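/- **Setting.** Let $(Z_t)_{t\in\mathbb Z}$ be independent standard normal random variables and, for $T\in\mathbb N$ and $1\le t\le T$, let $$X_{t,T}=\sum_{l=0}^{\infty}\psi_{t,T,l}Z_{t-l}\quad\text{(convergence in }L^2),\qquad \sup_{T}\sup_{1\le t\le T}\sum_{l=0}^\infty\psi_{t,T,l}^2<\infty ,$$ with real coefficients $\psi_{t,T,l}$. Write $I(l)=|l|$ for $l\neq0$ and $I(0)=1$. Assume that there are twice continuously differentiable functions $\psi_l:[0,1]\to\mathbb R$ ($l\ge 0$), twice differentiable functions $a,d:[0,1]\to[0,\infty)$ and a constant $C>0$ such that, with $d_\infty=\sup_{u\in[0,1]}d(u)$: 1. $|\psi_{t,T,l}-\psi_l(t/T)|\le \dfrac{C}{T\,I(l)^{1-d_\infty}}$ for all $T\ge1$, $1\le t\le T$, $l\ge0$, and $\psi_l(u)=\dfrac{a(u)}{I(l)^{1-d(u)}}+O\Big(\dfrac1{I(l)^{2-d_\infty}}\Big)$ uniformly in $u\in[0,1]$ as $l\to\infty$. 2. The time varying spectral density $f(u,\lambda)=\frac1{2\pi}\big|\sum_{l=0}^\infty\psi_l(u)e^{-i\lambda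 l}\big|^2$ (limit of the partial sums) is twice continuously differentiable on $(0,1)\times(0,\pi)$, and $f$ and all its partial derivatives up to order two are continuous on $[0,1]\times(0,\pi]$. 3. For all $l\ge2$, $\sup_{u\in(0,1)}|\psi_l'(u)|\le \dfrac{C\log l}{l^{1-d_\infty}}$ and $\sup_{u\in(0,1)}|\psi_l''(u)|\le \dfrac{C\log^2 l}{l^{1-d_\infty}}$; for all $\lambda\in(0,\pi)$, $\sup_{u\in(0,1)}\big|\frac{\partial}{\partial u}f(u,\lambda)\big|\le \dfrac{C(1+|\log\lambda|)}{\lambda^{2d_\infty}}$ and $\sup_{u\in(0,1)}\big|\frac{\partial^2}{\partial u^2}f(u,\lambda)\big|\le \dfrac{C(1+\log^2\lambda)}{\lambda^{2d_\infty}}$. Let the sample size be $T=NM$ with positive integers $N,M$, $N$ even. For $u\in[0,1]$ and $\lambda\in\mathbb R$ put $$I_N(u,\lambda)=\frac1{2\pi N}\Big|\sum_{s=0}^{N-1}X_{\lfloor uT\rfloor-N/2+1+s,\,T}\,e^{-i\lambda s}\Big|^2,\qquad X_{j,T}:=0\ \text{ for } j\notin\{1,\dots,T\},$$ and let $u_j=\frac{N(j-1)+N/2}{T}$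 ($1\le j\le M$), $\lambda_{k,N}=2\pi k/N$, and $$\hat\tau_1^2=\frac1{6T}\sum_{k=1}^{\lfloor N/2\rfloor}\sum_{j=1}^{M}I_N(u_j,\lambda_{k,N})^4 .$$ **Theorem 3.4.** Suppose that $d_\infty<1/8$ and that, along a sequence of sample sizes $T=NM\to\infty$, $$N\to\infty,\qquad \frac NT\to0,\qquad \frac{\sqrt T}{N^{1-4d_\infty}}\to0 .$$ Then $f^4$ is integrable on $[0,1]\times[-\pi,\pi]$ and $$\hat\tau_1^2\ \longrightarrow\ \frac1\pi\int_{-\pi}^{\pi}\int_0^1 f^4(u,\lambda)\,du\,d\lambda\qquad\text{in probability.}$$ -/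

import Mathlib

open MeasureTheory ProbabilityTheory Filter Topology

namespace LongMemory

noncomputable section

/-- `|x|` for `x ≠ 0`, and `1` for `x = 0`. -/
def idx (l : ℕ) : ℝ := if l = 0 then 1 else (l : ℝ)

/-- The supremum of the time varying long-memory parameter `d` over `[0,1]`. -/
def dInf (d : ℝ → ℝ) : ℝ := sSup (d '' Set.Icc 0 1)

/-- The transfer function `∑_{l ≥ 0} ψ_l(u) e^{-iλl}`. The series need not converge absolutely, so
its value is the limit of the partial sums (and not an unconditional sum). -/
def transfer (ψ : ℕ → ℝ → ℝ) (u lam : ℝ) : ℂ :=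
  limUnder atTop (fun n : ℕ => ∑ l ∈ Finset.range n,
    (ψ l u : ℂ) * Complex.exp (-(Complex.I * (lam : ℂ) * (l : ℂ))))

/-- The time varying spectral density `f(u,λ) = (2π)⁻¹ |∑_{l ≥ 0} ψ_l(u) e^{-iλl}|²`. -/
def spectralDensity (ψ : ℕ → ℝ → ℝ) (u lam : ℝ) : ℝ :=
  1 / (2 * Real.pi) * ‖transfer ψ u lam‖ ^ 2

/-- `g : [0,1] → ℝ` is twice differentiable (one-sided derivatives at the end points). -/
def TwiceDifferentiable (g : ℝ → ℝ) : Prop :=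
  DifferentiableOn ℝ g (Set.Icc 0 1) ∧
    DifferentiableOn ℝ (derivWithin g (Set.Icc 0 1)) (Set.Icc 0 1)

/-- A locally stationary long-memory process `X_{t,T} = ∑_{l ≥ 0} ψ_{t,T,l} Z_{t-l}`,
`1 ≤ t ≤ T`, with independent standard normal innovations `Z_t`, `t ∈ ℤ`.
Here `X t T` is `X_{t,T}`, `c t T l` is the coefficient `ψ_{t,T,l}`, and `ψ l u` is the
approximating coefficient `ψ_l(u)`, `u ∈ [0,1]`. Values of `X` and `c` outside `1 ≤ t ≤ T`, and
values of `ψ l`, `a`, `d` outside `[0,1]`, are irrelevant. -/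
structure IsLocallyStationary {Ω : Type*} [MeasurableSpace Ω] (P : Measure Ω)
    (Z : ℤ → Ω → ℝ) (X : ℤ → ℕ → Ω → ℝ) (c : ℤ → ℕ → ℕ → ℝ)
    (ψ : ℕ → ℝ → ℝ) (a d : ℝ → ℝ) : Prop where
  /-- The innovations are independent ... -/
  indep : iIndepFun Z P
  /-- ... and standard normal. -/
  gaussian : ∀ t : ℤ, HasLaw (Z t) (gaussianReal 0 1) P
  measurable_X : ∀ T : ℕ, ∀ t : ℤ, 1 ≤ t → t ≤ (T : ℤ) → AEStronglyMeasurable (X t T) P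
  /-- The moving average representation; the series converges in `L²`. -/
  representation : ∀ T : ℕ, ∀ t : ℤ, 1 ≤ t → t ≤ (T : ℤ) →
    Tendsto (fun n : ℕ => eLpNorm
      (fun ω => X t T ω - ∑ l ∈ Finset.range n, c t T l * Z (t - (l : ℤ)) ω) 2 P)
      atTop (𝓝 0)
  /-- `sup_T sup_{1 ≤ t ≤ T} ∑_l ψ_{t,T,l}² < ∞`. -/
  square_summable : ∃ C : ℝ, ∀ T : ℕ, ∀ t : ℤ, 1 ≤ t → t ≤ (T : ℤ) →
    Summable (fun l : ℕ => c t T l ^ 2) ∧ ∑' l : ℕ, c t T l ^ 2 ≤ C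
  contDiff_ψ : ∀ l : ℕ, ContDiffOn ℝ 2 (ψ l) (Set.Icc 0 1)
  a_nonneg : ∀ u ∈ Set.Icc (0 : ℝ) 1, 0 ≤ a u
  d_nonneg : ∀ u ∈ Set.Icc (0 : ℝ) 1, 0 ≤ d u
  twiceDiff_a : TwiceDifferentiable a
  twiceDiff_d : TwiceDifferentiable d
  /-- `|ψ_{t,T,l} - ψ_l(t/T)| ≤ C / (T I(l)^{1-d_∞})`. -/
  approx : ∃ C : ℝ, ∀ T : ℕ, ∀ t : ℤ, 1 ≤ t → t ≤ (T : ℤ) → ∀ l : ℕ,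
    |c t T l - ψ l ((t : ℝ) / (T : ℝ))| ≤ C / ((T : ℝ) * idx l ^ (1 - dInf d))
  /-- `ψ_l(u) = a(u) / I(l)^{1-d(u)} + O(1 / I(l)^{2-d_∞})`, uniformly in `u`, as `l → ∞`. -/
  asymptotics : ∃ C : ℝ, ∀ᶠ l : ℕ in atTop, ∀ u ∈ Set.Icc (0 : ℝ) 1,
    |ψ l u - a u / idx l ^ (1 - d u)| ≤ C / idx l ^ (2 - dInf d)
  /-- `f` is twice continuously differentiable in `(0,1) × (0,π)`, and `f` and its partial
  derivatives up to order two are continuous on `[0,1] × (0,π]`. -/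
  contDiff_f : ContDiffOn ℝ 2 (fun p : ℝ × ℝ => spectralDensity ψ p.1 p.2)
    (Set.Icc 0 1 ×ˢ Set.Ioc 0 Real.pi)
  /-- `|ψ_l'(u)| ≤ C log l / l^{1-d_∞}`. (At `l = 1` the right-hand side is `0`, so `l ≥ 2`; the
  derivatives of `ψ_0`, `ψ_1` are bounded anyway.) -/
  deriv_ψ : ∃ C : ℝ, ∀ l : ℕ, 2 ≤ l → ∀ u ∈ Set.Ioo (0 : ℝ) 1,
    |deriv (ψ l) u| ≤ C * Real.log l / (l : ℝ) ^ (1 - dInf d)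
  /-- `|ψ_l''(u)| ≤ C log² l / l^{1-d_∞}`. -/
  deriv2_ψ : ∃ C : ℝ, ∀ l : ℕ, 2 ≤ l → ∀ u ∈ Set.Ioo (0 : ℝ) 1,
    |iteratedDeriv 2 (ψ l) u| ≤ C * Real.log l ^ 2 / (l : ℝ) ^ (1 - dInf d)
  /-- `|∂f/∂u (u,λ)| ≤ C (1 + |log λ|) / λ^{2d_∞}`. -/
  deriv_f : ∃ C : ℝ, ∀ u ∈ Set.Ioo (0 : ℝ) 1, ∀ lam ∈ Set.Ioo 0 Real.pi,
    |deriv (fun v => spectralDensity ψ v lam) u|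
      ≤ C * (1 + |Real.log lam|) / lam ^ (2 * dInf d)
  /-- `|∂²f/∂u² (u,λ)| ≤ C (1 + log² λ) / λ^{2d_∞}`. -/
  deriv2_f : ∃ C : ℝ, ∀ u ∈ Set.Ioo (0 : ℝ) 1, ∀ lam ∈ Set.Ioo 0 Real.pi,
    |iteratedDeriv 2 (fun v => spectralDensity ψ v lam) u|
      ≤ C * (1 + Real.log lam ^ 2) / lam ^ (2 * dInf d)

/-- The observation `X_{t,T}`, put equal to `0` for `t ∉ {1, …, T}`. -/
def obs {Ω : Type*} (X : ℤ → ℕ → Ω → ℝ) (T : ℕ) (t : ℤ) (ω : Ω) : ℝ :=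
  if 1 ≤ t ∧ t ≤ (T : ℤ) then X t T ω else 0

/-- The local periodogram
`I_N(u,λ) = (2πN)⁻¹ |∑_{s=0}^{N-1} X_{⌊uT⌋-N/2+1+s,T} e^{-iλs}|²` (for even `N`). -/
def localPeriodogram {Ω : Type*} (X : ℤ → ℕ → Ω → ℝ) (T N : ℕ) (u lam : ℝ) (ω : Ω) : ℝ :=
  1 / (2 * Real.pi * (N : ℝ)) *
    ‖∑ s ∈ Finset.range N,
      (obs X T (⌊u * (T : ℝ)⌋ - ((N / 2 : ℕ) : ℤ) + 1 + (s : ℤ)) ω : ℂ) *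
        Complex.exp (-(Complex.I * (lam : ℂ) * (s : ℂ)))‖ ^ 2

/-- The rescaled mid-point `u_j = (N(j-1) + N/2)/T` of the `j`-th block. -/
def blockMid (T N j : ℕ) : ℝ := ((N : ℝ) * ((j : ℝ) - 1) + (N : ℝ) / 2) / (T : ℝ)

/-- The Fourier frequency `λ_{k,N} = 2πk/N`. -/
def fourierFreq (N k : ℕ) : ℝ := 2 * Real.pi * (k : ℝ) / (N : ℝ)

/-- `τ̂₁² = (6T)⁻¹ ∑_{k=1}^{⌊N/2⌋} ∑_{j=1}^{M} I_N(u_j, λ_{k,N})⁴`, with `T = NM`. -/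
def tauHatSq {Ω : Type*} (X : ℤ → ℕ → Ω → ℝ) (N M : ℕ) (ω : Ω) : ℝ :=
  1 / (6 * ((N * M : ℕ) : ℝ)) *
    ∑ k ∈ Finset.Icc 1 (N / 2), ∑ j ∈ Finset.Icc 1 M,
      localPeriodogram X (N * M) N (blockMid (N * M) N j) (fourierFreq N k) ω ^ 4

end

end LongMemory

namespace LongMemory

/-! ### Elementary estimates for power sums -/

/-! Write `A(u,λ)` for the transfer function, so `f = |A|²/(2π)`. On a block whose rescaled length
`N/T = 1/M` tends to zero, the process is nearly a stationary moving average, so the discrete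
Fourier transform (DFT) of the observations is nearly `A(u_j, λ_k)` times the DFT of the innovations
of the same block. Hence `I_N(u_j, λ_k)⁴` is nearly `f(u_j, λ_k)⁴ |ξ|⁸`, with `ξ` the innovation DFT
divided by `√N`. For `1 ≤ k < N/2` the variables `ξ` are standard complex normal, independent over
distinct pairs `(k, j)`, with `E|ξ|⁸ = 4! = 24`. After the prefactor `1/6` the estimator is
therefore close to `4/T` times the sum of `f⁴` over the grid, a Riemann sum with limit `(4/(2π))
∫_0^π ∫_0^1 f⁴`. Evenness in `λ` turns this into the integral over `[-π, π]`.

The difficulty is the pole at frequency zero. Fix `b` with `d_∞ < b < 1/8`. Coefficient sums over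
lags `≥ p` are `O(λ⁻¹ p^(b-1))` by summation by parts, and over any range of lags `O(λ^(-b))`;
`CoefBound` records this for `ψ` and for the time varying coefficients along a diagonal. Thus `f⁴ =
O(λ^(-8b))`, which is integrable.

The difference of the two DFTs is an `L²` limit of Gaussian linear forms whose coefficients have
square sum `O(N λ^(-2b))` (`sum_norm_sq_blockCoef_le`), and at most `ε N` once `λ ≥ δ` and the block
is long and short in rescaled time (`exists_sum_norm_sq_blockCoef_le`). Gaussian moments turn this
into normalised eighth moments `O(λ^(-8b))` and `O(ε⁴)`; since `8b < 1` their average over blocks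
and frequencies vanishes (`tendsto_average_zero`).

The inequality `|x⁸ - y⁸| ≤ η y⁸ + K |x - y|⁸` carries the approximation over to fourth powers of
periodograms in `L¹`. The fluctuations of `|ξ|⁸` about its mean are removed by a weak law with
weights `f⁴` (`integral_abs_weighted_sum_le`), and the frequency `π` contributes only `O(1/N)`. -/

lemma rpow_neg_sub_ge {s : ℝ} (hs : 0 < s) {x : ℝ} (hx : 1 ≤ x) :
    s * 2 ^ (-1 - s) * x ^ (-1 - s) ≤ x ^ (-s) - (x + 1) ^ (-s) := by
  have hx0 : 0 < x := by linarith
  have h1 : 1 / (x + 1) ≤ Real.log ((x + 1) / x) := by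
    have := Real.one_sub_inv_le_log_of_pos (x := (x + 1) / x) (by positivity)
    refine le_trans (le_of_eq ?_) this
    field_simp
    ring
  have h2 : 1 + s / (x + 1) ≤ ((x + 1) / x) ^ s := by
    rw [Real.rpow_def_of_pos (by positivity)]
    refine le_trans ?_ (Real.add_one_le_exp _)
    have := mul_le_mul_of_nonneg_left h1 hs.le
    have e : s * (1 / (x + 1)) = s / (x + 1) := by ring
    linarith
  have h3 : x ^ (-s) = (x + 1) ^ (-s) * ((x + 1) / x) ^ s := by
    rw [Real.div_rpow (by positivity) hx0.le, Real.rpow_neg (by positivity),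
      Real.rpow_neg (by positivity)]
    have : (x + 1) ^ s ≠ 0 := (Real.rpow_pos_of_pos (by positivity) _).ne'
    field_simp
  have h4 : (2 * x) ^ (-1 - s) ≤ (x + 1) ^ (-1 - s) :=
    -- Here `x + 1 ≤ 2 x` for `x ≥ 1`, which is the origin of the factor `2 ^ (-1 - s)`.
    Real.rpow_le_rpow_of_nonpos (by positivity) (by linarith) (by linarith)
  have h5 : (x + 1) ^ (-1 - s) = (x + 1) ^ (-s) / (x + 1) := by
    rw [show -1 - s = -s - 1 by ring, Real.rpow_sub_one (by positivity)]
  rw [mul_assoc, ← Real.mul_rpow (by norm_num) hx0.le]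
  have h6 : 0 ≤ (x + 1) ^ (-s) := by positivity
  calc s * (2 * x) ^ (-1 - s) ≤ s * (x + 1) ^ (-1 - s) := by gcongr
    _ = (x + 1) ^ (-s) * (1 + s / (x + 1)) - (x + 1) ^ (-s) := by rw [h5]; ring
    _ ≤ _ := by rw [h3]; gcongr

/-- By `rpow_neg_sub_ge` each summand is dominated by a multiple of a telescoping difference, so the
bound is free of `q`. -/
lemma sum_Ico_rpow_le {s : ℝ} (hs : 0 < s) (p q : ℕ) (hp : 1 ≤ p) :
    ∑ l ∈ Finset.Ico p q, (l : ℝ) ^ (-1 - s) ≤ (s * 2 ^ (-1 - s))⁻¹ * (p : ℝ) ^ (-s) := by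
  have hK : 0 < s * (2 : ℝ) ^ (-1 - s) := by positivity
  rw [le_inv_mul_iff₀ hK, Finset.mul_sum]
  rcases le_or_gt q p with h | h
  · rw [Finset.Ico_eq_empty (by omega)]
    simp only [Finset.sum_empty]
    positivity
  · have : ∀ q, p ≤ q → ∑ l ∈ Finset.Ico p q, s * 2 ^ (-1 - s) * (l : ℝ) ^ (-1 - s)
        ≤ (p : ℝ) ^ (-s) - (q : ℝ) ^ (-s) := by
      intro q hq
      induction q, hq using Nat.le_induction with
      | base => simp
      | succ q hq ih =>
        rw [Finset.sum_Ico_succ_top hq]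
        have := rpow_neg_sub_ge hs (x := q) (by exact_mod_cast hp.trans hq)
        push_cast
        linarith
    refine (this q h.le).trans ?_
    have : 0 ≤ (q : ℝ) ^ (-s) := by positivity
    linarith

/-- Induction on the upper end: concavity of `x ^ b`, in the form of Bernoulli's inequality, shows
that `(q + 1) ^ b / b - q ^ b / b` dominates the new summand. -/
lemma sum_Ico_one_rpow_le {b : ℝ} (hb : 0 < b) (hb1 : b ≤ 1) (q : ℕ) :
    ∑ l ∈ Finset.Ico 1 q, (l : ℝ) ^ (b - 1) ≤ (q : ℝ) ^ b / b := by
  have key : ∀ q : ℕ, ∑ l ∈ Finset.Ico 1 (q + 1), (l : ℝ) ^ (b - 1) ≤ (q : ℝ) ^ b / b := by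
    intro q
    induction q with
    | zero => simp [Real.zero_rpow hb.ne']
    | succ q ih =>
      rw [Finset.sum_Ico_succ_top (by omega)]
      refine (add_le_add_left ih _).trans ?_
      push_cast
      have hx : (0 : ℝ) < q + 1 := by positivity
      have h := rpow_one_add_le_one_add_mul_self (s := -1 / ((q : ℝ) + 1)) (p := b)
        (by rw [le_div_iff₀ hx]; nlinarith [(Nat.cast_nonneg q : (0:ℝ) ≤ q)]) hb.le hb1
      have e : (1 : ℝ) + -1 / (q + 1) = q / (q + 1) := by field_simp; ring
      rw [e, Real.div_rpow (by positivity) hx.le, div_le_iff₀ (by positivity)] at h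
      rw [Real.rpow_sub_one hx.ne', div_add' _ _ _ hb.ne', div_le_div_iff_of_pos_right hb]
      calc (q : ℝ) ^ b + (q + 1 : ℝ) ^ b / (q + 1) * b
          ≤ (1 + b * (-1 / (q + 1))) * (q + 1 : ℝ) ^ b + (q + 1 : ℝ) ^ b / (q + 1) * b := by gcongr
        _ = _ := by ring
  rcases Nat.eq_zero_or_pos q with rfl | hq
  · simp only [zero_le, Finset.Ico_eq_empty_of_le, Finset.sum_empty]; positivity
  · obtain ⟨r, rfl⟩ : ∃ r, q = r + 1 := ⟨q - 1, by omega⟩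
    refine (key r).trans ?_
    gcongr
    omega

/-! ### Summation by parts -/

lemma one_sub_mul_sum_Ico (z : ℂ) (g : ℕ → ℂ) {p q : ℕ} (hpq : p ≤ q) :
    (1 - z) * ∑ l ∈ Finset.Ico p q, g l * z ^ l =
      g p * z ^ p - g q * z ^ q + ∑ l ∈ Finset.Ico p q, (g (l + 1) - g l) * z ^ (l + 1) := by
  induction q, hpq using Nat.le_induction with
  | base => simp
  | succ q hq ih =>
    rw [Finset.sum_Ico_succ_top hq, Finset.sum_Ico_succ_top hq, mul_add, ih]
    ring

/-- The basic oscillating factor `e^{-iλ}`. -/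
noncomputable def phase (lam : ℝ) : ℂ := Complex.exp (-(Complex.I * (lam : ℂ)))

lemma exp_eq_phase_pow (lam : ℝ) (l : ℕ) :
    Complex.exp (-(Complex.I * (lam : ℂ) * (l : ℂ))) = phase lam ^ l := by
  rw [phase, ← Complex.exp_nat_mul]
  congr 1
  ring

lemma norm_phase (lam : ℝ) : ‖phase lam‖ = 1 := by
  rw [phase, show -(Complex.I * (lam : ℂ)) = ((-lam : ℝ) : ℂ) * Complex.I by push_cast; ring,
    Complex.norm_exp_ofReal_mul_I]

/-- The left factor comes from `|1 - e^{-iλ}| = 2 |sin(λ/2)|` and Jordan's inequality on `[0, π/2]`.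
-/
lemma le_norm_one_sub_phase {lam : ℝ} (h0 : 0 < lam) (hpi : lam ≤ Real.pi) :
    2 / Real.pi * lam ≤ ‖1 - phase lam‖ := by
  have h : ‖1 - phase lam‖ = ‖2 * Real.sin (lam / 2)‖ := by
    have h1 := Complex.norm_exp_I_mul_ofReal_sub_one (-lam)
    rw [norm_sub_rev, phase, show -(Complex.I * (lam : ℂ)) = Complex.I * ((-lam : ℝ) : ℂ) by
      push_cast; ring, h1, neg_div, Real.sin_neg, mul_neg, norm_neg]
  rw [h, Real.norm_eq_abs]
  have := Real.mul_le_sin (x := lam / 2) (by linarith) (by linarith)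
  calc 2 / Real.pi * lam = 2 * (2 / Real.pi * (lam / 2)) := by ring
    _ ≤ 2 * Real.sin (lam / 2) := by gcongr
    _ ≤ _ := le_abs_self _

/-- Abel summation divided by `|1 - e^{-iλ}| ≥ λ/2`: boundary values and total variation replace the
sum of absolute values. -/
lemma norm_sum_mul_phase_pow_le (g : ℕ → ℝ) {p q : ℕ} (hpq : p ≤ q) {lam : ℝ}
    (h0 : 0 < lam) (hpi : lam ≤ Real.pi) :
    ‖∑ l ∈ Finset.Ico p q, (g l : ℂ) * phase lam ^ l‖ ≤
      2 / lam * (|g p| + |g q| + ∑ l ∈ Finset.Ico p q, |g (l + 1) - g l|) := by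
  have h1 := one_sub_mul_sum_Ico (phase lam) (fun l => (g l : ℂ)) hpq
  have h2 := le_norm_one_sub_phase h0 hpi
  have h3 : ‖1 - phase lam‖ * ‖∑ l ∈ Finset.Ico p q, (g l : ℂ) * phase lam ^ l‖ ≤
      |g p| + |g q| + ∑ l ∈ Finset.Ico p q, |g (l + 1) - g l| := by
    rw [← norm_mul, h1]
    refine (norm_add_le _ _).trans (add_le_add ((norm_sub_le _ _).trans_eq ?_)
      ((norm_sum_le _ _).trans_eq ?_))
    · simp [norm_phase]
    · refine Finset.sum_congr rfl fun l _ => ?_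
      rw [norm_mul, norm_pow, norm_phase, one_pow, mul_one, ← Complex.ofReal_sub,
        Complex.norm_real, Real.norm_eq_abs]
  have h4 : (1 : ℝ) / 2 * lam ≤ 2 / Real.pi * lam := by
    refine mul_le_mul_of_nonneg_right ?_ h0.le
    rw [div_le_div_iff₀ (by norm_num) Real.pi_pos]
    linarith [Real.pi_le_four]
  rw [div_mul_eq_mul_div, le_div_iff₀ h0]
  have := mul_le_mul_of_nonneg_right (h4.trans h2)
    (norm_nonneg (∑ l ∈ Finset.Ico p q, (g l : ℂ) * phase lam ^ l))
  linarith

/-! ### Power profiles with slowly varying parameters -/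

/-- Varying the exponent costs a factor `log x`, which is absorbed by the gap between `m` and `b`.
This is why the working exponent is taken strictly above `d_∞`. -/
lemma abs_rpow_sub_rpow_le {x s t m b : ℝ} (hx : 1 ≤ x) (hs : s ≤ m) (ht : t ≤ m) (hb : m < b) :
    |x ^ s - x ^ t| ≤ (b - m)⁻¹ * |s - t| * x ^ b := by
  wlog hst : t ≤ s generalizing s t
  · rw [abs_sub_comm, abs_sub_comm s]
    exact this ht hs (le_of_not_ge hst)
  have hx0 : 0 < x := by linarith
  have h1 : 0 ≤ x ^ s - x ^ t := sub_nonneg.2 (Real.rpow_le_rpow_of_exponent_le hx hst)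
  rw [abs_of_nonneg h1, abs_of_nonneg (sub_nonneg.2 hst)]
  have h2 : x ^ t = x ^ s * x ^ (t - s) := by rw [← Real.rpow_add hx0]; congr 1; ring
  have h3 : 1 + (t - s) * Real.log x ≤ x ^ (t - s) := by
    rw [Real.rpow_def_of_pos hx0]
    linarith [Real.add_one_le_exp (Real.log x * (t - s))]
  have h4 : Real.log x ≤ x ^ (b - m) / (b - m) := Real.log_le_rpow_div hx0.le (by linarith)
  have h5 : x ^ m * x ^ (b - m) = x ^ b := by rw [← Real.rpow_add hx0]; congr 1; ring
  have h6 : x ^ s ≤ x ^ m := Real.rpow_le_rpow_of_exponent_le hx hs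
  have h7 : 0 ≤ x ^ s := by positivity
  have h8 : 0 ≤ s - t := by linarith
  have h9 : 0 ≤ Real.log x := Real.log_nonneg hx
  calc x ^ s - x ^ t ≤ x ^ s * ((s - t) * Real.log x) := by rw [h2]; nlinarith
    _ ≤ x ^ m * ((s - t) * (x ^ (b - m) / (b - m))) := by gcongr
    _ = (b - m)⁻¹ * (s - t) * (x ^ m * x ^ (b - m)) := by rw [div_eq_mul_inv]; ring
    _ = _ := by rw [h5]

/-- Monotonicity of `x ^ r` reduces the difference to `x ^ r (1/x - 1/(x+1))`, which is at most `x ^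
(r - 2)`. -/
lemma abs_rpow_succ_sub_le {x r b : ℝ} (hx : 1 ≤ x) (hr0 : 0 ≤ r) (hr : r ≤ b) (hb : b ≤ 1) :
    |(x + 1) ^ (r - 1) - x ^ (r - 1)| ≤ x ^ (b - 2) := by
  have hx0 : 0 < x := by linarith
  have h1 : (x + 1) ^ (r - 1) ≤ x ^ (r - 1) :=
    Real.rpow_le_rpow_of_nonpos hx0 (by linarith) (by linarith)
  rw [abs_sub_comm, abs_of_nonneg (by linarith), Real.rpow_sub_one hx0.ne',
    Real.rpow_sub_one (by positivity)]
  have h2 : x ^ r ≤ (x + 1) ^ r := Real.rpow_le_rpow hx0.le (by linarith) hr0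
  have h3 : x ^ (b - 2) = x ^ b / x ^ 2 := by
    rw [Real.rpow_sub hx0, Real.rpow_two]
  have h4 : x ^ r ≤ x ^ b := Real.rpow_le_rpow_of_exponent_le hx hr
  have h5 : 0 ≤ x ^ r := by positivity
  rw [h3]
  calc x ^ r / x - (x + 1) ^ r / (x + 1) ≤ x ^ r / x - x ^ r / (x + 1) := by gcongr
    _ = x ^ r / (x * (x + 1)) := by field_simp; ring
    _ ≤ x ^ r / x ^ 2 := by gcongr; nlinarith
    _ ≤ _ := by gcongr

end LongMemory

namespace LongMemory

/-- On `[p, q)` the sequence `g` is close to `α_l l^{δ_l - 1}`, where `α` and `δ` vary slowly, at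
rate `h`, and `0 ≤ δ ≤ m`. -/
structure IsProfile (m κ h : ℝ) (p q : ℕ) (g α δ : ℕ → ℝ) : Prop where
  abs_α_le : ∀ l, |α l| ≤ κ
  δ_nonneg : ∀ l, 0 ≤ δ l
  δ_le : ∀ l, δ l ≤ m
  abs_α_sub_le : ∀ l, |α (l + 1) - α l| ≤ κ * h
  abs_δ_sub_le : ∀ l, |δ (l + 1) - δ l| ≤ κ * h
  abs_zero_le : 0 ∈ Finset.Ico p q → |g 0| ≤ κ
  abs_sub_le : ∀ l ∈ Finset.Ico p q, 1 ≤ l →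
    |g l - α l * (l : ℝ) ^ (δ l - 1)| ≤ κ * ((l : ℝ) ^ (m - 2) + h * (l : ℝ) ^ (m - 1))
  nonneg : 0 ≤ h
  le_one : h ≤ 1
  length_mul_le : ((q - p : ℕ) : ℝ) * h ≤ 1

/-! ### Trigonometric sums of power profiles. -/

namespace IsProfile

variable {m κ h : ℝ} {p q : ℕ} {g α δ : ℕ → ℝ}

lemma κ_nonneg (H : IsProfile m κ h p q g α δ) : 0 ≤ κ := (abs_nonneg _).trans (H.abs_α_le 0)

lemma mono (H : IsProfile m κ h p q g α δ) {p' q' : ℕ} (hp : p ≤ p') (hq : q' ≤ q) :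
    IsProfile m κ h p' q' g α δ where
  abs_α_le := H.abs_α_le
  δ_nonneg := H.δ_nonneg
  δ_le := H.δ_le
  abs_α_sub_le := H.abs_α_sub_le
  abs_δ_sub_le := H.abs_δ_sub_le
  abs_zero_le h0 := H.abs_zero_le (Finset.Ico_subset_Ico hp hq h0)
  abs_sub_le l hl := H.abs_sub_le l (Finset.Ico_subset_Ico hp hq hl)
  nonneg := H.nonneg
  le_one := H.le_one
  length_mul_le := le_trans (mul_le_mul_of_nonneg_right
    (by exact_mod_cast (by omega : q' - p' ≤ q - p)) H.nonneg) H.length_mul_le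

/-- One `κ` pays for the power itself, the other two for the two error terms. -/
lemma abs_le (H : IsProfile m κ h p q g α δ) {b : ℝ} (hb : m < b) {l : ℕ}
    (hl : l ∈ Finset.Ico p q) (hl1 : 1 ≤ l) : |g l| ≤ 3 * κ * (l : ℝ) ^ (b - 1) := by
  have hx : (1 : ℝ) ≤ l := by exact_mod_cast hl1
  have h1 := H.abs_sub_le l hl hl1
  have h2 : |α l * (l : ℝ) ^ (δ l - 1)| ≤ κ * (l : ℝ) ^ (b - 1) := by
    rw [abs_mul, abs_of_nonneg (by positivity : 0 ≤ (l : ℝ) ^ (δ l - 1))]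
    refine mul_le_mul (H.abs_α_le l) (Real.rpow_le_rpow_of_exponent_le hx ?_) (by positivity)
      H.κ_nonneg
    linarith [H.δ_le l]
  have h3 : (l : ℝ) ^ (m - 2) ≤ (l : ℝ) ^ (b - 1) :=
    Real.rpow_le_rpow_of_exponent_le hx (by linarith)
  have h4 : h * (l : ℝ) ^ (m - 1) ≤ (l : ℝ) ^ (b - 1) := by
    refine (mul_le_of_le_one_left (by positivity) H.le_one).trans
      (Real.rpow_le_rpow_of_exponent_le hx (by linarith))
  have h5 : |g l| ≤ |g l - α l * (l : ℝ) ^ (δ l - 1)| + |α l * (l : ℝ) ^ (δ l - 1)| := by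
    simpa using abs_add_le (g l - α l * (l : ℝ) ^ (δ l - 1)) (α l * (l : ℝ) ^ (δ l - 1))
  have h6 : κ * ((l : ℝ) ^ (m - 2) + h * (l : ℝ) ^ (m - 1)) ≤
      κ * ((l : ℝ) ^ (b - 1) + (l : ℝ) ^ (b - 1)) :=
    mul_le_mul_of_nonneg_left (add_le_add h3 h4) H.κ_nonneg
  linarith

/-- The increment is split into the change of `α`, the change of the exponent at base `l + 1`, and
the change of the base at fixed exponent. The first two are of order `h` uniformly in `l`; only the
third decays, and it is summable. -/
lemma abs_main_sub_le (H : IsProfile m κ h p q g α δ) {b : ℝ} (hb : m < b) (hb1 : b < 1)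
    {l : ℕ} (hp : 1 ≤ p) (hl : l ∈ Finset.Ico p q) :
    |α (l + 1) * ((l + 1 : ℕ) : ℝ) ^ (δ (l + 1) - 1) - α l * (l : ℝ) ^ (δ l - 1)| ≤
      (κ + κ * ((b - m)⁻¹ * κ)) * h * (p : ℝ) ^ (b - 1) + κ * (l : ℝ) ^ (b - 2) := by
  have hpl : p ≤ l := (Finset.mem_Ico.1 hl).1
  have hx : (1 : ℝ) ≤ l := by exact_mod_cast hp.trans hpl
  have hp1 : (1 : ℝ) ≤ p := by exact_mod_cast hp
  have hpl' : (p : ℝ) ≤ l + 1 := by exact_mod_cast hpl.trans (Nat.le_succ l)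
  push_cast
  have hκ := H.κ_nonneg
  have hh := H.nonneg
  have hbm : 0 < b - m := by linarith
  set x : ℝ := (l : ℝ)
  have e1 : (x + 1) ^ (b - 1) ≤ (p : ℝ) ^ (b - 1) :=
    Real.rpow_le_rpow_of_nonpos (by linarith) hpl' (by linarith)
  have e2 : (x + 1) ^ (δ (l + 1) - 1) ≤ (p : ℝ) ^ (b - 1) :=
    (Real.rpow_le_rpow_of_exponent_le (by linarith) (by linarith [H.δ_le (l + 1)])).trans e1
  have e3 := abs_rpow_sub_rpow_le (x := x + 1) (s := δ (l + 1) - 1) (t := δ l - 1) (m := m - 1)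
    (b := b - 1) (by linarith) (by linarith [H.δ_le (l + 1)]) (by linarith [H.δ_le l])
    (by linarith)
  rw [show b - 1 - (m - 1) = b - m by ring, show δ (l + 1) - 1 - (δ l - 1) = δ (l + 1) - δ l by ring]
    at e3
  have e4 := abs_rpow_succ_sub_le (x := x) (r := δ l) (b := b) hx (H.δ_nonneg l)
    (by linarith [H.δ_le l]) hb1.le
  have e5 : |(x + 1) ^ (δ (l + 1) - 1) - (x + 1) ^ (δ l - 1)| ≤
      (b - m)⁻¹ * (κ * h) * (p : ℝ) ^ (b - 1) := by
    refine e3.trans (mul_le_mul (mul_le_mul_of_nonneg_left (H.abs_δ_sub_le l) (by positivity)) e1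
      (by positivity) (by positivity))
  have d1 : |(α (l + 1) - α l) * (x + 1) ^ (δ (l + 1) - 1)| ≤ κ * h * (p : ℝ) ^ (b - 1) := by
    rw [abs_mul, abs_of_nonneg (by positivity : 0 ≤ (x + 1) ^ (δ (l + 1) - 1))]
    exact mul_le_mul (H.abs_α_sub_le l) e2 (by positivity) (by positivity)
  have d2 : |α l * ((x + 1) ^ (δ (l + 1) - 1) - (x + 1) ^ (δ l - 1))| ≤
      κ * ((b - m)⁻¹ * (κ * h) * (p : ℝ) ^ (b - 1)) := by
    rw [abs_mul]
    exact mul_le_mul (H.abs_α_le l) e5 (by positivity) (by positivity)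
  have d3 : |α l * ((x + 1) ^ (δ l - 1) - x ^ (δ l - 1))| ≤ κ * x ^ (b - 2) := by
    rw [abs_mul]
    exact mul_le_mul (H.abs_α_le l) e4 (by positivity) (by positivity)
  calc _ = |(α (l + 1) - α l) * (x + 1) ^ (δ (l + 1) - 1) +
        α l * ((x + 1) ^ (δ (l + 1) - 1) - (x + 1) ^ (δ l - 1)) +
        α l * ((x + 1) ^ (δ l - 1) - x ^ (δ l - 1))| := by congr 1; ring
    _ ≤ _ := (abs_add_three _ _ _).trans (add_le_add (add_le_add d1 d2) d3)
    _ = _ := by ring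

/-- Summation by parts is applied to the main part `M l = α l * l ^ (δ l - 1)` only. In its total
variation the drift of the parameters contributes at most length times `h` times `p ^ (b - 1)`, and
`length_mul_le` keeps this bounded; the change of base contributes the convergent sum of `l ^ (b -
2)`. The remainder `g - M` is summed in absolute value with the same result, and the missing `1 / λ`
is supplied by `1 ≤ 4 / λ`. -/
lemma norm_sum_le_tail (m κ : ℝ) {b : ℝ} (hb : m < b) (hb1 : b < 1) (hκ : 0 ≤ κ) :
    ∃ C, 0 ≤ C ∧ ∀ (h : ℝ) (p q : ℕ) (g α δ : ℕ → ℝ), IsProfile m κ h p q g α δ → 1 ≤ p →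
      ∀ lam, 0 < lam → lam ≤ Real.pi →
        ‖∑ l ∈ Finset.Ico p q, (g l : ℂ) * phase lam ^ l‖ ≤ C / lam * (p : ℝ) ^ (b - 1) := by
  have hbm : 0 < b - m := by linarith
  have hb1' : 0 < 1 - b := by linarith
  set K : ℝ := ((1 - b) * 2 ^ (-1 - (1 - b)))⁻¹ with hK
  have hK0 : 0 ≤ K := by positivity
  set B : ℝ := κ + κ * ((b - m)⁻¹ * κ) with hB
  have hB0 : 0 ≤ B := by positivity
  refine ⟨2 * (2 * κ + B + κ * K) + 4 * (κ * (K + 1)), by positivity, ?_⟩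
  intro h p q g α δ H hp lam hl0 hlpi
  have hp1 : (1 : ℝ) ≤ p := by exact_mod_cast hp
  rcases lt_or_ge q p with hqp | hpq
  · rw [Finset.Ico_eq_empty (by omega)]
    simp only [Finset.sum_empty, norm_zero]
    positivity
  have hsum : ∑ l ∈ Finset.Ico p q, (l : ℝ) ^ (b - 2) ≤ K * (p : ℝ) ^ (b - 1) := by
    have := sum_Ico_rpow_le hb1' p q hp
    rw [show -1 - (1 - b) = b - 2 by ring, show -(1 - b) = b - 1 by ring] at this
    rw [hK, show -1 - (1 - b) = b - 2 by ring]
    exact this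
  set P := (p : ℝ) ^ (b - 1) with hP
  have hP0 : 0 ≤ P := by positivity
  set M : ℕ → ℝ := fun l => α l * (l : ℝ) ^ (δ l - 1) with hM
  have hlen : ((q - p : ℕ) : ℝ) * h ≤ 1 := H.length_mul_le
  have hMle : ∀ l, p ≤ l → |M l| ≤ κ * P := by
    intro l hl
    have hx : (p : ℝ) ≤ l := by exact_mod_cast hl
    simp only [hM, abs_mul]
    rw [abs_of_nonneg (by positivity : 0 ≤ (l : ℝ) ^ (δ l - 1))]
    refine mul_le_mul (H.abs_α_le l) ?_ (by positivity) hκ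
    refine (Real.rpow_le_rpow_of_exponent_le (by linarith)
      (by linarith [H.δ_le l] : δ l - 1 ≤ b - 1)).trans ?_
    exact Real.rpow_le_rpow_of_nonpos (by linarith) hx (by linarith)
  have hdiff : ∑ l ∈ Finset.Ico p q, |M (l + 1) - M l| ≤ (B + κ * K) * P := by
    refine (Finset.sum_le_sum fun l hl => H.abs_main_sub_le hb hb1 hp hl).trans ?_
    rw [Finset.sum_add_distrib, Finset.sum_const, ← Finset.mul_sum, Nat.card_Ico, nsmul_eq_mul]
    have : ((q - p : ℕ) : ℝ) * (B * h * P) ≤ B * P := by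
      calc ((q - p : ℕ) : ℝ) * (B * h * P) = (((q - p : ℕ) : ℝ) * h) * (B * P) := by ring
        _ ≤ 1 * (B * P) := by gcongr
        _ = _ := one_mul _
    have h2 := mul_le_mul_of_nonneg_left hsum hκ
    linarith
  have hmain := norm_sum_mul_phase_pow_le M hpq hl0 hlpi
  have hres : ‖∑ l ∈ Finset.Ico p q, ((g l : ℂ) - M l) * phase lam ^ l‖ ≤ κ * (K + 1) * P := by
    refine (norm_sum_le _ _).trans ?_
    have hterm : ∀ l ∈ Finset.Ico p q, ‖((g l : ℂ) - M l) * phase lam ^ l‖ ≤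
        κ * (l : ℝ) ^ (b - 2) + κ * (h * P) := by
      intro l hl
      have hpl : p ≤ l := (Finset.mem_Ico.1 hl).1
      have hx : (p : ℝ) ≤ l := by exact_mod_cast hpl
      rw [norm_mul, norm_pow, norm_phase, one_pow, mul_one, ← Complex.ofReal_sub,
        Complex.norm_real, Real.norm_eq_abs]
      refine (H.abs_sub_le l hl (hp.trans hpl)).trans ?_
      have hh := H.nonneg
      rw [← mul_add]
      refine mul_le_mul_of_nonneg_left (add_le_add ?_ (mul_le_mul_of_nonneg_left ?_ hh)) hκ
      · exact Real.rpow_le_rpow_of_exponent_le (by linarith) (by linarith)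
      · exact (Real.rpow_le_rpow_of_exponent_le (by linarith)
          (by linarith : m - 1 ≤ b - 1)).trans
          (Real.rpow_le_rpow_of_nonpos (by linarith) hx (by linarith))
    refine (Finset.sum_le_sum hterm).trans ?_
    rw [Finset.sum_add_distrib, Finset.sum_const, ← Finset.mul_sum, Nat.card_Ico, nsmul_eq_mul]
    have : ((q - p : ℕ) : ℝ) * (κ * (h * P)) ≤ κ * P := by
      calc ((q - p : ℕ) : ℝ) * (κ * (h * P)) = (((q - p : ℕ) : ℝ) * h) * (κ * P) := by ring
        _ ≤ 1 * (κ * P) := by gcongr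
        _ = _ := one_mul _
    have h2 := mul_le_mul_of_nonneg_left hsum hκ
    linarith
  have hsplit : ∑ l ∈ Finset.Ico p q, (g l : ℂ) * phase lam ^ l =
      ∑ l ∈ Finset.Ico p q, (M l : ℂ) * phase lam ^ l +
        ∑ l ∈ Finset.Ico p q, ((g l : ℂ) - M l) * phase lam ^ l := by
    rw [← Finset.sum_add_distrib]
    exact Finset.sum_congr rfl fun l _ => by ring
  rw [hsplit]
  refine (norm_add_le _ _).trans ?_
  have h4 : 1 ≤ 4 / lam := by
    rw [le_div_iff₀ hl0]
    linarith [Real.pi_le_four]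
  have h5 : κ * (K + 1) * P ≤ 4 / lam * (κ * (K + 1) * P) :=
    le_mul_of_one_le_left (by positivity) h4
  have h6 : 2 / lam * (|M p| + |M q| + ∑ l ∈ Finset.Ico p q, |M (l + 1) - M l|) ≤
      2 / lam * (κ * P + κ * P + (B + κ * K) * P) := by
    have := hMle p le_rfl
    have := hMle q hpq
    gcongr
  calc _ ≤ 2 / lam * (κ * P + κ * P + (B + κ * K) * P) + 4 / lam * (κ * (K + 1) * P) := by
        linarith
    _ = _ := by ring

/-- The range is cut at the lag `P` of order `1 / λ`. Below it there is no useful oscillation and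
the absolute values add up to order `P ^ b`; above it the tail bound gives `λ⁻¹ P ^ (b - 1)`. Both
are of order `λ ^ (-b)`. -/
lemma norm_sum_le_head (m κ : ℝ) {b : ℝ} (hb0 : 0 < b) (hb : m < b) (hb1 : b < 1) (hκ : 0 ≤ κ) :
    ∃ C, 0 ≤ C ∧ ∀ (h : ℝ) (p q : ℕ) (g α δ : ℕ → ℝ), IsProfile m κ h p q g α δ →
      ∀ lam, 0 < lam → lam ≤ Real.pi →
        ‖∑ l ∈ Finset.Ico p q, (g l : ℂ) * phase lam ^ l‖ ≤ C * lam ^ (-b) := by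
  obtain ⟨C₁, hC₁, htail⟩ := norm_sum_le_tail m κ hb hb1 hκ
  refine ⟨κ * 4 ^ b + 3 * κ * (5 ^ b / b) + C₁, by positivity, ?_⟩
  intro h p q g α δ H lam hl0 hlpi
  have hl4 : lam ≤ 4 := hlpi.trans Real.pi_le_four
  have hlb : lam ^ (-b) = (lam⁻¹) ^ b := by rw [Real.rpow_neg hl0.le, Real.inv_rpow hl0.le]
  have hlb0 : 0 ≤ lam ^ (-b) := by positivity
  set P : ℕ := max 1 ⌈lam⁻¹⌉₊ with hPdef
  have hP1 : 1 ≤ P := le_max_left _ _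
  have hPge : lam⁻¹ ≤ P := (Nat.le_ceil _).trans (by exact_mod_cast le_max_right _ _)
  -- Rounding up adds at most `1`, and `1 ≤ 4 / λ` because `λ ≤ π ≤ 4`.
  have hPle : (P : ℝ) ≤ 5 * lam⁻¹ := by
    have h1 : 1 ≤ 4 * lam⁻¹ := by
      rw [← div_eq_mul_inv, le_div_iff₀ hl0]; linarith
    have h2 : 0 < lam⁻¹ := by positivity
    rw [hPdef, Nat.cast_max, Nat.cast_one]
    refine max_le (by linarith) ?_
    linarith [(Nat.ceil_lt_add_one h2.le).le]
  have hone : 1 ≤ 4 ^ b * lam ^ (-b) := by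
    rw [hlb, ← Real.mul_rpow (by norm_num) (by positivity)]
    refine Real.one_le_rpow ?_ hb0.le
    rw [← div_eq_mul_inv, le_div_iff₀ hl0]; linarith
  -- contribution of the lags below `P`
  have hlow : ∀ p' q', p ≤ p' → q' ≤ q → q' ≤ P →
      ‖∑ l ∈ Finset.Ico p' q', (g l : ℂ) * phase lam ^ l‖ ≤
        (κ * 4 ^ b + 3 * κ * (5 ^ b / b)) * lam ^ (-b) := by
    intro p' q' hp' hq' hqP
    have H' := H.mono hp' hq'
    refine (norm_sum_le _ _).trans ?_
    have hterm : ∀ l ∈ Finset.Ico p' q', ‖(g l : ℂ) * phase lam ^ l‖ ≤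
        (if l = 0 then κ else 3 * κ * (l : ℝ) ^ (b - 1)) := by
      intro l hl
      rw [norm_mul, norm_pow, norm_phase, one_pow, mul_one, Complex.norm_real, Real.norm_eq_abs]
      split_ifs with h0
      · subst h0; exact H'.abs_zero_le hl
      · exact H'.abs_le hb hl (by omega)
    refine (Finset.sum_le_sum hterm).trans ?_
    have hsub : Finset.Ico p' q' ⊆ insert 0 (Finset.Ico 1 P) := by
      intro l hl
      simp only [Finset.mem_insert, Finset.mem_Ico] at hl ⊢
      omega
    refine (Finset.sum_le_sum_of_subset_of_nonneg hsub fun l _ _ => by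
      split_ifs <;> positivity).trans ?_
    rw [Finset.sum_insert (by simp)]
    have h1 : ∑ l ∈ Finset.Ico 1 P, (if l = 0 then κ else 3 * κ * (l : ℝ) ^ (b - 1)) =
        3 * κ * ∑ l ∈ Finset.Ico 1 P, (l : ℝ) ^ (b - 1) := by
      rw [Finset.mul_sum]
      refine Finset.sum_congr rfl fun l hl => ?_
      rw [if_neg (by simp only [Finset.mem_Ico] at hl; omega)]
    have h2 := sum_Ico_one_rpow_le hb0 hb1.le P
    have h3 : (P : ℝ) ^ b ≤ 5 ^ b * lam ^ (-b) := by
      rw [hlb, ← Real.mul_rpow (by norm_num) (by positivity)]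
      exact Real.rpow_le_rpow (by positivity) hPle hb0.le
    have h4 : κ ≤ κ * (4 ^ b * lam ^ (-b)) := le_mul_of_one_le_right hκ hone
    rw [h1, if_pos rfl]
    calc κ + 3 * κ * ∑ l ∈ Finset.Ico 1 P, (l : ℝ) ^ (b - 1)
        ≤ κ * (4 ^ b * lam ^ (-b)) + 3 * κ * (5 ^ b * lam ^ (-b) / b) := by
          gcongr
          exact h2.trans (by gcongr)
      _ = _ := by ring
  have hhigh : ∀ p', p ≤ p' → P ≤ p' →
      ‖∑ l ∈ Finset.Ico p' q, (g l : ℂ) * phase lam ^ l‖ ≤ C₁ * lam ^ (-b) := by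
    intro p' hp' hPp
    refine (htail h p' q g α δ (H.mono hp' le_rfl) (hP1.trans hPp) lam hl0 hlpi).trans ?_
    have h1 : (p' : ℝ) ^ (b - 1) ≤ (lam⁻¹) ^ (b - 1) :=
      Real.rpow_le_rpow_of_nonpos (by positivity) (hPge.trans (by exact_mod_cast hPp))
        (by linarith)
    have h2 : (lam⁻¹) ^ (b - 1) = lam ^ (-b) * lam := by
      rw [Real.rpow_sub_one (by positivity), hlb]; field_simp
    calc C₁ / lam * (p' : ℝ) ^ (b - 1) ≤ C₁ / lam * (lam ^ (-b) * lam) := by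
          rw [← h2]; gcongr
      _ = _ := by field_simp
  have hfin : ∀ x y : ℝ, x ≤ (κ * 4 ^ b + 3 * κ * (5 ^ b / b)) * lam ^ (-b) →
      y ≤ C₁ * lam ^ (-b) → x + y ≤ (κ * 4 ^ b + 3 * κ * (5 ^ b / b) + C₁) * lam ^ (-b) := by
    intro x y hx hy
    linarith
  rcases le_total q P with hqP | hPq
  · have := hfin _ 0 (hlow p q le_rfl le_rfl hqP) (by positivity)
    linarith
  rcases le_total P p with hPp | hpP
  · have := hfin 0 _ (by positivity) (hhigh p le_rfl hPp)
    linarith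
  · rw [← Finset.sum_Ico_consecutive _ hpP hPq]
    exact (norm_add_le _ _).trans (hfin _ _ (hlow p P le_rfl hPq le_rfl) (hhigh P hpP le_rfl))

end IsProfile

end LongMemory

/-! ### Power profiles of the coefficients of the process. -/

namespace LongMemory

lemma exists_bound_of_continuousOn {g : ℝ → ℝ} (hg : ContinuousOn g (Set.Icc 0 1)) :
    ∃ K, ∀ u ∈ Set.Icc (0 : ℝ) 1, |g u| ≤ K := by
  obtain ⟨K, hK⟩ := isCompact_Icc.exists_bound_of_continuousOn hg
  exact ⟨K, fun u hu => by simpa using hK u hu⟩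

/-- The second derivative serves to make the first one continuous, hence bounded on the compact
interval. -/
lemma TwiceDifferentiable.exists_lipschitz {g : ℝ → ℝ} (hg : TwiceDifferentiable g) :
    ∃ K, 0 ≤ K ∧ ∀ u ∈ Set.Icc (0 : ℝ) 1, ∀ v ∈ Set.Icc (0 : ℝ) 1, |g u - g v| ≤ K * |u - v| := by
  obtain ⟨K, hK⟩ := exists_bound_of_continuousOn hg.2.continuousOn
  refine ⟨|K|, abs_nonneg _, fun u hu v hv => ?_⟩
  have := (convex_Icc (0 : ℝ) 1).norm_image_sub_le_of_norm_derivWithin_le hg.1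
    (C := |K|) (fun x hx => (by simpa using (hK x hx).trans (le_abs_self K))) hv hu
  simpa using this

/-- The projection of the real line to the unit interval. -/
noncomputable def clip (x : ℝ) : ℝ := Set.projIcc (0 : ℝ) 1 zero_le_one x

lemma clip_mem (x : ℝ) : clip x ∈ Set.Icc (0 : ℝ) 1 := (Set.projIcc (0 : ℝ) 1 zero_le_one x).2

lemma clip_of_mem {x : ℝ} (hx : x ∈ Set.Icc (0 : ℝ) 1) : clip x = x := by
  rw [clip, Set.projIcc_of_mem _ hx]

lemma abs_clip_sub_le (x y : ℝ) : |clip x - clip y| ≤ |x - y| := by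
  have := (LipschitzWith.projIcc (zero_le_one (α := ℝ))).dist_le_mul x y
  simpa [Subtype.dist_eq, Real.dist_eq, clip] using this

lemma div_mem_Icc {T : ℕ} {t : ℤ} (h1 : 1 ≤ t) (h2 : t ≤ (T : ℤ)) :
    (t : ℝ) / (T : ℝ) ∈ Set.Icc (0 : ℝ) 1 := by
  have h1' : (1 : ℝ) ≤ t := by exact_mod_cast h1
  have h2' : (t : ℝ) ≤ T := by exact_mod_cast h2
  exact ⟨by positivity, (div_le_one (by linarith)).2 h2'⟩

namespace IsLocallyStationary

variable {Ω : Type*} [MeasurableSpace Ω] {P : Measure Ω}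
  {Z : ℤ → Ω → ℝ} {X : ℤ → ℕ → Ω → ℝ} {c : ℤ → ℕ → ℕ → ℝ}
  {ψ : ℕ → ℝ → ℝ} {a d : ℝ → ℝ}

lemma le_dInf (hX : IsLocallyStationary P Z X c ψ a d) {u : ℝ} (hu : u ∈ Set.Icc (0 : ℝ) 1) :
    d u ≤ dInf d :=
  le_csSup (isCompact_Icc.bddAbove_image hX.twiceDiff_d.1.continuousOn) ⟨u, hu, rfl⟩

lemma dInf_nonneg (hX : IsLocallyStationary P Z X c ψ a d) : 0 ≤ dInf d :=
  (hX.d_nonneg 0 (by simp)).trans (hX.le_dInf (by simp))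

/-- The asymptotics hold from some lag on; the finitely many earlier coefficients are continuous in
`u`, hence bounded, and go into the constant. -/
lemma exists_ψ_sub_le (hX : IsLocallyStationary P Z X c ψ a d) :
    ∃ K, 0 ≤ K ∧ ∀ l : ℕ, 1 ≤ l → ∀ u ∈ Set.Icc (0 : ℝ) 1,
      |ψ l u - a u * (l : ℝ) ^ (d u - 1)| ≤ K * (l : ℝ) ^ (dInf d - 2) := by
  obtain ⟨C, hC⟩ := hX.asymptotics
  obtain ⟨n, hn⟩ := eventually_atTop.1 hC
  have hloc : ∀ l : ℕ, ∃ B, 0 ≤ B ∧ (1 ≤ l → ∀ u ∈ Set.Icc (0 : ℝ) 1,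
      |ψ l u - a u * (l : ℝ) ^ (d u - 1)| ≤ B * (l : ℝ) ^ (dInf d - 2)) := by
    intro l
    obtain ⟨K₁, hK₁⟩ := exists_bound_of_continuousOn (hX.contDiff_ψ l).continuousOn
    obtain ⟨K₂, hK₂⟩ := exists_bound_of_continuousOn hX.twiceDiff_a.1.continuousOn
    refine ⟨(|K₁| + |K₂| * (l : ℝ) ^ (dInf d - 1)) / (l : ℝ) ^ (dInf d - 2), by positivity, ?_⟩
    intro hl u hu
    have hx : (1 : ℝ) ≤ l := by exact_mod_cast hl
    rw [div_mul_cancel₀ _ (Real.rpow_pos_of_pos (by linarith) _).ne']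
    refine (abs_sub _ _).trans (add_le_add ((hK₁ u hu).trans (le_abs_self _)) ?_)
    rw [abs_mul, abs_of_nonneg (by positivity : 0 ≤ (l : ℝ) ^ (d u - 1))]
    exact mul_le_mul ((hK₂ u hu).trans (le_abs_self _)) (Real.rpow_le_rpow_of_exponent_le hx
      (by linarith [hX.le_dInf hu])) (by positivity) (abs_nonneg _)
  choose B hB0 hB using hloc
  refine ⟨|C| + ∑ l ∈ Finset.range n, B l,
    add_nonneg (abs_nonneg _) (Finset.sum_nonneg fun l _ => hB0 l), fun l hl u hu => ?_⟩
  have hx : (0 : ℝ) < l := by exact_mod_cast hl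
  rcases lt_or_ge l n with hln | hln
  · refine (hB l hl u hu).trans (mul_le_mul_of_nonneg_right ?_ (by positivity))
    have := Finset.single_le_sum (f := B) (fun l _ => hB0 l) (Finset.mem_range.2 hln)
    linarith [abs_nonneg C]
  · have h := hn l hln u hu
    rw [idx, if_neg (by omega)] at h
    have e1 : a u / (l : ℝ) ^ (1 - d u) = a u * (l : ℝ) ^ (d u - 1) := by
      rw [div_eq_mul_inv, ← Real.rpow_neg hx.le, neg_sub]
    have e2 : C / (l : ℝ) ^ (2 - dInf d) = C * (l : ℝ) ^ (dInf d - 2) := by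
      rw [div_eq_mul_inv, ← Real.rpow_neg hx.le, neg_sub]
    rw [e1, e2] at h
    refine h.trans (mul_le_mul_of_nonneg_right ?_ (by positivity))
    have := Finset.sum_nonneg fun l (_ : l ∈ Finset.range n) => hB0 l
    linarith [le_abs_self C]

/-- Both the approximating coefficients and the time varying coefficients along a diagonal have
power profiles, with a common constant. -/
lemma exists_isProfile (hX : IsLocallyStationary P Z X c ψ a d) (hm1 : dInf d < 1) :
    ∃ κ, 0 ≤ κ ∧
      (∀ u ∈ Set.Icc (0 : ℝ) 1, ∀ p q : ℕ,
        IsProfile (dInf d) κ 0 p q (fun l => ψ l u) (fun _ => a u) (fun _ => d u)) ∧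
      (∀ (T : ℕ) (t : ℤ) (p q : ℕ), 1 ≤ T → q - p ≤ T →
        (∀ l ∈ Finset.Ico p q, 1 ≤ t + (l : ℤ) ∧ t + (l : ℤ) ≤ T) →
        IsProfile (dInf d) κ (T : ℝ)⁻¹ p q (fun l => c (t + l) T l)
          (fun l => a (clip ((t + l : ℝ) / T))) (fun l => d (clip ((t + l : ℝ) / T)))) ∧
      ∀ (T : ℕ) (t : ℤ), 1 ≤ t → t ≤ (T : ℤ) → ∀ l : ℕ,
        |c t T l - ψ l ((t : ℝ) / (T : ℝ))| ≤ κ * (T : ℝ)⁻¹ := by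
  obtain ⟨K₁, hK₁0, hK₁⟩ := hX.exists_ψ_sub_le
  obtain ⟨K₂, hK₂⟩ := exists_bound_of_continuousOn hX.twiceDiff_a.1.continuousOn
  obtain ⟨K₃, hK₃0, hK₃⟩ := hX.twiceDiff_a.exists_lipschitz
  obtain ⟨K₄, hK₄0, hK₄⟩ := hX.twiceDiff_d.exists_lipschitz
  obtain ⟨K₅, hK₅⟩ := exists_bound_of_continuousOn (hX.contDiff_ψ 0).continuousOn
  obtain ⟨K₆, hK₆⟩ := hX.approx
  set m := dInf d with hm
  set κ := K₁ + |K₂| + K₃ + K₄ + |K₅| + |K₆| with hκ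
  have hκ1 : K₁ ≤ κ := by have := abs_nonneg K₂; have := abs_nonneg K₅; have := abs_nonneg K₆; linarith
  have hκ2 : |K₂| ≤ κ := by have := abs_nonneg K₅; have := abs_nonneg K₆; linarith
  have hκ3 : K₃ ≤ κ := by
    have := abs_nonneg K₂; have := abs_nonneg K₅; have := abs_nonneg K₆; linarith
  have hκ4 : K₄ ≤ κ := by
    have := abs_nonneg K₂; have := abs_nonneg K₅; have := abs_nonneg K₆; linarith
  have hκ56 : |K₅| + |K₆| ≤ κ := by have := abs_nonneg K₂; linarith
  have hκ0 : 0 ≤ κ := hK₁0.trans hκ1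
  have happ : ∀ (T : ℕ) (t : ℤ), 1 ≤ t → t ≤ (T : ℤ) → ∀ l : ℕ,
      |c t T l - ψ l ((t : ℝ) / (T : ℝ))| ≤ |K₆| * ((T : ℝ)⁻¹ * idx l ^ (m - 1)) := by
    intro T t h1 h2 l
    refine (hK₆ T t h1 h2 l).trans ?_
    have hidx : 0 < idx l := by
      unfold idx; split_ifs with h
      · norm_num
      · exact_mod_cast Nat.pos_of_ne_zero h
    rw [div_eq_mul_inv, mul_inv, ← Real.rpow_neg hidx.le, neg_sub]
    exact mul_le_mul_of_nonneg_right (le_abs_self _) (by positivity)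
  have hstep : ∀ (T : ℕ) (t : ℤ) (l : ℕ),
      |clip ((t + (l + 1 : ℕ) : ℝ) / T) - clip ((t + l : ℝ) / T)| ≤ (T : ℝ)⁻¹ := by
    intro T t l
    refine (abs_clip_sub_le _ _).trans (le_of_eq ?_)
    push_cast
    rw [← sub_div, show (t : ℝ) + (l + 1) - (t + l) = 1 by ring, one_div, abs_inv, Nat.abs_cast]
  have hsmall : ∀ l : ℕ, idx l ^ (m - 1) ≤ 1 := by
    intro l
    refine Real.rpow_le_one_of_one_le_of_nonpos ?_ (by linarith)
    unfold idx; split_ifs with h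
    · norm_num
    · exact_mod_cast Nat.one_le_iff_ne_zero.2 h
  have hcψ : ∀ (T : ℕ) (t : ℤ), 1 ≤ t → t ≤ (T : ℤ) → ∀ l : ℕ,
      |c t T l - ψ l ((t : ℝ) / (T : ℝ))| ≤ |K₆| * (T : ℝ)⁻¹ := by
    intro T t h1 h2 l
    refine (happ T t h1 h2 l).trans (mul_le_mul_of_nonneg_left ?_ (abs_nonneg _))
    exact mul_le_of_le_one_right (by positivity) (hsmall l)
  refine ⟨κ, hκ0, fun u hu p q => ?_, fun T t p q hT hpq ht => ?_, fun T t h1 h2 l => ?_⟩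
  -- At a fixed `u` the parameters do not move, so the drift rate is `0`.
  · refine ⟨fun l => ((hK₂ u hu).trans (le_abs_self _)).trans hκ2, fun l => hX.d_nonneg u hu,
      fun l => hX.le_dInf hu, by simp, by simp, fun _ => ?_, fun l _ hl => ?_, le_rfl, zero_le_one,
      by simp⟩
    · have := abs_nonneg K₆
      exact ((hK₅ u hu).trans (le_abs_self _)).trans (by linarith)
    · refine (hK₁ l hl u hu).trans ?_
      rw [zero_mul, add_zero]
      gcongr
  -- Along the diagonal `(t + l, l)` rescaled time advances by `1 / T` per lag, and the Lipschitz
  -- bounds make `a` and `d` drift at that rate. `clip` only serves to define the parameters at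
  -- every lag; it is the identity on the lags of the range.
  · have hT1 : (1 : ℝ) ≤ T := by exact_mod_cast hT
    have hTi : (T : ℝ)⁻¹ ≤ 1 := inv_le_one_of_one_le₀ hT1
    refine ⟨fun l => ((hK₂ _ (clip_mem _)).trans (le_abs_self _)).trans hκ2,
      fun l => hX.d_nonneg _ (clip_mem _), fun l => hX.le_dInf (clip_mem _), fun l => ?_,
      fun l => ?_, fun h0 => ?_, fun l hl hl1 => ?_, by positivity, hTi, ?_⟩
    · refine (hK₃ _ (clip_mem _) _ (clip_mem _)).trans ?_
      exact mul_le_mul hκ3 (hstep T t l) (abs_nonneg _) hκ0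
    · refine (hK₄ _ (clip_mem _) _ (clip_mem _)).trans ?_
      exact mul_le_mul hκ4 (hstep T t l) (abs_nonneg _) hκ0
    · obtain ⟨h1, h2⟩ := ht 0 h0
      have e1 := hcψ T _ h1 h2 0
      have e2 := (hK₅ _ (div_mem_Icc h1 h2)).trans (le_abs_self _)
      have e3 : |K₆| * (T : ℝ)⁻¹ ≤ |K₆| := mul_le_of_le_one_right (abs_nonneg _) hTi
      have e4 := abs_sub_abs_le_abs_sub (c (t + (0 : ℕ)) T 0)
        (ψ 0 (((t + (0 : ℕ) : ℤ) : ℝ) / T))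
      refine (sub_le_iff_le_add.1 (e4.trans (e1.trans e3))).trans ?_
      exact (add_le_add_right e2 _).trans (by linarith)
    · obtain ⟨h1, h2⟩ := ht l hl
      have hu := div_mem_Icc h1 h2
      have e1 := happ T _ h1 h2 l
      have e2 := hK₁ l hl1 _ hu
      rw [idx, if_neg (by omega)] at e1
      push_cast at e1 e2 hu
      rw [clip_of_mem hu]
      set u : ℝ := ((t : ℝ) + l) / T
      calc |c (t + l) T l - a u * (l : ℝ) ^ (d u - 1)|
          ≤ |c (t + l) T l - ψ l u| + |ψ l u - a u * (l : ℝ) ^ (d u - 1)| := abs_sub_le _ _ _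
        _ ≤ |K₆| * ((T : ℝ)⁻¹ * (l : ℝ) ^ (m - 1)) + K₁ * (l : ℝ) ^ (m - 2) := add_le_add e1 e2
        _ ≤ κ * ((T : ℝ)⁻¹ * (l : ℝ) ^ (m - 1)) + κ * (l : ℝ) ^ (m - 2) := by
          have : |K₆| ≤ κ := by have := abs_nonneg K₅; linarith
          gcongr
        _ = _ := by ring
    · rw [← div_eq_mul_inv, div_le_one (by linarith)]
      exact_mod_cast hpq
  · refine (hcψ T t h1 h2 l).trans (mul_le_mul_of_nonneg_right ?_ (by positivity))
    have := abs_nonneg K₅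
    linarith

end IsLocallyStationary

end LongMemory

/-! ### Uniform bounds for block sums of the coefficients. -/

namespace LongMemory

/-- Bounds, uniform in all parameters, for the trigonometric block sums of the coefficients. -/
structure CoefBound (c : ℤ → ℕ → ℕ → ℝ) (ψ : ℕ → ℝ → ℝ) (b C : ℝ) : Prop where
  nonneg : 0 ≤ C
  ψ_tail : ∀ u ∈ Set.Icc (0 : ℝ) 1, ∀ lam, 0 < lam → lam ≤ Real.pi → ∀ p q : ℕ, 1 ≤ p →
    ‖∑ l ∈ Finset.Ico p q, (ψ l u : ℂ) * phase lam ^ l‖ ≤ C / lam * (p : ℝ) ^ (b - 1)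
  ψ_head : ∀ u ∈ Set.Icc (0 : ℝ) 1, ∀ lam, 0 < lam → lam ≤ Real.pi → ∀ p q : ℕ,
    ‖∑ l ∈ Finset.Ico p q, (ψ l u : ℂ) * phase lam ^ l‖ ≤ C * lam ^ (-b)
  c_tail : ∀ lam, 0 < lam → lam ≤ Real.pi → ∀ (T : ℕ) (t : ℤ) (p q : ℕ), 1 ≤ T → q - p ≤ T →
    (∀ l ∈ Finset.Ico p q, 1 ≤ t + (l : ℤ) ∧ t + (l : ℤ) ≤ T) → 1 ≤ p →
    ‖∑ l ∈ Finset.Ico p q, (c (t + l) T l : ℂ) * phase lam ^ l‖ ≤ C / lam * (p : ℝ) ^ (b - 1)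
  c_head : ∀ lam, 0 < lam → lam ≤ Real.pi → ∀ (T : ℕ) (t : ℤ) (p q : ℕ), 1 ≤ T → q - p ≤ T →
    (∀ l ∈ Finset.Ico p q, 1 ≤ t + (l : ℤ) ∧ t + (l : ℤ) ≤ T) →
    ‖∑ l ∈ Finset.Ico p q, (c (t + l) T l : ℂ) * phase lam ^ l‖ ≤ C * lam ^ (-b)
  c_sub_ψ : ∀ (T : ℕ) (t : ℤ), 1 ≤ t → t ≤ (T : ℤ) → ∀ l : ℕ,
    |c t T l - ψ l ((t : ℝ) / (T : ℝ))| ≤ C * (T : ℝ)⁻¹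

lemma IsLocallyStationary.exists_coefBound {Ω : Type*} [MeasurableSpace Ω] {P : Measure Ω}
    {Z : ℤ → Ω → ℝ} {X : ℤ → ℕ → Ω → ℝ} {c : ℤ → ℕ → ℕ → ℝ}
    {ψ : ℕ → ℝ → ℝ} {a d : ℝ → ℝ} (hX : IsLocallyStationary P Z X c ψ a d) {b : ℝ}
    (hb : dInf d < b) (hb1 : b < 1) : ∃ C, CoefBound c ψ b C := by
  obtain ⟨κ, hκ, h1, h2, h3⟩ := hX.exists_isProfile (hb.trans hb1)
  obtain ⟨C₁, hC₁, htail⟩ := IsProfile.norm_sum_le_tail (dInf d) κ hb hb1 hκ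
  obtain ⟨C₂, hC₂, hhead⟩ :=
    IsProfile.norm_sum_le_head (dInf d) κ (hX.dInf_nonneg.trans_lt hb) hb hb1 hκ
  have k1 : C₁ ≤ κ + C₁ + C₂ := by linarith
  have k2 : C₂ ≤ κ + C₁ + C₂ := by linarith
  have k3 : κ ≤ κ + C₁ + C₂ := by linarith
  refine ⟨κ + C₁ + C₂, by positivity, ?_, ?_, ?_, ?_, ?_⟩
  · intro u hu lam hl hlp p q hp
    refine (htail _ p q _ _ _ (h1 u hu p q) hp lam hl hlp).trans ?_
    gcongr
  · intro u hu lam hl hlp p q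
    refine (hhead _ p q _ _ _ (h1 u hu p q) lam hl hlp).trans ?_
    gcongr
  · intro lam hl hlp T t p q hT hpq ht hp
    refine (htail _ p q _ _ _ (h2 T t p q hT hpq ht) hp lam hl hlp).trans ?_
    gcongr
  · intro lam hl hlp T t p q hT hpq ht
    refine (hhead _ p q _ _ _ (h2 T t p q hT hpq ht) lam hl hlp).trans ?_
    gcongr
  · intro T t ht ht' l
    refine (h3 T t ht ht' l).trans ?_
    gcongr

namespace CoefBound

variable {c : ℤ → ℕ → ℕ → ℝ} {ψ : ℕ → ℝ → ℝ} {b C : ℝ}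

/-! ### The transfer function -/

lemma tendsto_rpow_nat (hb1 : b < 1) (K : ℝ) :
    Tendsto (fun n : ℕ => K * (n : ℝ) ^ (b - 1)) atTop (𝓝 0) := by
  have h := (tendsto_rpow_neg_atTop (show 0 < 1 - b by linarith)).comp tendsto_natCast_atTop_atTop
  rw [show -(1 - b) = b - 1 by ring] at h
  simpa using h.const_mul K

/-- Absolute convergence may fail, but the tail bound makes the partial sums Cauchy, so the
`limUnder` in `transfer` is a genuine limit and not a default value. -/
lemma tendsto_transfer (H : CoefBound c ψ b C) (hb1 : b < 1) {u lam : ℝ}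
    (hu : u ∈ Set.Icc (0 : ℝ) 1) (h0 : 0 < lam) (hpi : lam ≤ Real.pi) :
    Tendsto (fun n : ℕ => ∑ l ∈ Finset.range n, (ψ l u : ℂ) * phase lam ^ l) atTop
      (𝓝 (transfer ψ u lam)) := by
  set s : ℕ → ℂ := fun n => ∑ l ∈ Finset.range n, (ψ l u : ℂ) * phase lam ^ l with hs
  -- The shift by one keeps the lower end of each tail positive, as the tail bound requires.
  have hc : CauchySeq (fun n => s (n + 1)) := by
    refine cauchySeq_of_le_tendsto_0' (fun n : ℕ => C / lam * ((n + 1 : ℕ) : ℝ) ^ (b - 1)) ?_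
      ((tendsto_rpow_nat hb1 _).comp (tendsto_add_atTop_nat 1))
    intro n m hnm
    rw [dist_comm, dist_eq_norm, hs]
    simp only
    rw [← Finset.sum_Ico_eq_sub _ (by omega)]
    exact H.ψ_tail u hu lam h0 hpi _ _ (by omega)
  obtain ⟨A, hA⟩ := cauchySeq_tendsto_of_complete hc
  have hA' : Tendsto s atTop (𝓝 A) := (tendsto_add_atTop_iff_nat 1).1 hA
  have : transfer ψ u lam = A := by
    unfold transfer
    simp_rw [exp_eq_phase_pow]
    exact hA'.limUnder_eq
  rw [this]
  exact hA'

lemma norm_transfer_le (H : CoefBound c ψ b C) (hb1 : b < 1) {u lam : ℝ}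
    (hu : u ∈ Set.Icc (0 : ℝ) 1) (h0 : 0 < lam) (hpi : lam ≤ Real.pi) :
    ‖transfer ψ u lam‖ ≤ C * lam ^ (-b) := by
  refine le_of_tendsto (H.tendsto_transfer hb1 hu h0 hpi).norm (Eventually.of_forall fun n => ?_)
  rw [Finset.range_eq_Ico]
  exact H.ψ_head u hu lam h0 hpi 0 n

lemma norm_transfer_sub_le (H : CoefBound c ψ b C) (hb1 : b < 1) {u lam : ℝ}
    (hu : u ∈ Set.Icc (0 : ℝ) 1) (h0 : 0 < lam) (hpi : lam ≤ Real.pi) {L : ℕ} (hL : 1 ≤ L) :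
    ‖transfer ψ u lam - ∑ l ∈ Finset.range L, (ψ l u : ℂ) * phase lam ^ l‖ ≤
      C / lam * (L : ℝ) ^ (b - 1) := by
  refine le_of_tendsto ((H.tendsto_transfer hb1 hu h0 hpi).sub_const _).norm
    (eventually_atTop.2 ⟨L, fun n hn => ?_⟩)
  rw [← Finset.sum_Ico_eq_sub _ hn]
  exact H.ψ_tail u hu lam h0 hpi L n hL

/-- The coefficients are real, so conjugating the partial sums changes the sign of the frequency. -/
lemma transfer_neg (H : CoefBound c ψ b C) (hb1 : b < 1) {u lam : ℝ}
    (hu : u ∈ Set.Icc (0 : ℝ) 1) (h0 : 0 < lam) (hpi : lam ≤ Real.pi) :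
    transfer ψ u (-lam) = (starRingEnd ℂ) (transfer ψ u lam) := by
  have h := (Complex.continuous_conj.tendsto _).comp (H.tendsto_transfer hb1 hu h0 hpi)
  have e : (fun n : ℕ => ∑ l ∈ Finset.range n,
      (ψ l u : ℂ) * Complex.exp (-(Complex.I * ((-lam : ℝ) : ℂ) * (l : ℂ)))) =
      (starRingEnd ℂ) ∘ fun n : ℕ => ∑ l ∈ Finset.range n, (ψ l u : ℂ) * phase lam ^ l := by
    funext n
    simp only [Function.comp_apply, map_sum, map_mul, map_pow, Complex.conj_ofReal,
      exp_eq_phase_pow]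
    refine Finset.sum_congr rfl fun l _ => ?_
    congr 2
    rw [phase, phase, ← Complex.exp_conj]
    simp
  unfold transfer at h ⊢
  rw [e]
  exact h.limUnder_eq

lemma spectralDensity_neg (H : CoefBound c ψ b C) (hb1 : b < 1) {u lam : ℝ}
    (hu : u ∈ Set.Icc (0 : ℝ) 1) (h0 : 0 < lam) (hpi : lam ≤ Real.pi) :
    spectralDensity ψ u (-lam) = spectralDensity ψ u lam := by
  rw [spectralDensity, H.transfer_neg hb1 hu h0 hpi, RCLike.norm_conj, spectralDensity]

lemma spectralDensity_nonneg (ψ : ℕ → ℝ → ℝ) (u lam : ℝ) : 0 ≤ spectralDensity ψ u lam := by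
  unfold spectralDensity
  have := Real.pi_pos
  positivity

/-- `f` is at most the square of `λ ^ (-b)` up to a constant, so `f⁴` has a pole of order `8b`; this
is where the threshold `1/8` originates. -/
lemma spectralDensity_pow_le (H : CoefBound c ψ b C) (hb1 : b < 1) {u lam : ℝ}
    (hu : u ∈ Set.Icc (0 : ℝ) 1) (h0 : 0 < lam) (hpi : lam ≤ Real.pi) :
    spectralDensity ψ u lam ^ 4 ≤ C ^ 8 * lam ^ (-(8 * b)) := by
  have h1 := H.norm_transfer_le hb1 hu h0 hpi
  have h2 : spectralDensity ψ u lam ≤ (C * lam ^ (-b)) ^ 2 := by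
    unfold spectralDensity
    have : 1 / (2 * Real.pi) ≤ 1 := by
      rw [div_le_one (by positivity)]; linarith [Real.two_le_pi]
    calc 1 / (2 * Real.pi) * ‖transfer ψ u lam‖ ^ 2 ≤ 1 * (C * lam ^ (-b)) ^ 2 := by gcongr
      _ = _ := one_mul _
  calc _ ≤ ((C * lam ^ (-b)) ^ 2) ^ 4 := pow_le_pow_left₀ (spectralDensity_nonneg ψ u lam) h2 4
    _ = C ^ 8 * (lam ^ (-b)) ^ (8 : ℕ) := by ring
    _ = _ := by
      rw [← Real.rpow_natCast (lam ^ (-b)) 8, ← Real.rpow_mul h0.le]; congr 2; push_cast; ring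

end CoefBound

/-! ### Coefficients of the innovations in a block -/

/-- Up to a factor of modulus one, the coefficient of `Z_{t₀+m}` in
`∑_{s<N} e^{-iλs} (∑_{l<n} c_{t₀+s,T,l} Z_{t₀+s-l} - A Z_{t₀+s})`. -/
noncomputable def blockCoef (c : ℤ → ℕ → ℕ → ℝ) (T : ℕ) (t₀ : ℤ) (N n : ℕ) (lam : ℝ) (A : ℂ)
    (m : ℤ) : ℂ :=
  (∑ l ∈ Finset.range n, if 0 ≤ m + (l : ℤ) ∧ m + (l : ℤ) < N then
    (c (t₀ + m + l) T l : ℂ) * phase lam ^ l else 0) - if 0 ≤ m ∧ m < N then A else 0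

/-- Separates the innovations preceding the block from those inside it, which are estimated
differently. -/
lemma sum_Ico_neg_eq {M : Type*} [AddCommMonoid M] (F : ℤ → M) (n N : ℕ) :
    ∑ m ∈ Finset.Ico (-(n : ℤ)) N, F m =
      ∑ p ∈ Finset.Ico 1 (n + 1), F (-(p : ℤ)) + ∑ m ∈ Finset.range N, F m := by
  rw [← Finset.Ico_union_Ico_eq_Ico (b := (0 : ℤ)) (by omega) (by omega),
    Finset.sum_union (Finset.Ico_disjoint_Ico_consecutive _ _ _)]
  congr 1
  · refine Finset.sum_nbij' (fun m => (-m).toNat) (fun p => -(p : ℤ)) ?_ ?_ ?_ ?_ ?_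
    · intro m hm; simp only [Finset.mem_Ico] at hm ⊢; omega
    · intro p hp; simp only [Finset.mem_Ico] at hp ⊢; omega
    · intro m hm; simp only [Finset.mem_Ico] at hm; omega
    · intro p hp; simp
    · intro m hm; simp only [Finset.mem_Ico] at hm; congr 1; omega
  · refine Finset.sum_nbij' (fun m => m.toNat) (fun p => (p : ℤ)) ?_ ?_ ?_ ?_ ?_
    · intro m hm; simp only [Finset.mem_Ico, Finset.mem_range] at hm ⊢; omega
    · intro p hp; simp only [Finset.mem_Ico, Finset.mem_range] at hp ⊢; omega
    · intro m hm; simp only [Finset.mem_Ico] at hm; omega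
    · intro p hp; simp
    · intro m hm; simp only [Finset.mem_Ico] at hm; congr 1; omega

lemma sum_range_ite_eq (n N : ℕ) (m : ℤ) (F : ℕ → ℂ) :
    (∑ l ∈ Finset.range n, if 0 ≤ m + (l : ℤ) ∧ m + (l : ℤ) < N then F l else 0) =
      ∑ l ∈ Finset.Ico (-m).toNat (min n (N - m).toNat), F l := by
  rw [← Finset.sum_filter]
  refine Finset.sum_congr ?_ fun _ _ => rfl
  ext l
  simp only [Finset.mem_filter, Finset.mem_range, Finset.mem_Ico]
  omega

/-- An innovation `p` steps before the block reaches it only through lags `l ≥ p`, so its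
coefficient is a tail sum along a diagonal. -/
lemma blockCoef_neg (c : ℤ → ℕ → ℕ → ℝ) (T : ℕ) (t₀ : ℤ) (N n : ℕ) (lam : ℝ) (A : ℂ) {p : ℕ}
    (hp : 1 ≤ p) :
    blockCoef c T t₀ N n lam A (-(p : ℤ)) =
      ∑ l ∈ Finset.Ico p (min n (N + p)), (c (t₀ - p + l) T l : ℂ) * phase lam ^ l := by
  rw [blockCoef, if_neg (by omega), sub_zero, sum_range_ite_eq]
  refine Finset.sum_congr ?_ fun l _ => by rw [sub_eq_add_neg]
  congr 1 <;> omega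

/-- An innovation inside the block acts through the lags from `0` up to the end of the block; its
coefficient is a truncated transfer function minus the target `A`. -/
lemma blockCoef_natCast (c : ℤ → ℕ → ℕ → ℝ) (T : ℕ) (t₀ : ℤ) (N n : ℕ) (lam : ℝ) (A : ℂ) {m : ℕ}
    (hm : m < N) :
    blockCoef c T t₀ N n lam A (m : ℤ) =
      ∑ l ∈ Finset.Ico 0 (min n (N - m)), (c (t₀ + m + l) T l : ℂ) * phase lam ^ l - A := by
  rw [blockCoef, if_pos (by omega), sum_range_ite_eq]
  congr 1
  refine Finset.sum_congr ?_ fun l _ => rfl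
  congr 1 <;> omega

namespace CoefBound

variable {c : ℤ → ℕ → ℕ → ℝ} {ψ : ℕ → ℝ → ℝ} {b C : ℝ} {T N : ℕ} {t₀ : ℤ} {u lam : ℝ}

lemma norm_blockCoef_neg_le_head (H : CoefBound c ψ b C) (ht : 1 ≤ t₀) (hN : 1 ≤ N)
    (htN : t₀ + N ≤ T + 1) (h0 : 0 < lam) (hpi : lam ≤ Real.pi) (n : ℕ) {p : ℕ} (hp : 1 ≤ p)
    (A : ℂ) : ‖blockCoef c T t₀ N n lam A (-(p : ℤ))‖ ≤ C * lam ^ (-b) := by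
  rw [blockCoef_neg _ _ _ _ _ _ _ hp]
  refine H.c_head lam h0 hpi T (t₀ - p) p _ (by omega) (by omega) fun l hl => ?_
  simp only [Finset.mem_Ico] at hl
  omega

lemma norm_blockCoef_neg_le_tail (H : CoefBound c ψ b C) (ht : 1 ≤ t₀) (hN : 1 ≤ N)
    (htN : t₀ + N ≤ T + 1) (h0 : 0 < lam) (hpi : lam ≤ Real.pi) (n : ℕ) {p : ℕ} (hp : 1 ≤ p)
    (A : ℂ) : ‖blockCoef c T t₀ N n lam A (-(p : ℤ))‖ ≤ C / lam * (p : ℝ) ^ (b - 1) := by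
  rw [blockCoef_neg _ _ _ _ _ _ _ hp]
  refine H.c_tail lam h0 hpi T (t₀ - p) p _ (by omega) (by omega) (fun l hl => ?_) hp
  simp only [Finset.mem_Ico] at hl
  omega

lemma norm_blockCoef_natCast_le (H : CoefBound c ψ b C) (hb1 : b < 1) (ht : 1 ≤ t₀)
    (htN : t₀ + N ≤ T + 1) (hu : u ∈ Set.Icc (0 : ℝ) 1) (h0 : 0 < lam) (hpi : lam ≤ Real.pi)
    (n : ℕ) {m : ℕ} (hm : m < N) :
    ‖blockCoef c T t₀ N n lam (transfer ψ u lam) m‖ ≤ 2 * C * lam ^ (-b) := by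
  rw [blockCoef_natCast _ _ _ _ _ _ _ hm]
  have h1 := H.c_head lam h0 hpi T (t₀ + m) 0 (min n (N - m)) (by omega) (by omega) fun l hl => by
    simp only [Finset.mem_Ico] at hl
    omega
  have h2 := H.norm_transfer_le hb1 hu h0 hpi
  refine (norm_sub_le _ _).trans ((add_le_add h1 h2).trans (le_of_eq (by ring)))

/-- The squared tail bound is of order `p ^ (2b - 2)`, which is summable because `2b < 1`. -/
lemma sum_norm_sq_neg_le (H : CoefBound c ψ b C) (hb : b < 1 / 2) (ht : 1 ≤ t₀) (hN : 1 ≤ N)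
    (htN : t₀ + N ≤ T + 1) (h0 : 0 < lam) (hpi : lam ≤ Real.pi) (n : ℕ) (A : ℂ) {P Q : ℕ}
    (hP : 1 ≤ P) :
    ∑ p ∈ Finset.Ico P Q, ‖blockCoef c T t₀ N n lam A (-(p : ℤ))‖ ^ 2 ≤
      (C / lam) ^ 2 * (((1 - 2 * b) * 2 ^ (-1 - (1 - 2 * b)))⁻¹ * (P : ℝ) ^ (-(1 - 2 * b))) := by
  have hs := sum_Ico_rpow_le (show 0 < 1 - 2 * b by linarith) P Q hP
  refine le_trans ?_ (mul_le_mul_of_nonneg_left hs (by positivity))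
  rw [Finset.mul_sum]
  refine Finset.sum_le_sum fun p hp => ?_
  have hp1 : 1 ≤ p := hP.trans (Finset.mem_Ico.1 hp).1
  have hx : (0 : ℝ) < p := by exact_mod_cast hp1
  refine (pow_le_pow_left₀ (norm_nonneg _)
    (H.norm_blockCoef_neg_le_tail ht hN htN h0 hpi n hp1 A) 2).trans (le_of_eq ?_)
  rw [mul_pow, ← Real.rpow_natCast ((p : ℝ) ^ (b - 1)) 2, ← Real.rpow_mul hx.le]
  congr 2
  push_cast
  ring

/-- The innovations inside the block, and those less than `P ≈ 1/λ` before it, number `O(N)` and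
contribute `O(λ^(-2b))` each. The older ones contribute `λ⁻² P^(2b-1) ≤ λ⁻¹ λ^(-2b)` in total, up to
a constant. The condition `1 ≤ N λ` bounds both `P` and `λ⁻¹` by a multiple of `N`. -/
lemma sum_norm_sq_blockCoef_le (H : CoefBound c ψ b C) (hb0 : 0 < b) (hb : b < 1 / 2) :
    ∃ K, 0 ≤ K ∧ ∀ (T N : ℕ) (t₀ : ℤ) (u lam : ℝ), 1 ≤ t₀ → 1 ≤ N → t₀ + N ≤ T + 1 →
      u ∈ Set.Icc (0 : ℝ) 1 → 0 < lam → lam ≤ Real.pi → 1 ≤ N * lam → ∀ n : ℕ,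
      ∑ m ∈ Finset.Ico (-(n : ℤ)) N, ‖blockCoef c T t₀ N n lam (transfer ψ u lam) m‖ ^ 2 ≤
        K * N * lam ^ (-(2 * b)) := by
  have hC := H.nonneg
  have hs : 0 < 1 - 2 * b := by linarith
  set K₀ : ℝ := ((1 - 2 * b) * 2 ^ (-1 - (1 - 2 * b)))⁻¹ with hK₀
  have hK₀0 : 0 ≤ K₀ := by positivity
  refine ⟨5 * C ^ 2 + C ^ 2 * K₀ + 4 * C ^ 2, by positivity, ?_⟩
  intro T N t₀ u lam ht hN htN hu h0 hpi hNl n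
  have hN0 : (0 : ℝ) < N := by exact_mod_cast hN
  have hsq : (lam ^ (-b)) ^ 2 = lam ^ (-(2 * b)) := by
    rw [← Real.rpow_natCast (lam ^ (-b)) 2, ← Real.rpow_mul h0.le]; congr 1; push_cast; ring
  set E := lam ^ (-(2 * b)) with hE
  have hE0 : 0 ≤ E := by positivity
  have hlN : lam⁻¹ ≤ N := by rwa [inv_le_iff_one_le_mul₀ h0]
  set P : ℕ := max 1 ⌈lam⁻¹⌉₊ with hPdef
  have hP1 : 1 ≤ P := le_max_left _ _
  have hPge : lam⁻¹ ≤ P := (Nat.le_ceil _).trans (by exact_mod_cast le_max_right _ _)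
  have hPle : (P : ℝ) ≤ 5 * N := by
    rw [hPdef, Nat.cast_max, Nat.cast_one]
    have : (1 : ℝ) ≤ N := by exact_mod_cast hN
    refine max_le (by linarith) ?_
    have h2 : 0 < lam⁻¹ := by positivity
    linarith [(Nat.ceil_lt_add_one h2.le).le]
  rw [sum_Ico_neg_eq]
  set G : ℕ → ℝ := fun p => ‖blockCoef c T t₀ N n lam (transfer ψ u lam) (-(p : ℤ))‖ ^ 2 with hG
  have hG0 : ∀ p, 0 ≤ G p := fun p => by positivity
  have hneg : ∑ p ∈ Finset.Ico 1 (n + 1), G p ≤ ∑ p ∈ Finset.Ico 1 P, G p +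
      ∑ p ∈ Finset.Ico P (n + 1), G p := by
    rw [← Finset.sum_union (Finset.Ico_disjoint_Ico_consecutive _ _ _)]
    refine Finset.sum_le_sum_of_subset_of_nonneg (fun p hp => ?_) fun p _ _ => hG0 p
    simp only [Finset.mem_union, Finset.mem_Ico] at hp ⊢
    omega
  have hlow : ∑ p ∈ Finset.Ico 1 P, G p ≤ 5 * C ^ 2 * N * E := by
    have : ∀ p ∈ Finset.Ico 1 P, G p ≤ C ^ 2 * E := fun p hp => by
      rw [← hsq, ← mul_pow]
      exact pow_le_pow_left₀ (norm_nonneg _) (H.norm_blockCoef_neg_le_head ht hN htN h0 hpi n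
        (Finset.mem_Ico.1 hp).1 _) 2
    refine (Finset.sum_le_card_nsmul _ _ _ this).trans ?_
    rw [nsmul_eq_mul, Nat.card_Ico]
    have h1 : ((P - 1 : ℕ) : ℝ) ≤ 5 * N := le_trans (by exact_mod_cast Nat.sub_le _ _) hPle
    calc ((P - 1 : ℕ) : ℝ) * (C ^ 2 * E) ≤ (5 * N) * (C ^ 2 * E) := by gcongr
      _ = _ := by ring
  have hhigh : ∑ p ∈ Finset.Ico P (n + 1), G p ≤ C ^ 2 * K₀ * N * E := by
    refine (H.sum_norm_sq_neg_le hb ht hN htN h0 hpi n _ hP1).trans ?_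
    rw [← hK₀]
    have h1 : (P : ℝ) ^ (-(1 - 2 * b)) ≤ (lam⁻¹) ^ (-(1 - 2 * b)) :=
      Real.rpow_le_rpow_of_nonpos (by positivity) hPge (by linarith)
    have h2 : (lam⁻¹) ^ (-(1 - 2 * b)) = E * lam := by
      rw [Real.inv_rpow h0.le, ← Real.rpow_neg h0.le, hE, ← Real.rpow_add_one h0.ne']
      congr 1; ring
    calc (C / lam) ^ 2 * (K₀ * (P : ℝ) ^ (-(1 - 2 * b)))
        ≤ (C / lam) ^ 2 * (K₀ * (E * lam)) := by rw [← h2]; gcongr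
      _ = C ^ 2 * K₀ * lam⁻¹ * E := by field_simp
      _ ≤ _ := by gcongr
  have hpos : ∑ m ∈ Finset.range N, ‖blockCoef c T t₀ N n lam (transfer ψ u lam) m‖ ^ 2 ≤
      4 * C ^ 2 * N * E := by
    have : ∀ m ∈ Finset.range N, ‖blockCoef c T t₀ N n lam (transfer ψ u lam) m‖ ^ 2 ≤
        (2 * C) ^ 2 * E := fun m hm => by
      rw [← hsq, ← mul_pow]
      exact pow_le_pow_left₀ (norm_nonneg _) (H.norm_blockCoef_natCast_le (by linarith) ht htN
        hu h0 hpi n (Finset.mem_range.1 hm)) 2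
    refine (Finset.sum_le_card_nsmul _ _ _ this).trans (le_of_eq ?_)
    rw [nsmul_eq_mul, Finset.card_range]
    ring
  linarith

/-- At least `L` lags remain before the block ends. The first `L` are compared term by term with `ψ
l u`; what is left are two tails, one along the diagonal and one of the transfer function. -/
lemma norm_blockCoef_natCast_le_of_close (H : CoefBound c ψ b C) (hb1 : b < 1) (ht : 1 ≤ t₀)
    (htN : t₀ + N ≤ T + 1) (hu : u ∈ Set.Icc (0 : ℝ) 1) (h0 : 0 < lam)
    (hpi : lam ≤ Real.pi) {n L : ℕ} (hL : 1 ≤ L) (hLn : L ≤ n) {κ : ℝ}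
    (hκ : ∀ s < N, ∀ l < L, |c (t₀ + s) T l - ψ l u| ≤ κ) {m : ℕ} (hm : m + L ≤ N) :
    ‖blockCoef c T t₀ N n lam (transfer ψ u lam) m‖ ≤
      L * κ + 2 * (C / lam * (L : ℝ) ^ (b - 1)) := by
  rw [blockCoef_natCast _ _ _ _ _ _ _ (by omega),
    ← Finset.sum_Ico_consecutive _ (Nat.zero_le L) (by omega : L ≤ min n (N - m))]
  have h1 := H.c_tail lam h0 hpi T (t₀ + m) L (min n (N - m)) (by omega) (by omega) (fun l hl => by
    simp only [Finset.mem_Ico] at hl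
    omega) hL
  have h2 := H.norm_transfer_sub_le hb1 hu h0 hpi hL
  have h3 : ‖∑ l ∈ Finset.range L, ((c (t₀ + m + l) T l : ℂ) - ψ l u) * phase lam ^ l‖ ≤ L * κ := by
    refine (norm_sum_le_of_le (Finset.range L) (n := fun _ => κ) fun l hl => ?_).trans
      (le_of_eq (by simp))
    rw [norm_mul, norm_pow, norm_phase, one_pow, mul_one, ← Complex.ofReal_sub,
      Complex.norm_real, Real.norm_eq_abs]
    have hl' := Finset.mem_range.1 hl
    have := hκ (m + l) (by omega) l hl'
    push_cast at this
    rwa [← add_assoc] at this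
  have e : ∑ l ∈ Finset.Ico 0 L, (c (t₀ + m + l) T l : ℂ) * phase lam ^ l +
      ∑ l ∈ Finset.Ico L (min n (N - m)), (c (t₀ + m + l) T l : ℂ) * phase lam ^ l -
      transfer ψ u lam =
      ∑ l ∈ Finset.range L, ((c (t₀ + m + l) T l : ℂ) - ψ l u) * phase lam ^ l +
      ∑ l ∈ Finset.Ico L (min n (N - m)), (c (t₀ + m + l) T l : ℂ) * phase lam ^ l -
      (transfer ψ u lam - ∑ l ∈ Finset.range L, (ψ l u : ℂ) * phase lam ^ l) := by
    simp only [sub_mul, Finset.sum_sub_distrib, ← Finset.range_eq_Ico]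
    ring
  rw [e]
  refine (norm_sub_le _ _).trans ?_
  have := norm_add_le (∑ l ∈ Finset.range L, ((c (t₀ + m + l) T l : ℂ) - ψ l u) * phase lam ^ l)
    (∑ l ∈ Finset.Ico L (min n (N - m)), (c (t₀ + m + l) T l : ℂ) * phase lam ^ l)
  linarith

/-- At frequencies bounded away from zero the remainder coefficients are small. -/
lemma exists_sum_norm_sq_blockCoef_le (H : CoefBound c ψ b C) (hb0 : 0 < b) (hb : b < 1 / 2)
    (hψ : ∀ l, ContinuousOn (ψ l) (Set.Icc 0 1)) {δ ε : ℝ} (hδ : 0 < δ) (hε : 0 < ε) :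
    ∃ η > 0, ∃ N₀ : ℕ, ∀ (T N : ℕ) (t₀ : ℤ) (u lam : ℝ), 1 ≤ t₀ → N₀ ≤ N → t₀ + N ≤ T + 1 →
      u ∈ Set.Icc (0 : ℝ) 1 → δ ≤ lam → lam ≤ Real.pi → (T : ℝ)⁻¹ ≤ η →
      (∀ s < N, |((t₀ + s : ℤ) : ℝ) / T - u| ≤ η) → ∀ n : ℕ, N ≤ n →
      ∑ m ∈ Finset.Ico (-(n : ℤ)) N, ‖blockCoef c T t₀ N n lam (transfer ψ u lam) m‖ ^ 2 ≤
        ε * N := by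
  have hC := H.nonneg
  have hb1 : b < 1 := by linarith
  have hs : 0 < 1 - 2 * b := by linarith
  obtain ⟨ε', hε', hε'2⟩ : ∃ ε' > 0, (2 * ε') ^ 2 ≤ ε / 3 := by
    refine ⟨Real.sqrt (ε / 3) / 2, by positivity, ?_⟩
    rw [mul_div_cancel₀ _ (by norm_num), Real.sq_sqrt (by positivity)]
  -- Cut-off lag: for `λ ≥ δ` the two tails beyond `L` together stay below `ε'`, and each of the `L`
  -- earlier coefficients may be off by `κ = ε' / L`.
  obtain ⟨L, hL1, hL⟩ : ∃ L : ℕ, 1 ≤ L ∧ 2 * (C / δ * (L : ℝ) ^ (b - 1)) ≤ ε' := by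
    have h := (tendsto_rpow_nat hb1 (2 * (C / δ))).eventually (eventually_le_nhds hε')
    obtain ⟨L, hL⟩ := (h.and (eventually_ge_atTop 1)).exists
    exact ⟨L, hL.2, by rw [← mul_assoc]; exact hL.1⟩
  have hL0 : (0 : ℝ) < L := by exact_mod_cast hL1
  set κ : ℝ := ε' / L with hκ
  have hκ0 : 0 < κ := by positivity
  have huc : ∀ l : ℕ, ∃ η > 0, ∀ u ∈ Set.Icc (0 : ℝ) 1, ∀ v ∈ Set.Icc (0 : ℝ) 1,
      |u - v| ≤ η → |ψ l u - ψ l v| ≤ κ / 2 := by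
    intro l
    have := isCompact_Icc.uniformContinuousOn_of_continuous (hψ l)
    obtain ⟨η, hη, h⟩ := Metric.uniformContinuousOn_iff.1 this (κ / 2) (by positivity)
    refine ⟨η / 2, by positivity, fun u hu v hv huv => ?_⟩
    exact (h u hu v hv (by rw [Real.dist_eq]; linarith)).le
  choose η₁ hη₁ huc using huc
  obtain ⟨η₂, hη₂, hη₂l⟩ : ∃ η₂ > 0, ∀ l < L, η₂ ≤ η₁ l := by
    refine ⟨(Finset.range L).inf' ⟨0, by simpa using Nat.pos_of_ne_zero (by omega)⟩ η₁, ?_, fun l hl => ?_⟩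
    · exact (Finset.lt_inf'_iff _).2 fun l _ => hη₁ l
    · exact Finset.inf'_le _ (Finset.mem_range.2 hl)
  set K₀ : ℝ := ((1 - 2 * b) * 2 ^ (-1 - (1 - 2 * b)))⁻¹ with hK₀
  have hK₀0 : 0 ≤ K₀ := by positivity
  -- Bounds the contribution of the last `L` innovations of the block and of all innovations
  -- preceding it. It does not depend on `N`, hence is negligible against `ε N`.
  set B : ℝ := L * (2 * C * δ ^ (-b)) ^ 2 + (C / δ) ^ 2 * K₀ with hB
  -- Half of `κ` goes to the modulus of continuity of `ψ l`, half to the approximation error `C /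
  -- T`; `C + 1` avoids division by zero.
  refine ⟨min η₂ (κ / 2 / (C + 1)), by positivity, max L ⌈B / (ε / 3)⌉₊, ?_⟩
  intro T N t₀ u lam ht hN htN hu hδl hpi hTη hsη n hn
  have h0 : 0 < lam := hδ.trans_le hδl
  have hNL : L ≤ N := (le_max_left _ _).trans hN
  have hN1 : 1 ≤ N := hL1.trans hNL
  have hBN : B ≤ ε / 3 * N := by
    rw [mul_comm, ← div_le_iff₀ (by positivity)]
    exact (Nat.le_ceil _).trans (by exact_mod_cast (le_max_right _ _).trans hN)
  have hClam : C / lam ≤ C / δ := div_le_div_of_nonneg_left hC hδ hδl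
  have hclose : ∀ s < N, ∀ l < L, |c (t₀ + s) T l - ψ l u| ≤ κ := by
    intro s hs l hl
    have ht1 : 1 ≤ t₀ + (s : ℤ) := by omega
    have ht2 : t₀ + (s : ℤ) ≤ T := by omega
    have h1 := H.c_sub_ψ T _ ht1 ht2 l
    have h2 := huc l _ (div_mem_Icc ht1 ht2) u hu
      ((hsη s hs).trans ((min_le_left _ _).trans (hη₂l l hl)))
    have h3 : C * (T : ℝ)⁻¹ ≤ κ / 2 := by
      calc C * (T : ℝ)⁻¹ ≤ (C + 1) * (κ / 2 / (C + 1)) := by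
            gcongr
            · linarith
            · exact hTη.trans (min_le_right _ _)
        _ = _ := by field_simp
    refine (abs_sub_le _ (ψ l (((t₀ + s : ℤ) : ℝ) / T)) _).trans ?_
    linarith
  rw [sum_Ico_neg_eq]
  have hneg := H.sum_norm_sq_neg_le hb ht hN1 htN h0 hpi n (transfer ψ u lam) (P := 1)
    (Q := n + 1) le_rfl
  rw [Nat.cast_one, Real.one_rpow, mul_one, ← hK₀] at hneg
  have hneg' : (C / lam) ^ 2 * K₀ ≤ (C / δ) ^ 2 * K₀ := by gcongr
  have hbulk : ∑ m ∈ Finset.range (N - L),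
      ‖blockCoef c T t₀ N n lam (transfer ψ u lam) m‖ ^ 2 ≤ ε / 3 * N := by
    have : ∀ m ∈ Finset.range (N - L),
        ‖blockCoef c T t₀ N n lam (transfer ψ u lam) m‖ ^ 2 ≤ ε / 3 := fun m hm => by
      refine le_trans (pow_le_pow_left₀ (norm_nonneg _) ?_ 2) hε'2
      have hmN : m + L ≤ N := by have := Finset.mem_range.1 hm; omega
      refine (H.norm_blockCoef_natCast_le_of_close hb1 ht htN hu h0 hpi hL1 (hNL.trans hn)
        hclose hmN).trans ?_
      have e1 : (L : ℝ) * κ = ε' := by rw [hκ]; field_simp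
      have e2 : C / lam * (L : ℝ) ^ (b - 1) ≤ C / δ * (L : ℝ) ^ (b - 1) := by gcongr
      linarith
    refine (Finset.sum_le_card_nsmul _ _ _ this).trans ?_
    rw [nsmul_eq_mul, Finset.card_range, mul_comm]
    have : ((N - L : ℕ) : ℝ) ≤ N := by exact_mod_cast Nat.sub_le _ _
    gcongr
  have hedge : ∑ m ∈ Finset.Ico (N - L) N,
      ‖blockCoef c T t₀ N n lam (transfer ψ u lam) m‖ ^ 2 ≤ L * (2 * C * δ ^ (-b)) ^ 2 := by
    have : ∀ m ∈ Finset.Ico (N - L) N,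
        ‖blockCoef c T t₀ N n lam (transfer ψ u lam) m‖ ^ 2 ≤ (2 * C * δ ^ (-b)) ^ 2 :=
      fun m hm => by
        refine pow_le_pow_left₀ (norm_nonneg _) ((H.norm_blockCoef_natCast_le hb1 ht htN
          hu h0 hpi n (Finset.mem_Ico.1 hm).2).trans ?_) 2
        have : lam ^ (-b) ≤ δ ^ (-b) := Real.rpow_le_rpow_of_nonpos hδ hδl (by linarith)
        gcongr
    refine (Finset.sum_le_card_nsmul _ _ _ this).trans (le_of_eq ?_)
    rw [nsmul_eq_mul, Nat.card_Ico, Nat.sub_sub_self hNL]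
  rw [Finset.range_eq_Ico, ← Finset.sum_Ico_consecutive _ (Nat.zero_le _) (Nat.sub_le N L),
    ← Finset.range_eq_Ico]
  have : 0 ≤ ε / 3 * N := by positivity
  linarith

end CoefBound

end LongMemory

namespace LongMemory

/-! ### Moments of the normal distribution -/

/-- By symmetry the moment is a Gamma integral over the half line. For `k = 0` the truncated
difference `2 * k - 1` is `0` and `0‼ = 1`, so the formula remains correct. -/
lemma integral_pow_gaussianReal_zero_one (k : ℕ) :
    ∫ x, x ^ (2 * k) ∂gaussianReal 0 1 = ((2 * k - 1).doubleFactorial : ℝ) := by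
  rw [integral_gaussianReal_eq_integral_smul (by norm_num)]
  have e : ∀ x : ℝ, gaussianPDFReal 0 1 x • x ^ (2 * k) =
      (Real.sqrt (2 * Real.pi))⁻¹ * (|x| ^ ((2 * k : ℕ) : ℝ) * Real.exp (-(1 / 2) * |x| ^ (2 : ℝ))) := by
    intro x
    rw [gaussianPDFReal, Real.rpow_natCast, Real.rpow_two, sq_abs, (even_two_mul k).pow_abs]
    simp only [NNReal.coe_one, mul_one, sub_zero, smul_eq_mul]
    rw [show -x ^ 2 / 2 = -(1 / 2) * x ^ 2 by ring]
    ring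
  simp_rw [e]
  rw [integral_const_mul, integral_comp_abs (f := fun x : ℝ =>
    x ^ ((2 * k : ℕ) : ℝ) * Real.exp (-(1 / 2) * x ^ (2 : ℝ))),
    integral_rpow_mul_exp_neg_mul_rpow (by norm_num)
      (lt_of_lt_of_le (by norm_num) (Nat.cast_nonneg _)) (by norm_num)]
  have h1 : (((2 * k : ℕ) : ℝ) + 1) / 2 = k + 1 / 2 := by push_cast; ring
  have h2 : -(((2 * k : ℕ) : ℝ) + 1) / 2 = -(k + 1 / 2 : ℝ) := by push_cast; ring
  rw [h1, h2, Real.Gamma_nat_add_half, Real.rpow_neg (by norm_num),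
    Real.rpow_add (by norm_num), Real.rpow_natCast, ← Real.sqrt_eq_rpow,
    Real.sqrt_mul (by norm_num), Real.sqrt_div (by norm_num), Real.sqrt_one]
  have hp : Real.sqrt Real.pi ≠ 0 := (Real.sqrt_pos.2 Real.pi_pos).ne'
  have h22 : Real.sqrt 2 ≠ 0 := by positivity
  rw [one_div_pow]
  field_simp

variable {Ω : Type*} [MeasurableSpace Ω] {P : Measure Ω} {Z : ℤ → Ω → ℝ}

lemma hasGaussianLaw_pi (hi : iIndepFun Z P) (hg : ∀ t, HasLaw (Z t) (gaussianReal 0 1) P)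
    (s : Finset ℤ) : HasGaussianLaw (fun ω (m : s) => Z m ω) P :=
  (hi.precomp (g := fun m : s => (m : ℤ)) Subtype.val_injective).hasGaussianLaw
    fun m => (hg m).hasGaussianLaw

lemma hasGaussianLaw_linear (hi : iIndepFun Z P) (hg : ∀ t, HasLaw (Z t) (gaussianReal 0 1) P)
    (s : Finset ℤ) (r : ℤ → ℝ) : HasGaussianLaw (fun ω => ∑ m ∈ s, r m * Z m ω) P := by
  have h := (hasGaussianLaw_pi hi hg s).map_fun
    (∑ m : s, r m • ContinuousLinearMap.proj (R := ℝ) (φ := fun _ : s => ℝ) m)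
  refine h.congr (Eventually.of_forall fun ω => ?_)
  simp [← Finset.sum_coe_sort s]

/-- Joint normality of two families is what allows vanishing covariances to be read as independence.
-/
lemma hasGaussianLaw_linear_prod (hi : iIndepFun Z P)
    (hg : ∀ t, HasLaw (Z t) (gaussianReal 0 1) P) (s : Finset ℤ) {ι κ : Type*} [Fintype ι]
    [Fintype κ] (r : ι → ℤ → ℝ) (r' : κ → ℤ → ℝ) :
    HasGaussianLaw (fun ω => (fun i => ∑ m ∈ s, r i m * Z m ω, fun j => ∑ m ∈ s, r' j m * Z m ω))
      P := by
  have h := (hasGaussianLaw_pi hi hg s).map_fun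
    ((ContinuousLinearMap.pi fun i => ∑ m : s, r i m •
      ContinuousLinearMap.proj (R := ℝ) (φ := fun _ : s => ℝ) m).prod
    (ContinuousLinearMap.pi fun j => ∑ m : s, r' j m •
      ContinuousLinearMap.proj (R := ℝ) (φ := fun _ : s => ℝ) m))
  refine h.congr (Eventually.of_forall fun ω => ?_)
  ext i <;> simp [← Finset.sum_coe_sort s]

lemma covariance_linear [IsProbabilityMeasure P] (hi : iIndepFun Z P)
    (hg : ∀ t, HasLaw (Z t) (gaussianReal 0 1) P) (s : Finset ℤ) (r r' : ℤ → ℝ) :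
    cov[fun ω => ∑ m ∈ s, r m * Z m ω, fun ω => ∑ m ∈ s, r' m * Z m ω; P] =
      ∑ m ∈ s, r m * r' m := by
  have hm : ∀ m, MemLp (Z m) 2 P := fun m => (hg m).hasGaussianLaw.memLp_two
  rw [covariance_fun_sum_fun_sum' (fun m _ => (hm m).const_mul _) fun m _ => (hm m).const_mul _]
  refine Finset.sum_congr rfl fun m hms => ?_
  rw [Finset.sum_eq_single_of_mem m hms]
  · rw [covariance_const_mul_left, covariance_const_mul_right,
      covariance_self (hg m).aemeasurable, (hg m).variance_eq, variance_id_gaussianReal]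
    simp
  · intro m' _ hne
    rw [covariance_const_mul_left, covariance_const_mul_right,
      (hi.indepFun hne.symm).covariance_eq_zero (hm _) (hm _)]
    simp

lemma hasLaw_linear [IsProbabilityMeasure P] (hi : iIndepFun Z P)
    (hg : ∀ t, HasLaw (Z t) (gaussianReal 0 1) P) (s : Finset ℤ) (r : ℤ → ℝ) :
    HasLaw (fun ω => ∑ m ∈ s, r m * Z m ω)
      (gaussianReal 0 (∑ m ∈ s, r m ^ 2).toNNReal) P := by
  have h := hasGaussianLaw_linear hi hg s r
  refine ⟨h.aemeasurable, ?_⟩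
  rw [h.map_eq_gaussianReal, ← covariance_self h.aemeasurable, covariance_linear hi hg]
  congr 1
  · rw [integral_finsetSum _ fun m _ => (hg m).hasGaussianLaw.integrable.const_mul _]
    refine Finset.sum_eq_zero fun m _ => ?_
    rw [integral_const_mul, (hg m).integral_eq, integral_id_gaussianReal, mul_zero]
  · simp_rw [sq]

lemma integral_linear_pow [IsProbabilityMeasure P] (hi : iIndepFun Z P)
    (hg : ∀ t, HasLaw (Z t) (gaussianReal 0 1) P) (s : Finset ℤ) (r : ℤ → ℝ) (k : ℕ) :
    ∫ ω, (∑ m ∈ s, r m * Z m ω) ^ (2 * k) ∂P = ((2 * k - 1).doubleFactorial : ℝ) * (∑ m ∈ s, r m ^ 2) ^ k := by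
  have h := hasLaw_linear hi hg s r
  set v := ∑ m ∈ s, r m ^ 2 with hv
  have hv0 : 0 ≤ v := Finset.sum_nonneg fun _ _ => sq_nonneg _
  have e1 : ∫ ω, (∑ m ∈ s, r m * Z m ω) ^ (2 * k) ∂P =
      ∫ x, x ^ (2 * k) ∂gaussianReal 0 v.toNNReal := by
    rw [← h.map_eq, integral_map h.aemeasurable (by fun_prop)]
  have e2 : gaussianReal 0 v.toNNReal = (gaussianReal 0 1).map (fun x => Real.sqrt v * x) := by
    rw [gaussianReal_map_const_mul, mul_zero, mul_one]
    congr 1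
    ext
    simp [Real.sq_sqrt hv0, hv0]
  rw [e1, e2, integral_map (by fun_prop) (by fun_prop)]
  simp_rw [mul_pow]
  rw [integral_const_mul, integral_pow_gaussianReal_zero_one, pow_mul, Real.sq_sqrt hv0, mul_comm]

/-! ### Complex linear forms -/

/-- The linear form `∑_{m ∈ s} b_m Z_m`. -/
noncomputable def linForm (Z : ℤ → Ω → ℝ) (s : Finset ℤ) (b : ℤ → ℂ) (ω : Ω) : ℂ :=
  ∑ m ∈ s, b m * (Z m ω : ℂ)

lemma linForm_re {Ω : Type*} {Z : ℤ → Ω → ℝ} (s : Finset ℤ) (b : ℤ → ℂ) (ω : Ω) :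
    (linForm Z s b ω).re = ∑ m ∈ s, (b m).re * Z m ω := by
  simp [linForm]

lemma linForm_im {Ω : Type*} {Z : ℤ → Ω → ℝ} (s : Finset ℤ) (b : ℤ → ℂ) (ω : Ω) :
    (linForm Z s b ω).im = ∑ m ∈ s, (b m).im * Z m ω := by
  simp [linForm]

lemma norm_linForm_sq {Ω : Type*} {Z : ℤ → Ω → ℝ} (s : Finset ℤ) (b : ℤ → ℂ) (ω : Ω) :
    ‖linForm Z s b ω‖ ^ 2 =
      (∑ m ∈ s, (b m).re * Z m ω) ^ 2 + (∑ m ∈ s, (b m).im * Z m ω) ^ 2 := by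
  rw [← Complex.normSq_eq_norm_sq, Complex.normSq_apply, linForm_re, linForm_im, sq, sq]

lemma memLp_linForm (hg : ∀ t, HasLaw (Z t) (gaussianReal 0 1) P) (s : Finset ℤ) (b : ℤ → ℂ)
    {p : ENNReal} (hp : p ≠ ⊤) : MemLp (linForm Z s b) p P :=
  memLp_finsetSum _ fun m _ => ((hg m).hasGaussianLaw.memLp hp).ofReal.const_mul _

lemma integrable_norm_linForm_pow [IsProbabilityMeasure P]
    (hg : ∀ t, HasLaw (Z t) (gaussianReal 0 1) P) (s : Finset ℤ) (b : ℤ → ℂ) (k : ℕ) :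
    Integrable (fun ω => ‖linForm Z s b ω‖ ^ k) P := by
  have := (memLp_linForm hg s b (p := (k : ENNReal)) (by simp)).integrable_norm_pow'
  simpa using this

lemma integrable_linear_pow [IsProbabilityMeasure P] (hi : iIndepFun Z P)
    (hg : ∀ t, HasLaw (Z t) (gaussianReal 0 1) P) (s : Finset ℤ) (r : ℤ → ℝ) (k : ℕ) :
    Integrable (fun ω => (∑ m ∈ s, r m * Z m ω) ^ k) P := by
  have h := hasGaussianLaw_linear hi hg s r
  have := (h.memLp (p := (k : ENNReal)) (by simp)).integrable_norm_pow'
  refine (integrable_norm_iff ?_).1 (by simpa using this)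
  exact (h.aemeasurable.pow_const k).aestronglyMeasurable

/-- Real and imaginary parts are centred normal with variance at most the square sum of the
coefficients. Convexity of the `k`-th power separates them, so their correlation plays no role; the
constant is not sharp. -/
lemma integral_norm_linForm_pow_le [IsProbabilityMeasure P] (hi : iIndepFun Z P)
    (hg : ∀ t, HasLaw (Z t) (gaussianReal 0 1) P) (s : Finset ℤ) (b : ℤ → ℂ) (k : ℕ) :
    ∫ ω, ‖linForm Z s b ω‖ ^ (2 * k) ∂P ≤
      2 ^ (k + 1) * ((2 * k - 1).doubleFactorial : ℝ) * (∑ m ∈ s, ‖b m‖ ^ 2) ^ k := by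
  have hre := integral_linear_pow hi hg s (fun m => (b m).re) k
  have him := integral_linear_pow hi hg s (fun m => (b m).im) k
  have hle : ∀ ω, ‖linForm Z s b ω‖ ^ (2 * k) ≤ 2 ^ k * ((∑ m ∈ s, (b m).re * Z m ω) ^ (2 * k) +
      (∑ m ∈ s, (b m).im * Z m ω) ^ (2 * k)) := by
    intro ω
    rw [pow_mul, norm_linForm_sq, pow_mul, pow_mul]
    refine (add_pow_le (sq_nonneg _) (sq_nonneg _) k).trans ?_
    refine mul_le_mul_of_nonneg_right (pow_le_pow_right₀ (by norm_num) (Nat.sub_le _ _)) ?_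
    positivity
  have hB : ∀ m, (b m).re ^ 2 ≤ ‖b m‖ ^ 2 ∧ (b m).im ^ 2 ≤ ‖b m‖ ^ 2 := by
    intro m
    rw [← Complex.normSq_eq_norm_sq, Complex.normSq_apply]
    constructor <;> nlinarith [sq_nonneg (b m).re, sq_nonneg (b m).im]
  have h1 : (∑ m ∈ s, (b m).re ^ 2) ^ k ≤ (∑ m ∈ s, ‖b m‖ ^ 2) ^ k :=
    pow_le_pow_left₀ (Finset.sum_nonneg fun _ _ => sq_nonneg _)
      (Finset.sum_le_sum fun m _ => (hB m).1) k
  have h2 : (∑ m ∈ s, (b m).im ^ 2) ^ k ≤ (∑ m ∈ s, ‖b m‖ ^ 2) ^ k :=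
    pow_le_pow_left₀ (Finset.sum_nonneg fun _ _ => sq_nonneg _)
      (Finset.sum_le_sum fun m _ => (hB m).2) k
  have i1 := integrable_linear_pow hi hg s (fun m => (b m).re) (2 * k)
  have i2 := integrable_linear_pow hi hg s (fun m => (b m).im) (2 * k)
  calc ∫ ω, ‖linForm Z s b ω‖ ^ (2 * k) ∂P
      ≤ ∫ ω, 2 ^ k * ((∑ m ∈ s, (b m).re * Z m ω) ^ (2 * k) +
      (∑ m ∈ s, (b m).im * Z m ω) ^ (2 * k)) ∂P :=
        integral_mono (integrable_norm_linForm_pow hg s b _) ((i1.add i2).const_mul _) hle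
    _ = 2 ^ k * (((2 * k - 1).doubleFactorial : ℝ) * (∑ m ∈ s, (b m).re ^ 2) ^ k +
        ((2 * k - 1).doubleFactorial : ℝ) * (∑ m ∈ s, (b m).im ^ 2) ^ k) := by
        rw [integral_const_mul, integral_add i1 i2, hre, him]
    _ ≤ 2 ^ k * (((2 * k - 1).doubleFactorial : ℝ) * (∑ m ∈ s, ‖b m‖ ^ 2) ^ k +
        ((2 * k - 1).doubleFactorial : ℝ) * (∑ m ∈ s, ‖b m‖ ^ 2) ^ k) := by gcongr
    _ = _ := by ring

/-- The eighth absolute moment of a standard complex normal variable. -/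
lemma integral_norm_linForm_pow_eight [IsProbabilityMeasure P] (hi : iIndepFun Z P)
    (hg : ∀ t, HasLaw (Z t) (gaussianReal 0 1) P) (s : Finset ℤ) (b : ℤ → ℂ)
    (hre : ∑ m ∈ s, (b m).re ^ 2 = 1 / 2) (him : ∑ m ∈ s, (b m).im ^ 2 = 1 / 2)
    (hri : ∑ m ∈ s, (b m).re * (b m).im = 0) :
    ∫ ω, ‖linForm Z s b ω‖ ^ 8 ∂P = 24 := by
  set U : Ω → ℝ := fun ω => ∑ m ∈ s, (b m).re * Z m ω with hU
  set V : Ω → ℝ := fun ω => ∑ m ∈ s, (b m).im * Z m ω with hV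
  have hind : IndepFun U V P := by
    have h := (hasGaussianLaw_linear_prod hi hg s (fun _ : Unit => fun m => (b m).re)
      (fun _ : Unit => fun m => (b m).im)).indepFun_of_covariance_eval
      fun _ _ => by rw [covariance_linear hi hg, hri]
    exact h.comp (measurable_pi_apply ()) (measurable_pi_apply ())
  have mU : ∀ k, ∫ ω, U ω ^ (2 * k) ∂P = ((2 * k - 1).doubleFactorial : ℝ) * (1 / 2) ^ k :=
    fun k => by rw [← hre]; exact integral_linear_pow hi hg s _ k
  have mV : ∀ k, ∫ ω, V ω ^ (2 * k) ∂P = ((2 * k - 1).doubleFactorial : ℝ) * (1 / 2) ^ k :=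
    fun k => by rw [← him]; exact integral_linear_pow hi hg s _ k
  have iU : ∀ k, Integrable (fun ω => U ω ^ k) P := fun k => integrable_linear_pow hi hg s _ k
  have iV : ∀ k, Integrable (fun ω => V ω ^ k) P := fun k => integrable_linear_pow hi hg s _ k
  have hUV : ∀ j k, IndepFun (fun ω => U ω ^ j) (fun ω => V ω ^ k) P := fun j k =>
    hind.comp (φ := fun x => x ^ j) (ψ := fun x => x ^ k) (by fun_prop) (by fun_prop)
  have iUV : ∀ j k, Integrable (fun ω => U ω ^ j * V ω ^ k) P := fun j k =>
    (hUV j k).integrable_mul (iU j) (iV k)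
  have mUV : ∀ j k, ∫ ω, U ω ^ (2 * j) * V ω ^ (2 * k) ∂P =
      ((2 * j - 1).doubleFactorial : ℝ) * (1 / 2) ^ j *
        (((2 * k - 1).doubleFactorial : ℝ) * (1 / 2) ^ k) := fun j k => by
    rw [(hUV (2 * j) (2 * k)).integral_fun_mul_eq_mul_integral (iU _).aestronglyMeasurable
      (iV _).aestronglyMeasurable, mU, mV]
  -- Binomial expansion of `(U² + V²)⁴`. With independent normal `U`, `V` of variance `1/2` the
  -- moments of order 2, 4, 6, 8 are `1/2`, `3/4`, `15/8`, `105/16`, and the sum is `4! = 24`.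
  have e : ∀ ω, ‖linForm Z s b ω‖ ^ 8 = U ω ^ (2 * 4) + 4 * (U ω ^ (2 * 3) * V ω ^ (2 * 1)) +
      6 * (U ω ^ (2 * 2) * V ω ^ (2 * 2)) + 4 * (U ω ^ (2 * 1) * V ω ^ (2 * 3)) +
      V ω ^ (2 * 4) := fun ω => by
    rw [show 8 = 2 * 4 by norm_num, pow_mul, norm_linForm_sq]
    simp only [hU, hV]
    ring
  simp_rw [e]
  rw [integral_add, integral_add, integral_add, integral_add]
  · simp_rw [integral_const_mul, mUV, mU, mV]
    norm_num [Nat.doubleFactorial]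
  all_goals first
    | exact iU _
    | exact iV _
    | exact (iUV _ _).const_mul _
    | exact (iU _).add ((iUV _ _).const_mul _)
    | exact ((iU _).add ((iUV _ _).const_mul _)).add ((iUV _ _).const_mul _)
    | exact (((iU _).add ((iUV _ _).const_mul _)).add ((iUV _ _).const_mul _)).add
        ((iUV _ _).const_mul _)

/-- Uncorrelated complex linear forms are independent. -/
lemma indepFun_norm_linForm_pow [IsProbabilityMeasure P] (hi : iIndepFun Z P)
    (hg : ∀ t, HasLaw (Z t) (gaussianReal 0 1) P) (s : Finset ℤ) (b b' : ℤ → ℂ)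
    (h1 : ∑ m ∈ s, b m * b' m = 0) (h2 : ∑ m ∈ s, b m * (starRingEnd ℂ) (b' m) = 0) (k : ℕ) :
    IndepFun (fun ω => ‖linForm Z s b ω‖ ^ (2 * k)) (fun ω => ‖linForm Z s b' ω‖ ^ (2 * k)) P := by
  set r : Bool → (ℤ → ℂ) → ℤ → ℝ := fun i b m => bif i then (b m).re else (b m).im with hr
  -- The relations with and without conjugation amount to four real equations; their sums and
  -- differences isolate each of the four covariances.
  have hcov : ∀ i j, ∑ m ∈ s, r i b m * r j b' m = 0 := by
    have a1 := congrArg Complex.re h1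
    have a2 := congrArg Complex.im h1
    have a3 := congrArg Complex.re h2
    have a4 := congrArg Complex.im h2
    simp only [Complex.re_sum, Complex.im_sum, Complex.mul_re, Complex.mul_im, Complex.conj_re,
      Complex.conj_im, Complex.zero_re, Complex.zero_im, mul_neg, sub_neg_eq_add,
      Finset.sum_add_distrib, Finset.sum_sub_distrib, Finset.sum_neg_distrib] at a1 a2 a3 a4
    intro i j
    cases i <;> cases j <;> simp only [hr, cond_true, cond_false] <;> linarith
  have h := (hasGaussianLaw_linear_prod hi hg s (fun i : Bool => r i b)
    (fun i : Bool => r i b')).indepFun_of_covariance_eval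
    fun i j => by rw [covariance_linear hi hg, hcov]
  have h' := h.comp (φ := fun x : Bool → ℝ => (x true ^ 2 + x false ^ 2) ^ k)
    (ψ := fun x : Bool → ℝ => (x true ^ 2 + x false ^ 2) ^ k) (by fun_prop) (by fun_prop)
  have e : ∀ b : ℤ → ℂ, (fun ω => ‖linForm Z s b ω‖ ^ (2 * k)) =
      (fun x : Bool → ℝ => (x true ^ 2 + x false ^ 2) ^ k) ∘
        fun ω i => ∑ m ∈ s, r i b m * Z m ω := fun b => by
    funext ω
    simp only [pow_mul, norm_linForm_sq, Function.comp_apply, hr, cond_true, cond_false]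
  rw [e, e]
  exact h'

end LongMemory

namespace LongMemory

/-! ### Transfer of moment bounds to limits -/

/-- A Fatou argument: `L²` convergence implies convergence in measure, along which `L^k` norms are
lower semicontinuous. It carries the Gaussian bounds from truncated moving averages to the process,
whose series is only known to converge in `L²`. -/
lemma integral_norm_pow_le_of_tendsto {Ω : Type*} [MeasurableSpace Ω] {P : Measure Ω}
    [IsProbabilityMeasure P] {f : ℕ → Ω → ℂ} {g : Ω → ℂ} {k : ℕ} (hk : k ≠ 0) {B : ℝ}
    (hf : ∀ n, MemLp (f n) k P) (hg : AEStronglyMeasurable g P)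
    (hfg : Tendsto (fun n => eLpNorm (f n - g) 2 P) atTop (𝓝 0))
    (hB : ∀ᶠ n in atTop, ∫ ω, ‖f n ω‖ ^ k ∂P ≤ B) :
    MemLp g k P ∧ ∫ ω, ‖g ω‖ ^ k ∂P ≤ B := by
  have hk' : (k : ENNReal) ≠ 0 := by exact_mod_cast hk
  have hkt : (k : ENNReal) ≠ ⊤ := by simp
  have hB0 : 0 ≤ B := by
    obtain ⟨n, hn⟩ := hB.exists
    exact (integral_nonneg fun ω => by positivity).trans hn
  have hnorm : ∀ {h : Ω → ℂ}, MemLp h k P →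
      eLpNorm h k P = ENNReal.ofReal ((∫ ω, ‖h ω‖ ^ k ∂P) ^ ((k : ℝ)⁻¹)) := fun hh => by
    rw [hh.eLpNorm_eq_integral_rpow_norm hk' hkt]
    simp [Real.rpow_natCast]
  have hm := tendstoInMeasure_of_tendsto_eLpNorm (by norm_num : (2 : ENNReal) ≠ 0)
    (fun n => (hf n).1) hg hfg
  have hle : eLpNorm g k P ≤ ENNReal.ofReal (B ^ ((k : ℝ)⁻¹)) := by
    refine eLpNorm_le_of_tendstoInMeasure (hB.mono fun n hn => ?_) hm fun n => (hf n).1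
    rw [hnorm (hf n)]
    exact ENNReal.ofReal_le_ofReal (Real.rpow_le_rpow (integral_nonneg fun ω => by positivity) hn
      (by positivity))
  have hgm : MemLp g k P := ⟨hg, hle.trans_lt ENNReal.ofReal_lt_top⟩
  refine ⟨hgm, ?_⟩
  rw [hnorm hgm, ENNReal.ofReal_le_ofReal_iff (by positivity)] at hle
  have h1 : 0 ≤ ∫ ω, ‖g ω‖ ^ k ∂P := integral_nonneg fun ω => by positivity
  exact (Real.rpow_le_rpow_iff h1 hB0 (by positivity)).1 hle

/-! ### The discrete Fourier transform of a block -/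

/-- The discrete Fourier transform of the observations `Y_0, …, Y_{N-1}`. -/
noncomputable def dft {Ω : Type*} (Y : ℕ → Ω → ℝ) (N : ℕ) (lam : ℝ) (ω : Ω) : ℂ :=
  ∑ s ∈ Finset.range N, (Y s ω : ℂ) * phase lam ^ s

lemma sum_Ico_ite_shift (F : ℤ → ℂ) {n N l : ℕ} (hl : l ≤ n) :
    (∑ m ∈ Finset.Ico (-(n : ℤ)) N, if 0 ≤ m + (l : ℤ) ∧ m + (l : ℤ) < N then F (m + l) else 0) =
      ∑ s ∈ Finset.range N, F s := by
  rw [← Finset.sum_filter]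
  refine Finset.sum_nbij' (fun m => (m + l).toNat) (fun s => (s : ℤ) - l) ?_ ?_ ?_ ?_ ?_
  · intro m hm; simp only [Finset.mem_filter, Finset.mem_Ico, Finset.mem_range] at hm ⊢; omega
  · intro s hs; simp only [Finset.mem_filter, Finset.mem_Ico, Finset.mem_range] at hs ⊢; omega
  · intro m hm; simp only [Finset.mem_filter, Finset.mem_Ico] at hm; omega
  · intro s hs; simp
  · intro m hm; simp only [Finset.mem_filter, Finset.mem_Ico] at hm; congr 1; omega

lemma phase_ne_zero (lam : ℝ) : phase lam ≠ 0 := Complex.exp_ne_zero _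

/-- The terms are regrouped by the innovation index `m = s - l`. Since `phase ^ s = phase ^ m *
phase ^ l`, a factor of modulus one splits off and the sum over lags is `blockCoef`. -/
lemma dft_sub_eq_linForm {Ω : Type*} (Z : ℤ → Ω → ℝ) (c : ℤ → ℕ → ℕ → ℝ) (T : ℕ) (t₀ : ℤ)
    (N n : ℕ) (lam : ℝ) (A : ℂ) (ω : Ω) :
    dft (fun s ω => ∑ l ∈ Finset.range n, c (t₀ + s) T l * Z (t₀ + s - l) ω) N lam ω -
        A * dft (fun s => Z (t₀ + s)) N lam ω =
      linForm (fun m => Z (t₀ + m)) (Finset.Ico (-(n : ℤ)) N)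
        (fun m => phase lam ^ m * blockCoef c T t₀ N n lam A m) ω := by
  have hz := phase_ne_zero lam
  have h1 : dft (fun s ω => ∑ l ∈ Finset.range n, c (t₀ + s) T l * Z (t₀ + s - l) ω) N lam ω =
      ∑ m ∈ Finset.Ico (-(n : ℤ)) N, ∑ l ∈ Finset.range n,
        if 0 ≤ m + (l : ℤ) ∧ m + (l : ℤ) < N then
          (c (t₀ + (m + l)) T l : ℂ) * Z (t₀ + (m + l) - l) ω * phase lam ^ (m + l) else 0 := by
    rw [Finset.sum_comm, dft]
    simp only [Complex.ofReal_sum, Finset.sum_mul]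
    rw [Finset.sum_comm]
    refine Finset.sum_congr rfl fun l hl => ?_
    rw [sum_Ico_ite_shift (fun k => (c (t₀ + k) T l : ℂ) * Z (t₀ + k - l) ω * phase lam ^ k)
      (Finset.mem_range.1 hl).le]
    simp
  have h2 : A * dft (fun s => Z (t₀ + s)) N lam ω = ∑ m ∈ Finset.Ico (-(n : ℤ)) N,
      if 0 ≤ m ∧ m < N then A * (Z (t₀ + m) ω * phase lam ^ m) else 0 := by
    have := sum_Ico_ite_shift (fun k => A * (Z (t₀ + k) ω * phase lam ^ k)) (Nat.zero_le n) (N := N)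
    simp only [Nat.cast_zero, add_zero] at this
    rw [this, dft, Finset.mul_sum]
    simp
  rw [h1, h2, ← Finset.sum_sub_distrib, linForm]
  refine Finset.sum_congr rfl fun m _ => ?_
  rw [blockCoef, mul_sub, sub_mul, Finset.mul_sum, Finset.sum_mul]
  congr 1
  · refine Finset.sum_congr rfl fun l _ => ?_
    split_ifs with h
    · rw [zpow_add₀ hz, zpow_natCast, ← add_assoc, add_sub_cancel_right]
      ring
    · simp
  · split_ifs with h
    · ring
    · simp

/-- For truncated series the difference is a Gaussian linear form, whose eighth moment is at most
`2^5 * 7!!` times the fourth power of the square sum of its coefficients; then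
`integral_norm_pow_le_of_tendsto` applies. -/
lemma IsLocallyStationary.integral_norm_dft_sub_le {Ω : Type*} [MeasurableSpace Ω] {P : Measure Ω}
    [IsProbabilityMeasure P] {Z : ℤ → Ω → ℝ} {X : ℤ → ℕ → Ω → ℝ} {c : ℤ → ℕ → ℕ → ℝ}
    {ψ : ℕ → ℝ → ℝ} {a d : ℝ → ℝ} (hX : IsLocallyStationary P Z X c ψ a d)
    {T N : ℕ} {t₀ : ℤ} (ht : 1 ≤ t₀) (htN : t₀ + N ≤ T + 1) (lam : ℝ) (A : ℂ) {V : ℝ}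
    (hV : ∀ᶠ n : ℕ in atTop,
      ∑ m ∈ Finset.Ico (-(n : ℤ)) N, ‖blockCoef c T t₀ N n lam A m‖ ^ 2 ≤ V) :
    MemLp (fun ω => dft (fun s => X (t₀ + s) T) N lam ω - A * dft (fun s => Z (t₀ + s)) N lam ω)
      8 P ∧
    ∫ ω, ‖dft (fun s => X (t₀ + s) T) N lam ω - A * dft (fun s => Z (t₀ + s)) N lam ω‖ ^ 8 ∂P ≤
      2 ^ 5 * 105 * V ^ 4 := by
  have hi : iIndepFun (fun m => Z (t₀ + m)) P :=
    hX.indep.precomp (g := fun m => t₀ + m) (add_right_injective t₀)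
  have hg : ∀ m, HasLaw (Z (t₀ + m)) (gaussianReal 0 1) P := fun m => hX.gaussian _
  have hXm : ∀ s ∈ Finset.range N, AEStronglyMeasurable (X (t₀ + s) T) P := fun s hs => by
    have := Finset.mem_range.1 hs
    exact hX.measurable_X T _ (by omega) (by omega)
  have hZm : ∀ t, AEStronglyMeasurable (Z t) P := fun t =>
    (hX.gaussian t).aemeasurable.aestronglyMeasurable
  have hdm : ∀ Y : ℕ → Ω → ℝ, (∀ s ∈ Finset.range N, AEStronglyMeasurable (Y s) P) →
      AEStronglyMeasurable (dft Y N lam) P := fun Y hY =>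
    Finset.aestronglyMeasurable_fun_sum _ fun s hs =>
      (Complex.continuous_ofReal.comp_aestronglyMeasurable (hY s hs)).mul_const _
  have key := integral_norm_pow_le_of_tendsto (P := P) (k := 8) (by norm_num)
    (f := fun n => linForm (fun m => Z (t₀ + m)) (Finset.Ico (-(n : ℤ)) N)
        (fun m => phase lam ^ m * blockCoef c T t₀ N n lam A m))
    (g := fun ω => dft (fun s => X (t₀ + s) T) N lam ω - A * dft (fun s => Z (t₀ + s)) N lam ω)
    (B := 2 ^ 5 * 105 * V ^ 4) (fun n => memLp_linForm hg _ _ (by simp)) ?_ ?_ ?_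
  · simpa using key
  · exact (hdm _ hXm).sub ((hdm _ fun s _ => hZm _).const_mul A)
  · have hlim : Tendsto (fun n : ℕ => ∑ s ∈ Finset.range N, eLpNorm
        (fun ω => X (t₀ + s) T ω - ∑ l ∈ Finset.range n, c (t₀ + s) T l * Z (t₀ + s - l) ω) 2 P)
        atTop (𝓝 0) := by
      have h : ∀ s ∈ Finset.range N, Tendsto (fun n : ℕ => eLpNorm
          (fun ω => X (t₀ + s) T ω - ∑ l ∈ Finset.range n, c (t₀ + s) T l * Z (t₀ + s - l) ω) 2 P)
          atTop (𝓝 0) := fun s hs => by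
        have := Finset.mem_range.1 hs
        exact hX.representation T _ (by omega) (by omega)
      simpa using tendsto_finsetSum _ h
    refine tendsto_of_tendsto_of_tendsto_of_le_of_le tendsto_const_nhds hlim (fun _ => zero_le)
      fun n => ?_
    have e : (linForm (fun m => Z (t₀ + m)) (Finset.Ico (-(n : ℤ)) N)
        (fun m => phase lam ^ m * blockCoef c T t₀ N n lam A m)) -
        (fun ω => dft (fun s => X (t₀ + s) T) N lam ω - A * dft (fun s => Z (t₀ + s)) N lam ω) =
        -∑ s ∈ Finset.range N, (fun ω => ((X (t₀ + s) T ω -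
          ∑ l ∈ Finset.range n, c (t₀ + s) T l * Z (t₀ + s - l) ω : ℝ) : ℂ) * phase lam ^ s) := by
      funext ω
      rw [Pi.sub_apply, ← dft_sub_eq_linForm, Pi.neg_apply, Finset.sum_apply, dft, dft, dft]
      simp only [Complex.ofReal_sub, sub_mul, Finset.sum_sub_distrib]
      ring
    rw [e, eLpNorm_neg]
    have hterm : ∀ s ∈ Finset.range N, AEStronglyMeasurable (fun ω => ((X (t₀ + s) T ω -
          ∑ l ∈ Finset.range n, c (t₀ + s) T l * Z (t₀ + s - l) ω : ℝ) : ℂ) * phase lam ^ s) P :=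
      fun s hs => (Complex.continuous_ofReal.comp_aestronglyMeasurable ((hXm s hs).sub
        (Finset.aestronglyMeasurable_fun_sum _ fun l _ => (hZm _).const_mul _))).mul_const _
    refine (eLpNorm_sum_le hterm (by norm_num)).trans (Finset.sum_le_sum fun s _ => ?_)
    refine eLpNorm_mono fun ω => ?_
    rw [norm_mul, norm_pow, norm_phase, one_pow, mul_one, Complex.norm_real]
  · filter_upwards [hV] with n hn
    have h := integral_norm_linForm_pow_le hi hg (Finset.Ico (-(n : ℤ)) N)
      (fun m => phase lam ^ m * blockCoef c T t₀ N n lam A m) 4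
    refine h.trans ?_
    have e : ∑ m ∈ Finset.Ico (-(n : ℤ)) N, ‖phase lam ^ m * blockCoef c T t₀ N n lam A m‖ ^ 2 =
        ∑ m ∈ Finset.Ico (-(n : ℤ)) N, ‖blockCoef c T t₀ N n lam A m‖ ^ 2 :=
      Finset.sum_congr rfl fun m _ => by rw [norm_mul, norm_zpow, norm_phase, one_zpow, one_mul]
    rw [e]
    have h105 : ((2 * 4 - 1).doubleFactorial : ℝ) = 105 := by norm_num [Nat.doubleFactorial]
    rw [h105]
    have := Finset.sum_nonneg fun m (_ : m ∈ Finset.Ico (-(n : ℤ)) N) =>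
      sq_nonneg ‖blockCoef c T t₀ N n lam A m‖
    gcongr

end LongMemory

namespace LongMemory

/-! ### Fourier frequencies -/

lemma fourierFreq_pos {N k : ℕ} (hN : 0 < N) (hk : 1 ≤ k) : 0 < fourierFreq N k := by
  have : (0 : ℝ) < N := by exact_mod_cast hN
  have : (0 : ℝ) < k := by exact_mod_cast hk
  unfold fourierFreq
  have := Real.pi_pos
  positivity

lemma fourierFreq_le_pi {N k : ℕ} (hN : 0 < N) (hk : k ≤ N / 2) : fourierFreq N k ≤ Real.pi := by
  have h0 : (0 : ℝ) < N := by exact_mod_cast hN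
  have h1 : (2 : ℝ) * k ≤ N := by exact_mod_cast (by omega : 2 * k ≤ N)
  unfold fourierFreq
  rw [div_le_iff₀ h0]
  nlinarith [Real.pi_pos]

lemma one_le_mul_fourierFreq {N k : ℕ} (hN : 0 < N) (hk : 1 ≤ k) :
    1 ≤ (N : ℝ) * fourierFreq N k := by
  have h0 : (0 : ℝ) < N := by exact_mod_cast hN
  have h1 : (1 : ℝ) ≤ k := by exact_mod_cast hk
  unfold fourierFreq
  rw [mul_div_cancel₀ _ h0.ne']
  nlinarith [Real.two_le_pi]

/-- Since `λ_k ≥ k / N`, the sum is at most `N ^ β` times a power sum of order `N ^ (1 - β)`. -/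
lemma sum_fourierFreq_rpow_le {N : ℕ} (hN : 2 ≤ N) {β : ℝ} (hβ0 : 0 ≤ β) (hβ : β < 1) :
    ∑ k ∈ Finset.Icc 1 (N / 2), fourierFreq N k ^ (-β) ≤ (1 - β)⁻¹ * N := by
  have h0 : (0 : ℝ) < N := by exact_mod_cast (by omega : 0 < N)
  have hs : 0 < 1 - β := by linarith
  have hterm : ∀ k ∈ Finset.Icc 1 (N / 2), fourierFreq N k ^ (-β) ≤
      (N : ℝ) ^ β * (k : ℝ) ^ ((1 - β) - 1) := by
    intro k hk
    have hk1 : (0 : ℝ) < k := by exact_mod_cast (Finset.mem_Icc.1 hk).1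
    have h1 : (k : ℝ) / N ≤ fourierFreq N k := by
      unfold fourierFreq
      gcongr
      nlinarith [Real.two_le_pi]
    refine (Real.rpow_le_rpow_of_nonpos (by positivity) h1 (by linarith)).trans (le_of_eq ?_)
    rw [Real.div_rpow hk1.le h0.le, Real.rpow_neg h0.le, div_inv_eq_mul, mul_comm]
    congr 2; ring
  refine (Finset.sum_le_sum hterm).trans ?_
  rw [← Finset.mul_sum]
  have h2 := sum_Ico_one_rpow_le hs (by linarith) (N / 2 + 1)
  have e : Finset.Icc 1 (N / 2) = Finset.Ico 1 (N / 2 + 1) := by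
    ext; simp only [Finset.mem_Icc, Finset.mem_Ico]; omega
  have h3 : (((N / 2 + 1 : ℕ) : ℝ)) ^ (1 - β) ≤ (N : ℝ) ^ (1 - β) :=
    Real.rpow_le_rpow (by positivity) (by exact_mod_cast (by omega : N / 2 + 1 ≤ N)) hs.le
  rw [e]
  calc (N : ℝ) ^ β * ∑ k ∈ Finset.Ico 1 (N / 2 + 1), (k : ℝ) ^ (1 - β - 1)
      ≤ (N : ℝ) ^ β * ((N : ℝ) ^ (1 - β) / (1 - β)) := by
        gcongr
        exact h2.trans (by gcongr)
    _ = ((N : ℝ) ^ β * (N : ℝ) ^ (1 - β)) * (1 - β)⁻¹ := by ring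
    _ = _ := by
      rw [← Real.rpow_add h0, show β + (1 - β) = 1 by ring, Real.rpow_one, mul_comm]

lemma two_le_of_pos_of_even {N : ℕ} (h0 : 0 < N) (h : Even N) : 2 ≤ N := by
  obtain ⟨r, rfl⟩ := h
  omega

/-- Averages over blocks and Fourier frequencies of an array with an integrable singularity at
frequency zero. -/
lemma sum_sum_le {N M : ℕ} (hN : 2 ≤ N) {β B : ℝ} (hβ0 : 0 ≤ β) (hβ : β < 1)
    {g : ℕ → ℕ → ℝ}
    (hg : ∀ k ∈ Finset.Icc 1 (N / 2), ∀ j ∈ Finset.Icc 1 M, g j k ≤ B * fourierFreq N k ^ (-β))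
    (hB : 0 ≤ B) :
    ∑ k ∈ Finset.Icc 1 (N / 2), ∑ j ∈ Finset.Icc 1 M, g j k ≤
      B * (1 - β)⁻¹ * ((N * M : ℕ) : ℝ) := by
  calc ∑ k ∈ Finset.Icc 1 (N / 2), ∑ j ∈ Finset.Icc 1 M, g j k
      ≤ ∑ k ∈ Finset.Icc 1 (N / 2), ∑ j ∈ Finset.Icc 1 M, B * fourierFreq N k ^ (-β) :=
        Finset.sum_le_sum fun k hk => Finset.sum_le_sum fun j hj => hg k hk j hj
    _ = M * B * ∑ k ∈ Finset.Icc 1 (N / 2), fourierFreq N k ^ (-β) := by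
        rw [Finset.mul_sum]
        refine Finset.sum_congr rfl fun k _ => ?_
        rw [Finset.sum_const, Nat.card_Icc, nsmul_eq_mul, Nat.add_sub_cancel, mul_assoc]
    _ ≤ M * B * ((1 - β)⁻¹ * N) := by
        gcongr
        exact sum_fourierFreq_rpow_le hN hβ0 hβ
    _ = _ := by push_cast; ring

/-- A discrete dominated convergence. Above `δ` the array is uniformly small. Below `δ` one has
`λ^(-β) ≤ δ^(γ-β) λ^(-γ)`, and with `γ` halfway between `β` and `1` the averages of `λ^(-γ)` stay
bounded while `δ^(γ-β)` is small. -/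
lemma tendsto_average_zero {N M : ℕ → ℕ} (hN : ∀ n, 2 ≤ N n) (hM : ∀ n, 0 < M n)
    {β B : ℝ} (hβ0 : 0 < β) (hβ : β < 1) (hB : 0 ≤ B) {g : ℕ → ℕ → ℕ → ℝ}
    (hg0 : ∀ n, ∀ k ∈ Finset.Icc 1 (N n / 2), ∀ j ∈ Finset.Icc 1 (M n), 0 ≤ g n j k)
    (hg : ∀ n, ∀ k ∈ Finset.Icc 1 (N n / 2), ∀ j ∈ Finset.Icc 1 (M n),
      g n j k ≤ B * fourierFreq (N n) k ^ (-β))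
    (hsmall : ∀ δ > 0, ∀ ε > 0, ∀ᶠ n in atTop, ∀ k ∈ Finset.Icc 1 (N n / 2),
      ∀ j ∈ Finset.Icc 1 (M n), δ ≤ fourierFreq (N n) k → g n j k ≤ ε) :
    Tendsto (fun n => 1 / ((N n * M n : ℕ) : ℝ) *
      ∑ k ∈ Finset.Icc 1 (N n / 2), ∑ j ∈ Finset.Icc 1 (M n), g n j k) atTop (𝓝 0) := by
  set γ := (1 + β) / 2 with hγ
  have hγβ : β < γ := by rw [hγ]; linarith
  have hγ1 : γ < 1 := by rw [hγ]; linarith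
  have h1γ : 0 < 1 - γ := by linarith
  have hT : ∀ n, (0 : ℝ) < ((N n * M n : ℕ) : ℝ) := fun n => by
    exact_mod_cast Nat.mul_pos (by have := hN n; omega) (hM n)
  rw [Metric.tendsto_atTop']
  intro ε hε
  obtain ⟨δ, hδ0, hδ⟩ : ∃ δ > 0, B * δ ^ (γ - β) * (1 - γ)⁻¹ < ε / 2 := by
    have h : Tendsto (fun δ : ℝ => B * δ ^ (γ - β) * (1 - γ)⁻¹) (𝓝[>] 0) (𝓝 0) := by
      have h1 : ContinuousAt (fun δ : ℝ => B * δ ^ (γ - β) * (1 - γ)⁻¹) 0 :=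
        ((Real.continuousAt_rpow_const 0 (γ - β) (Or.inr (by linarith))).const_mul B).mul_const _
      have h2 := h1.tendsto
      rw [Real.zero_rpow (by linarith), mul_zero, zero_mul] at h2
      exact h2.mono_left nhdsWithin_le_nhds
    obtain ⟨δ, hδ⟩ := ((h.eventually (gt_mem_nhds (half_pos hε))).and
      self_mem_nhdsWithin).exists
    exact ⟨δ, hδ.2, hδ.1⟩
  obtain ⟨n₀, hn₀⟩ := eventually_atTop.1 (hsmall δ hδ0 (ε / 2) (half_pos hε))
  refine ⟨n₀, fun n hn => ?_⟩
  have hpos : 0 ≤ ∑ k ∈ Finset.Icc 1 (N n / 2), ∑ j ∈ Finset.Icc 1 (M n), g n j k :=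
    Finset.sum_nonneg fun k hk => Finset.sum_nonneg fun j hj => hg0 n k hk j hj
  rw [Real.dist_eq, sub_zero, abs_of_nonneg (mul_nonneg (by positivity) hpos)]
  -- Subtracting `ε / 2` makes a single bound valid on both sides of `δ`.
  have hpt : ∀ k ∈ Finset.Icc 1 (N n / 2), ∀ j ∈ Finset.Icc 1 (M n),
      g n j k - ε / 2 ≤ B * δ ^ (γ - β) * fourierFreq (N n) k ^ (-γ) := by
    intro k hk j hj
    have hl := fourierFreq_pos (N := N n) (by have := hN n; omega) (Finset.mem_Icc.1 hk).1
    set lam := fourierFreq (N n) k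
    rcases le_or_gt δ lam with h | h
    · have := hn₀ n hn.le k hk j hj h
      have : 0 ≤ B * δ ^ (γ - β) * lam ^ (-γ) := by positivity
      linarith
    · have h1 := hg n k hk j hj
      have h2 : lam ^ (-β) = lam ^ (γ - β) * lam ^ (-γ) := by
        rw [← Real.rpow_add hl]; congr 1; ring
      have h3 : lam ^ (γ - β) ≤ δ ^ (γ - β) := Real.rpow_le_rpow hl.le h.le (by linarith)
      calc g n j k - ε / 2 ≤ B * (lam ^ (γ - β) * lam ^ (-γ)) := by rw [← h2]; linarith
        _ ≤ B * (δ ^ (γ - β) * lam ^ (-γ)) := by gcongr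
        _ = _ := by ring
  have hsum := sum_sum_le (M := M n) (hN n) (by linarith) hγ1 hpt (by positivity)
  simp only [Finset.sum_sub_distrib, Finset.sum_const, Nat.card_Icc, Nat.add_sub_cancel,
    nsmul_eq_mul] at hsum
  have hhalf : ((N n / 2 : ℕ) : ℝ) * (M n * (ε / 2)) ≤ ((N n * M n : ℕ) : ℝ) * (ε / 2) := by
    rw [← mul_assoc]
    refine mul_le_mul_of_nonneg_right ?_ (by positivity)
    exact_mod_cast Nat.mul_le_mul_right _ (Nat.div_le_self _ _)
  rw [one_div, inv_mul_lt_iff₀ (hT n)]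
  calc _ ≤ ((N n * M n : ℕ) : ℝ) * (ε / 2) +
        B * δ ^ (γ - β) * (1 - γ)⁻¹ * ((N n * M n : ℕ) : ℝ) := by linarith
    _ < ((N n * M n : ℕ) : ℝ) * (ε / 2) + ε / 2 * ((N n * M n : ℕ) : ℝ) := by
        have := mul_lt_mul_of_pos_right hδ (hT n)
        linarith
    _ = _ := by ring

/-! ### Riemann sums -/

/-- The step function takes the value `g k` on `((k-1)h, kh]`. Written as integrals, Riemann sums
become accessible to dominated convergence, which copes with the pole at zero. -/
lemma integral_ceil_eq_sum (g : ℕ → ℝ) {h : ℝ} (hh : 0 < h) (K : ℕ) :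
    IntervalIntegrable (fun x => g ⌈x / h⌉₊) volume 0 (K * h) ∧
      ∫ x in (0 : ℝ)..(K * h), g ⌈x / h⌉₊ = h * ∑ k ∈ Finset.Icc 1 K, g k := by
  induction K with
  | zero => simp
  | succ K ih =>
    have hle : (K : ℝ) * h ≤ ((K + 1 : ℕ) : ℝ) * h := by push_cast; nlinarith
    have hc : Set.EqOn (fun _ => g (K + 1)) (fun x => g ⌈x / h⌉₊)
        (Set.uIoc ((K : ℝ) * h) (((K + 1 : ℕ) : ℝ) * h)) := by
      intro x hx
      rw [Set.uIoc_of_le hle] at hx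
      have : ⌈x / h⌉₊ = K + 1 := by
        rw [Nat.ceil_eq_iff (by omega), lt_div_iff₀ hh, div_le_iff₀ hh]
        simpa using hx
      simp only [this]
    have hi : IntervalIntegrable (fun x => g ⌈x / h⌉₊) volume ((K : ℝ) * h)
        (((K + 1 : ℕ) : ℝ) * h) :=
      (intervalIntegrable_const (c := g (K + 1))).congr hc
    refine ⟨ih.1.trans hi, ?_⟩
    rw [← intervalIntegral.integral_add_adjacent_intervals ih.1 hi, ih.2,
      intervalIntegral.integral_congr_ae (Eventually.of_forall fun x hx => (hc hx).symm),
      intervalIntegral.integral_const, Finset.sum_Icc_succ_top (by omega)]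
    push_cast
    simp only [smul_eq_mul]
    ring

end LongMemory

namespace LongMemory

/-- The midpoint of the `j`-th of `M` equal subintervals of the unit interval. -/
noncomputable def midpt (M j : ℕ) : ℝ := ((j : ℝ) - 1 / 2) / M

lemma midpt_mem {M j : ℕ} (h1 : 1 ≤ j) (h2 : j ≤ M) : midpt M j ∈ Set.Icc (0 : ℝ) 1 := by
  have h1' : (1 : ℝ) ≤ j := by exact_mod_cast h1
  have h2' : (j : ℝ) ≤ M := by exact_mod_cast h2
  have : (0 : ℝ) < M := by linarith
  unfold midpt
  exact ⟨div_nonneg (by linarith) this.le, (div_le_one this).2 (by linarith)⟩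

lemma ceil_mem {M : ℕ} {u : ℝ} (hM : 0 < M) (hu : u ∈ Set.Ioc (0 : ℝ) 1) :
    1 ≤ ⌈u / (1 / (M : ℝ))⌉₊ ∧ ⌈u / (1 / (M : ℝ))⌉₊ ≤ M := by
  have hM' : (0 : ℝ) < M := by exact_mod_cast hM
  rw [div_div_eq_mul_div, div_one]
  refine ⟨Nat.one_le_iff_ne_zero.2 (Nat.ceil_pos.2 (mul_pos hu.1 hM')).ne', Nat.ceil_le.2 ?_⟩
  nlinarith [hu.2]

lemma abs_midpt_ceil_sub_le {M : ℕ} {u : ℝ} (hM : 0 < M) (hu : u ∈ Set.Ioc (0 : ℝ) 1) :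
    |midpt M ⌈u / (1 / (M : ℝ))⌉₊ - u| ≤ 1 / M := by
  have hM' : (0 : ℝ) < M := by exact_mod_cast hM
  have h0 : 0 ≤ u * M := by have := hu.1; positivity
  rw [div_div_eq_mul_div, div_one, midpt]
  have h1 := Nat.le_ceil (u * M)
  have h2 := Nat.ceil_lt_add_one h0
  rw [show ((⌈u * M⌉₊ : ℝ) - 1 / 2) / M - u = ((⌈u * M⌉₊ : ℝ) - 1 / 2 - u * M) / M by
    field_simp, abs_div, abs_of_pos hM']
  gcongr
  rw [abs_le]
  constructor <;> linarith

lemma measurable_comp_ceil (g : ℕ → ℝ) (h : ℝ) : Measurable fun x : ℝ => g ⌈x / h⌉₊ :=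
  (measurable_of_countable g).comp (Nat.measurable_ceil.comp (measurable_id.div_const h))

section Riemann

variable {F : ℝ → ℝ → ℝ} {β B : ℝ}

/-- The frequency moves along with the grid, so joint continuity of `F` is used at `(u, λ)`; the
constant `D` dominates. -/
lemma tendsto_sum_midpt {M : ℕ → ℕ} (hM : Tendsto M atTop atTop) (hM0 : ∀ n, 0 < M n)
    (hF : ContinuousOn (fun p : ℝ × ℝ => F p.1 p.2) (Set.Icc 0 1 ×ˢ Set.Ioc 0 Real.pi))
    {x : ℕ → ℝ} {lam : ℝ} (hx : Tendsto x atTop (𝓝 lam)) (hlam : lam ∈ Set.Ioc 0 Real.pi)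
    (hxm : ∀ n, x n ∈ Set.Ioc 0 Real.pi) {D : ℝ}
    (hD : ∀ n, ∀ u ∈ Set.Icc (0 : ℝ) 1, |F u (x n)| ≤ D) :
    Tendsto (fun n => 1 / (M n : ℝ) * ∑ j ∈ Finset.Icc 1 (M n), F (midpt (M n) j) (x n)) atTop
      (𝓝 (∫ u in (0 : ℝ)..1, F u lam)) := by
  have hM' : ∀ n, (0 : ℝ) < M n := fun n => by exact_mod_cast hM0 n
  have e : ∀ n, 1 / (M n : ℝ) * ∑ j ∈ Finset.Icc 1 (M n), F (midpt (M n) j) (x n) =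
      ∫ u in (0 : ℝ)..1, F (midpt (M n) ⌈u / (1 / (M n : ℝ))⌉₊) (x n) := fun n => by
    have := (integral_ceil_eq_sum (fun j => F (midpt (M n) j) (x n))
      (one_div_pos.2 (hM' n)) (M n)).2
    rw [mul_one_div_cancel (hM' n).ne'] at this
    exact this.symm
  simp_rw [e]
  refine intervalIntegral.tendsto_integral_filter_of_dominated_convergence (fun _ => D)
    (Eventually.of_forall fun n => ?_) (Eventually.of_forall fun n => Eventually.of_forall
      fun u hu => ?_) intervalIntegrable_const (Eventually.of_forall fun u hu => ?_)
  · exact (measurable_comp_ceil (fun j => F (midpt (M n) j) (x n)) _).aestronglyMeasurable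
  · rw [Set.uIoc_of_le zero_le_one] at hu
    have := ceil_mem (hM0 n) hu
    exact hD n _ (midpt_mem this.1 this.2)
  · rw [Set.uIoc_of_le zero_le_one] at hu
    have hu' : u ∈ Set.Icc (0 : ℝ) 1 := ⟨hu.1.le, hu.2⟩
    have h1 : Tendsto (fun n => midpt (M n) ⌈u / (1 / (M n : ℝ))⌉₊) atTop (𝓝 u) := by
      rw [tendsto_iff_dist_tendsto_zero]
      refine squeeze_zero (fun _ => dist_nonneg) (fun n => abs_midpt_ceil_sub_le (hM0 n) hu) ?_
      exact tendsto_one_div_atTop_nhds_zero_nat.comp hM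
    have h2 := (hF (u, lam) ⟨hu', hlam⟩).tendsto
    refine h2.comp (tendsto_nhdsWithin_iff.2 ⟨h1.prodMk_nhds hx, Eventually.of_forall fun n => ?_⟩)
    have := ceil_mem (hM0 n) hu
    exact ⟨midpt_mem this.1 this.2, hxm n⟩

/-- Frequencies are rounded up to the Fourier grid. As `N` is even, `π` is a grid point, so rounding
never leaves `(0, π]`; and rounding up can only decrease `λ^(-β)`. -/
lemma fourierFreq_ceil {N : ℕ} (hN : 0 < N) (hNe : Even N) {lam : ℝ}
    (hl : lam ∈ Set.Ioc 0 Real.pi) :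
    fourierFreq N ⌈lam / (2 * Real.pi / N)⌉₊ ∈ Set.Ioc 0 Real.pi ∧
      lam ≤ fourierFreq N ⌈lam / (2 * Real.pi / N)⌉₊ ∧
      fourierFreq N ⌈lam / (2 * Real.pi / N)⌉₊ ≤ lam + 2 * Real.pi / N := by
  have hN' : (0 : ℝ) < N := by exact_mod_cast hN
  have hpi := Real.pi_pos
  set h : ℝ := 2 * Real.pi / N with hh
  have hh0 : 0 < h := by positivity
  have e : ∀ k : ℕ, fourierFreq N k = k * h := fun k => by rw [hh, fourierFreq]; ring
  have h0 : 0 < lam / h := div_pos hl.1 hh0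
  have hk1 : 1 ≤ ⌈lam / h⌉₊ := Nat.one_le_iff_ne_zero.2 (Nat.ceil_pos.2 h0).ne'
  have hk2 : ⌈lam / h⌉₊ ≤ N / 2 := by
    obtain ⟨r, hr⟩ := hNe
    have hr' : N / 2 = r := by omega
    rw [hr', Nat.ceil_le, div_le_iff₀ hh0, hh]
    have : (N : ℝ) = 2 * r := by rw [hr]; push_cast; ring
    have hr0 : (0 : ℝ) < r := by linarith
    rw [this]
    field_simp
    exact hl.2
  refine ⟨⟨fourierFreq_pos hN hk1, fourierFreq_le_pi hN hk2⟩, ?_, ?_⟩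
  · rw [e, ← div_le_iff₀ hh0]
    exact Nat.le_ceil _
  · rw [e]
    have := (Nat.ceil_lt_add_one h0.le).le
    calc (⌈lam / h⌉₊ : ℝ) * h ≤ (lam / h + 1) * h := by gcongr
      _ = _ := by field_simp

/-- Dominated convergence in `λ` with majorant `B λ^(-β)`, the inner averages being handled by
`tendsto_sum_midpt`. The factor `1/(2π)` is the weight `1/N` divided by the grid spacing `2π/N`. -/
lemma tendsto_riemann_sum {N M : ℕ → ℕ} (hN : Tendsto N atTop atTop) (hN0 : ∀ n, 0 < N n)
    (hNe : ∀ n, Even (N n)) (hM : Tendsto M atTop atTop) (hM0 : ∀ n, 0 < M n)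
    (hF : ContinuousOn (fun p : ℝ × ℝ => F p.1 p.2) (Set.Icc 0 1 ×ˢ Set.Ioc 0 Real.pi))
    (hβ0 : 0 ≤ β) (hβ : β < 1) (hB : 0 ≤ B)
    (hFB : ∀ u ∈ Set.Icc (0 : ℝ) 1, ∀ lam ∈ Set.Ioc 0 Real.pi, |F u lam| ≤ B * lam ^ (-β)) :
    Tendsto (fun n => 1 / ((N n * M n : ℕ) : ℝ) * ∑ k ∈ Finset.Icc 1 (N n / 2),
      ∑ j ∈ Finset.Icc 1 (M n), F (midpt (M n) j) (fourierFreq (N n) k)) atTop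
      (𝓝 (1 / (2 * Real.pi) * ∫ lam in (0 : ℝ)..Real.pi, ∫ u in (0 : ℝ)..1, F u lam)) := by
  have hN' : ∀ n, (0 : ℝ) < N n := fun n => by exact_mod_cast hN0 n
  have hM' : ∀ n, (0 : ℝ) < M n := fun n => by exact_mod_cast hM0 n
  have hpi := Real.pi_pos
  set H : ℕ → ℕ → ℝ := fun n k => 1 / (M n : ℝ) *
    ∑ j ∈ Finset.Icc 1 (M n), F (midpt (M n) j) (fourierFreq (N n) k) with hH
  have e : ∀ n, 1 / ((N n * M n : ℕ) : ℝ) * ∑ k ∈ Finset.Icc 1 (N n / 2),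
      ∑ j ∈ Finset.Icc 1 (M n), F (midpt (M n) j) (fourierFreq (N n) k) =
      1 / (2 * Real.pi) * ∫ lam in (0 : ℝ)..Real.pi, H n ⌈lam / (2 * Real.pi / N n)⌉₊ := fun n => by
    have h := (integral_ceil_eq_sum (H n) (h := 2 * Real.pi / N n)
      (div_pos (by positivity) (hN' n)) (N n / 2)).2
    have hpi' : ((N n / 2 : ℕ) : ℝ) * (2 * Real.pi / N n) = Real.pi := by
      obtain ⟨r, hr⟩ := hNe n
      have hr' : N n / 2 = r := by omega
      have h2 : (N n : ℝ) = 2 * r := by rw [hr]; push_cast; ring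
      have hr0 : (0 : ℝ) < r := by linarith [hN' n]
      rw [hr', h2]
      field_simp
    rw [hpi'] at h
    rw [h, hH]
    simp only
    rw [← Finset.mul_sum]
    have := (hN' n).ne'
    have := (hM' n).ne'
    push_cast
    field_simp
  simp_rw [e]
  refine Tendsto.const_mul _ ?_
  refine intervalIntegral.tendsto_integral_filter_of_dominated_convergence
    (fun lam => B * lam ^ (-β)) (Eventually.of_forall fun n => ?_)
    (Eventually.of_forall fun n => Eventually.of_forall fun lam hl => ?_)
    ((intervalIntegral.intervalIntegrable_rpow' (by linarith)).const_mul B)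
    (Eventually.of_forall fun lam hl => ?_)
  · exact (measurable_comp_ceil (H n) _).aestronglyMeasurable
  · rw [Set.uIoc_of_le hpi.le] at hl
    obtain ⟨h1, h2, -⟩ := fourierFreq_ceil (hN0 n) (hNe n) hl
    have hb : ∀ j ∈ Finset.Icc 1 (M n), |F (midpt (M n) j)
        (fourierFreq (N n) ⌈lam / (2 * Real.pi / N n)⌉₊)| ≤ B * lam ^ (-β) := fun j hj => by
      refine (hFB _ (midpt_mem (Finset.mem_Icc.1 hj).1 (Finset.mem_Icc.1 hj).2) _ h1).trans ?_
      exact mul_le_mul_of_nonneg_left (Real.rpow_le_rpow_of_nonpos hl.1 h2 (by linarith)) hB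
    rw [hH, Real.norm_eq_abs, abs_mul, abs_of_pos (one_div_pos.2 (hM' n)), one_div,
      inv_mul_le_iff₀ (hM' n)]
    refine (Finset.abs_sum_le_sum_abs _ _).trans ((Finset.sum_le_card_nsmul _ _ _ hb).trans ?_)
    simp
  · rw [Set.uIoc_of_le hpi.le] at hl
    have hq := fun n => fourierFreq_ceil (hN0 n) (hNe n) hl
    refine tendsto_sum_midpt hM hM0 hF (D := B * lam ^ (-β)) ?_ hl (fun n => (hq n).1)
      fun n u hu => ?_
    · have hz : Tendsto (fun n => lam + 2 * Real.pi / (N n : ℝ)) atTop (𝓝 lam) := by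
        have := ((tendsto_const_div_atTop_nhds_zero_nat (2 * Real.pi)).comp hN).const_add lam
        simpa using this
      exact tendsto_of_tendsto_of_tendsto_of_le_of_le tendsto_const_nhds hz
        (fun n => (hq n).2.1) fun n => (hq n).2.2
    · refine (hFB u hu _ (hq n).1).trans ?_
      exact mul_le_mul_of_nonneg_left (Real.rpow_le_rpow_of_nonpos hl.1 (hq n).2.1 (by linarith)) hB

/-- Integrability over the full frequency range of a function which is even in the frequency. -/
lemma integrableOn_rectangle
    (hF : ContinuousOn (fun p : ℝ × ℝ => F p.1 p.2) (Set.Icc 0 1 ×ˢ Set.Ioc 0 Real.pi))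
    (hβ : β < 1)
    (hFB : ∀ u ∈ Set.Icc (0 : ℝ) 1, ∀ lam ∈ Set.Ioc 0 Real.pi, |F u lam| ≤ B * lam ^ (-β))
    (heven : ∀ u ∈ Set.Icc (0 : ℝ) 1, ∀ lam ∈ Set.Ioc 0 Real.pi, F u (-lam) = F u lam) :
    IntegrableOn (fun p : ℝ × ℝ => F p.1 p.2) (Set.Icc 0 1 ×ˢ Set.Icc (-Real.pi) Real.pi)
      volume := by
  have hpi := Real.pi_pos
  have hms : MeasurableSet (Set.Icc (0 : ℝ) 1 ×ˢ Set.Ioc 0 Real.pi) :=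
    measurableSet_Icc.prod measurableSet_Ioc
  have hpos : IntegrableOn (fun p : ℝ × ℝ => F p.1 p.2) (Set.Icc 0 1 ×ˢ Set.Ioc 0 Real.pi)
      volume := by
    have hdom : IntegrableOn (fun p : ℝ × ℝ => 1 * (B * p.2 ^ (-β)))
        (Set.Icc 0 1 ×ˢ Set.Ioc 0 Real.pi) volume := by
      rw [IntegrableOn, Measure.volume_eq_prod, ← Measure.prod_restrict]
      refine Integrable.mul_prod (f := fun _ : ℝ => (1 : ℝ)) (g := fun x : ℝ => B * x ^ (-β))
        (integrable_const _) ?_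
      have := (intervalIntegral.intervalIntegrable_rpow' (a := 0) (b := Real.pi)
        (by linarith : -1 < -β)).const_mul B
      rwa [intervalIntegrable_iff_integrableOn_Ioc_of_le hpi.le] at this
    refine Integrable.mono' hdom (hF.aestronglyMeasurable hms) ?_
    refine (ae_restrict_iff' hms).2 (Eventually.of_forall fun p hp => ?_)
    rw [one_mul]
    exact hFB p.1 hp.1 p.2 hp.2
  have hneg : IntegrableOn (fun p : ℝ × ℝ => F p.1 p.2)
      (Set.Icc 0 1 ×ˢ Set.Ico (-Real.pi) 0) volume := by
    have hmp : MeasurePreserving (Prod.map id Neg.neg : ℝ × ℝ → ℝ × ℝ) volume volume := by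
      rw [Measure.volume_eq_prod]
      exact (MeasurePreserving.id volume).prod (Measure.measurePreserving_neg volume)
    have hemb : MeasurableEmbedding (Prod.map id Neg.neg : ℝ × ℝ → ℝ × ℝ) :=
      ((MeasurableEquiv.refl ℝ).prodCongr (MeasurableEquiv.neg ℝ)).measurableEmbedding
    have h := (hmp.integrableOn_comp_preimage hemb).2 hpos
    have hset : (Prod.map id Neg.neg : ℝ × ℝ → ℝ × ℝ) ⁻¹' (Set.Icc 0 1 ×ˢ Set.Ioc 0 Real.pi) =
        Set.Icc 0 1 ×ˢ Set.Ico (-Real.pi) 0 := by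
      ext p
      simp only [Set.mem_preimage, Set.mem_prod, Set.mem_Icc, Set.mem_Ioc, Set.mem_Ico,
        Prod.map_fst, Prod.map_snd, id]
      constructor <;> rintro ⟨h1, h2, h3⟩ <;> exact ⟨h1, by linarith, by linarith⟩
    rw [hset] at h
    refine h.congr_fun (fun p hp => ?_) (measurableSet_Icc.prod measurableSet_Ico)
    simp only [Function.comp_apply, Prod.map_fst, Prod.map_snd, id]
    have hp2 := hp.2
    have := heven p.1 hp.1 (-p.2) ⟨by linarith [hp2.2], by linarith [hp2.1]⟩
    rw [← this, neg_neg]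
  have hzero : IntegrableOn (fun p : ℝ × ℝ => F p.1 p.2) (Set.Icc 0 1 ×ˢ {0}) volume := by
    have : (volume : Measure (ℝ × ℝ)) (Set.Icc 0 1 ×ˢ {0}) = 0 := by
      rw [Measure.volume_eq_prod, Measure.prod_prod]; simp
    rw [IntegrableOn, Measure.restrict_eq_zero.2 this]
    exact integrable_zero_measure
  refine ((hpos.union hneg).union hzero).mono_set fun p hp => ?_
  have h1 := hp.1
  have h2 := hp.2
  rcases lt_trichotomy p.2 0 with h | h | h
  · exact Or.inl (Or.inr ⟨h1, h2.1, h⟩)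
  · exact Or.inr ⟨h1, h⟩
  · exact Or.inl (Or.inl ⟨h1, h, h2.2⟩)

/-- Reduction of the integral over all frequencies to the positive frequencies. -/
lemma integral_symm_eq
    (hF : ContinuousOn (fun p : ℝ × ℝ => F p.1 p.2) (Set.Icc 0 1 ×ˢ Set.Ioc 0 Real.pi))
    (hβ : β < 1)
    (hFB : ∀ u ∈ Set.Icc (0 : ℝ) 1, ∀ lam ∈ Set.Ioc 0 Real.pi, |F u lam| ≤ B * lam ^ (-β))
    (heven : ∀ u ∈ Set.Icc (0 : ℝ) 1, ∀ lam ∈ Set.Ioc 0 Real.pi, F u (-lam) = F u lam) :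
    ∫ lam in (-Real.pi)..Real.pi, ∫ u in (0 : ℝ)..1, F u lam =
      2 * ∫ lam in (0 : ℝ)..Real.pi, ∫ u in (0 : ℝ)..1, F u lam := by
  have hpi := Real.pi_pos
  set G : ℝ → ℝ := fun lam => ∫ u in (0 : ℝ)..1, F u lam with hG
  have hGi : IntegrableOn G (Set.Icc (-Real.pi) Real.pi) volume := by
    have h := integrableOn_rectangle hF hβ hFB heven
    rw [IntegrableOn, Measure.volume_eq_prod, ← Measure.prod_restrict] at h
    refine (h.swap.integral_prod_left).congr (Eventually.of_forall fun lam => ?_)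
    simp only [hG, Function.comp_apply, Prod.swap_prod_mk]
    rw [intervalIntegral.integral_of_le zero_le_one, integral_Icc_eq_integral_Ioc]
  have hGe : ∀ lam ∈ Set.Ioc 0 Real.pi, G (-lam) = G lam := fun lam hl =>
    intervalIntegral.integral_congr fun u hu => by
      rw [Set.uIcc_of_le zero_le_one] at hu
      exact heven u hu lam hl
  have i1 : IntervalIntegrable G volume (-Real.pi) 0 := by
    rw [intervalIntegrable_iff_integrableOn_Icc_of_le (by linarith)]
    exact hGi.mono_set (Set.Icc_subset_Icc_right hpi.le)
  have i2 : IntervalIntegrable G volume 0 Real.pi := by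
    rw [intervalIntegrable_iff_integrableOn_Icc_of_le hpi.le]
    exact hGi.mono_set (Set.Icc_subset_Icc_left (by linarith))
  rw [← intervalIntegral.integral_add_adjacent_intervals i1 i2]
  have h : ∫ lam in (-Real.pi)..0, G lam = ∫ lam in (0 : ℝ)..Real.pi, G lam := by
    have h1 : ∫ lam in (0 : ℝ)..Real.pi, G (-lam) = ∫ lam in (-Real.pi)..0, G lam := by
      rw [intervalIntegral.integral_comp_neg, neg_zero]
    rw [← h1]
    refine intervalIntegral.integral_congr_ae (Eventually.of_forall fun lam hl => ?_)
    rw [Set.uIoc_of_le hpi.le] at hl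
    exact hGe lam hl
  rw [h]
  ring

end Riemann

end LongMemory

namespace LongMemory

/-! ### Comparison of eighth powers -/

/-- If `r ≤ κ y`, then `x` lies within a factor `1 ± κ` of `y` and the eighth powers differ by a
small multiple of `y⁸`. Otherwise `y < r / κ` and both powers are bounded by a multiple of `r⁸`. -/
lemma exists_pow_eight_sub_le {η : ℝ} (hη : 0 < η) :
    ∃ K, 0 ≤ K ∧ ∀ x y r : ℝ, 0 ≤ x → 0 ≤ y → |x - y| ≤ r →
      |x ^ 8 - y ^ 8| ≤ η * y ^ 8 + K * r ^ 8 := by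
  set κ : ℝ := min 1 (η / 255) with hκ
  have hκ0 : 0 < κ := by positivity
  have hκ1 : κ ≤ 1 := min_le_left _ _
  have hκη : 255 * κ ≤ η := by
    have := min_le_right 1 (η / 255)
    linarith
  -- The chord of `t⁸` over `[1, 2]` has slope `2⁸ - 1 = 255`.
  have hup : (1 + κ) ^ 8 ≤ 1 + 255 * κ := by
    have h := (convexOn_pow (𝕜 := ℝ) 8).2 (Set.mem_Ici.2 zero_le_one)
      (Set.mem_Ici.2 zero_le_two) (by linarith : 0 ≤ 1 - κ) hκ0.le (by ring)
    simp only [smul_eq_mul] at h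
    have e : (1 - κ) * 1 + κ * 2 = 1 + κ := by ring
    rw [e] at h
    linarith
  have hlow : 1 - 8 * κ ≤ (1 - κ) ^ 8 := by
    have := one_add_mul_le_pow (a := -κ) (by linarith) 8
    push_cast at this
    rw [← sub_eq_add_neg] at this
    linarith
  refine ⟨(1 / κ + 1) ^ 8, by positivity, fun x y r hx hy hxy => ?_⟩
  have hr : 0 ≤ r := (abs_nonneg _).trans hxy
  obtain ⟨h1, h2⟩ := abs_le.1 hxy
  have hy8 : 0 ≤ y ^ 8 := by positivity
  rcases le_or_gt r (κ * y) with h | h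
  · have hK : 0 ≤ (1 / κ + 1) ^ 8 * r ^ 8 := by positivity
    rw [abs_le]
    constructor
    · have h3 : ((1 - κ) * y) ^ 8 ≤ x ^ 8 :=
        pow_le_pow_left₀ (mul_nonneg (by linarith) hy) (by linarith) 8
      rw [mul_pow] at h3
      nlinarith [mul_le_mul_of_nonneg_right hlow hy8]
    · have h3 : x ^ 8 ≤ ((1 + κ) * y) ^ 8 := pow_le_pow_left₀ hx (by linarith) 8
      rw [mul_pow] at h3
      nlinarith [mul_le_mul_of_nonneg_right hup hy8]
  · have hyr : y ≤ 1 / κ * r := by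
      rw [one_div, inv_mul_eq_div, le_div_iff₀ hκ0]; linarith
    have h3 : x ^ 8 ≤ ((1 / κ + 1) * r) ^ 8 := pow_le_pow_left₀ hx (by linarith) 8
    have h4 : y ^ 8 ≤ ((1 / κ + 1) * r) ^ 8 := pow_le_pow_left₀ hy (by linarith) 8
    rw [mul_pow] at h3 h4
    have hη8 : 0 ≤ η * y ^ 8 := by positivity
    have hx8 : 0 ≤ x ^ 8 := by positivity
    rw [abs_le]
    constructor <;> linarith

/-! ### A weak law for weighted sums -/

/-- The variance of `|Y - E Y|` is nonnegative, which is `(E|Y - E Y|)² ≤ Var Y`. -/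
lemma integral_abs_sub_le_sqrt_variance {Ω : Type*} [MeasurableSpace Ω] {P : Measure Ω}
    [IsProbabilityMeasure P] {Y : Ω → ℝ} (hY : MemLp Y 2 P) :
    ∫ ω, |Y ω - P[Y]| ∂P ≤ Real.sqrt Var[Y; P] := by
  have hD : MemLp (fun ω => |Y ω - P[Y]|) 2 P := (hY.sub (memLp_const _)).abs
  refine Real.le_sqrt_of_sq_le ?_
  have h := variance_nonneg (fun ω => |Y ω - P[Y]|) P
  rw [variance_eq_sub hD] at h
  rw [variance_eq_integral hY.1.aemeasurable]
  simpa [sq_abs] using h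

/-- Pairwise independence already makes the variance additive, and each variance is at most the
second moment. -/
lemma integral_abs_weighted_sum_le {Ω ι : Type*} [MeasurableSpace Ω] {P : Measure Ω}
    [IsProbabilityMeasure P] {Y : ι → Ω → ℝ} {I : Finset ι} {μ K : ℝ} (w : ι → ℝ)
    (hY : ∀ i ∈ I, MemLp (Y i) 2 P) (hind : Set.Pairwise (I : Set ι) fun i j => IndepFun (Y i) (Y j) P)
    (hμ : ∀ i ∈ I, ∫ ω, Y i ω ∂P = μ) (hK : ∀ i ∈ I, ∫ ω, Y i ω ^ 2 ∂P ≤ K) :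
    ∫ ω, |∑ i ∈ I, w i * (Y i ω - μ)| ∂P ≤ Real.sqrt (K * ∑ i ∈ I, w i ^ 2) := by
  have hwY : ∀ i ∈ I, MemLp (fun ω => w i * Y i ω) 2 P := fun i hi => (hY i hi).const_mul _
  have hS : MemLp (∑ i ∈ I, fun ω => w i * Y i ω) 2 P := memLp_finsetSum' _ hwY
  have hvar : Var[∑ i ∈ I, fun ω => w i * Y i ω; P] ≤ K * ∑ i ∈ I, w i ^ 2 := by
    rw [IndepFun.variance_sum hwY fun i hi j hj hij =>
      (hind hi hj hij).comp (measurable_const_mul (w i)) (measurable_const_mul (w j)),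
      Finset.mul_sum]
    refine Finset.sum_le_sum fun i hi => ?_
    rw [variance_const_mul, mul_comm]
    refine mul_le_mul_of_nonneg_right ((variance_le_expectation_sq (hY i hi).1).trans ?_)
      (sq_nonneg _)
    exact hK i hi
  have hmean : P[∑ i ∈ I, fun ω => w i * Y i ω] = ∑ i ∈ I, w i * μ := by
    simp only [Finset.sum_apply]
    rw [integral_finsetSum _ fun i hi => (hwY i hi).integrable (by norm_num)]
    exact Finset.sum_congr rfl fun i hi => by rw [integral_const_mul, hμ i hi]
  refine le_trans (le_of_eq ?_) ((integral_abs_sub_le_sqrt_variance hS).trans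
    (Real.sqrt_le_sqrt hvar))
  rw [hmean]
  refine integral_congr_ae (Eventually.of_forall fun ω => ?_)
  simp only [Finset.sum_apply, ← Finset.sum_sub_distrib, mul_sub]

/-! ### Orthogonality of the Fourier vectors -/

lemma phase_add (x y : ℝ) : phase (x + y) = phase x * phase y := by
  rw [phase, phase, phase, ← Complex.exp_add]
  congr 1; push_cast; ring

lemma conj_phase (x : ℝ) : (starRingEnd ℂ) (phase x) = phase (-x) := by
  rw [phase, phase, ← Complex.exp_conj]
  simp

lemma dvd_of_phase_eq_one {N : ℕ} (hN : 0 < N) {r : ℤ}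
    (h : phase (2 * Real.pi * r / N) = 1) : (N : ℤ) ∣ r := by
  rw [phase, Complex.exp_eq_one_iff] at h
  obtain ⟨n, hn⟩ := h
  have hN' : (N : ℝ) ≠ 0 := by exact_mod_cast hN.ne'
  have h1 := congrArg Complex.im hn
  simp only [Complex.neg_im, Complex.mul_im, Complex.I_re, Complex.ofReal_im, Complex.I_im,
    Complex.ofReal_re, zero_mul, one_mul, zero_add, Complex.intCast_re, Complex.intCast_im,
    Complex.mul_re, Complex.re_ofNat, Complex.im_ofNat, mul_zero, sub_zero, mul_one, add_zero] at h1
  have h2 : (r : ℝ) = ((-n * N : ℤ) : ℝ) := by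
    push_cast
    have hpi := Real.pi_pos.ne'
    field_simp at h1
    linarith
  exact ⟨-n, by rw [mul_comm]; exact_mod_cast h2⟩

lemma sum_phase_pow_eq_zero {N : ℕ} (hN : 0 < N) {r : ℤ} (h : ¬ (N : ℤ) ∣ r) :
    ∑ i ∈ Finset.range N, phase (2 * Real.pi * r / N) ^ i = 0 := by
  have hne : phase (2 * Real.pi * r / N) ≠ 1 := fun h' => h (dvd_of_phase_eq_one hN h')
  rw [geom_sum_eq hne]
  have : phase (2 * Real.pi * r / N) ^ N = 1 := by
    have hN' : (N : ℂ) ≠ 0 := by exact_mod_cast hN.ne'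
    rw [phase, ← Complex.exp_nat_mul, Complex.exp_eq_one_iff]
    refine ⟨-r, ?_⟩
    push_cast
    field_simp
  rw [this, sub_self, zero_div]

/-- The first time point of the `j`-th block. -/
def blockStart (N j : ℕ) : ℤ := N * ((j : ℤ) - 1) + 1

lemma one_le_blockStart {N j : ℕ} (hj : 1 ≤ j) : 1 ≤ blockStart N j := by
  have : 0 ≤ (N : ℤ) * ((j : ℤ) - 1) := mul_nonneg (by omega) (by omega)
  unfold blockStart; omega

lemma blockStart_add_le {N M j : ℕ} (hj : j ≤ M) :
    blockStart N j + N ≤ ((N * M : ℕ) : ℤ) + 1 := by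
  have : (N : ℤ) * ((j : ℤ) - 1) + N ≤ N * M := by
    have := mul_le_mul_of_nonneg_left (by exact_mod_cast hj : (j : ℤ) ≤ M) (by omega : 0 ≤ (N : ℤ))
    linarith
  unfold blockStart
  push_cast
  omega

/-- The normalised Fourier vector of the `j`-th block at the `k`-th Fourier frequency. -/
noncomputable def fourierVec (N j k : ℕ) (m : ℤ) : ℂ :=
  if blockStart N j ≤ m ∧ m < blockStart N j + N then
    ((Real.sqrt N : ℝ) : ℂ)⁻¹ * phase (fourierFreq N k) ^ (m - blockStart N j).toNat else 0

lemma sum_block_ite {N M j : ℕ} (hj : j ∈ Finset.Icc 1 M) (F : ℤ → ℂ) :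
    (∑ m ∈ Finset.Ico 1 (((N * M : ℕ) : ℤ) + 1),
      if blockStart N j ≤ m ∧ m < blockStart N j + N then F m else 0) =
      ∑ i ∈ Finset.range N, F (blockStart N j + i) := by
  have h1 := one_le_blockStart (N := N) (Finset.mem_Icc.1 hj).1
  have h2 := blockStart_add_le (N := N) (Finset.mem_Icc.1 hj).2
  rw [← Finset.sum_filter]
  refine Finset.sum_nbij' (fun m => (m - blockStart N j).toNat) (fun i => blockStart N j + i)
    ?_ ?_ ?_ ?_ ?_
  · intro m hm; simp only [Finset.mem_filter, Finset.mem_Ico, Finset.mem_range] at hm ⊢; omega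
  · intro s hs; simp only [Finset.mem_filter, Finset.mem_Ico, Finset.mem_range] at hs ⊢; omega
  · intro m hm; simp only [Finset.mem_filter, Finset.mem_Ico] at hm; omega
  · intro s hs; simp
  · intro m hm; simp only [Finset.mem_filter, Finset.mem_Ico] at hm; congr 1; omega

lemma sum_fourierVec_mul {N M j : ℕ} (hj : j ∈ Finset.Icc 1 M) (k : ℕ) (G : ℤ → ℂ) :
    ∑ m ∈ Finset.Ico 1 (((N * M : ℕ) : ℤ) + 1), fourierVec N j k m * G m =
      ((Real.sqrt N : ℝ) : ℂ)⁻¹ * ∑ i ∈ Finset.range N,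
        phase (fourierFreq N k) ^ i * G (blockStart N j + i) := by
  have h := sum_block_ite (N := N) hj (fun m => ((Real.sqrt N : ℝ) : ℂ)⁻¹ *
    phase (fourierFreq N k) ^ (m - blockStart N j).toNat * G m)
  simp only [fourierVec, ite_mul, zero_mul]
  rw [h, Finset.mul_sum]
  refine Finset.sum_congr rfl fun i _ => ?_
  rw [add_sub_cancel_left, Int.toNat_natCast, mul_assoc]

lemma linForm_fourierVec {Ω : Type*} (Z : ℤ → Ω → ℝ) {N M j : ℕ} (hj : j ∈ Finset.Icc 1 M) (k : ℕ)
    (ω : Ω) : linForm Z (Finset.Ico 1 (((N * M : ℕ) : ℤ) + 1)) (fourierVec N j k) ω =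
      ((Real.sqrt N : ℝ) : ℂ)⁻¹ * dft (fun s => Z (blockStart N j + s)) N (fourierFreq N k) ω := by
  rw [linForm, sum_fourierVec_mul hj, dft]
  congr 1
  exact Finset.sum_congr rfl fun i _ => mul_comm _ _

lemma fourierVec_blockStart_add {N j i : ℕ} (k : ℕ) (hi : i < N) :
    fourierVec N j k (blockStart N j + i) =
      ((Real.sqrt N : ℝ) : ℂ)⁻¹ * phase (fourierFreq N k) ^ i := by
  rw [fourierVec, if_pos (by omega), add_sub_cancel_left, Int.toNat_natCast]

lemma fourierVec_mul_of_ne {N j j' : ℕ} (hjj : j ≠ j') (k k' : ℕ) (m : ℤ) :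
    fourierVec N j k m = 0 ∨ fourierVec N j' k' m = 0 := by
  by_contra! hc
  obtain ⟨h1, h2⟩ := hc
  have h1' : blockStart N j ≤ m ∧ m < blockStart N j + N := by
    by_contra h; exact h1 (if_neg h)
  have h2' : blockStart N j' ≤ m ∧ m < blockStart N j' + N := by
    by_contra h; exact h2 (if_neg h)
  unfold blockStart at h1' h2'
  apply hjj
  have hN : (0 : ℤ) ≤ N := by omega
  rcases lt_trichotomy j j' with h | h | h
  · have : (N : ℤ) * ((j : ℤ) - 1) + N ≤ N * ((j' : ℤ) - 1) := by
      have := mul_le_mul_of_nonneg_left (by omega : (j : ℤ) ≤ j' - 1) hN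
      linarith
    omega
  · exact h
  · have : (N : ℤ) * ((j' : ℤ) - 1) + N ≤ N * ((j : ℤ) - 1) := by
      have := mul_le_mul_of_nonneg_left (by omega : (j' : ℤ) ≤ j - 1) hN
      linarith
    omega

lemma phase_fourierFreq_mul (N k k' : ℕ) :
    phase (fourierFreq N k) * phase (fourierFreq N k') =
      phase (2 * Real.pi * ((k + k' : ℤ) : ℝ) / N) := by
  rw [← phase_add]
  congr 1
  unfold fourierFreq
  push_cast
  ring

lemma phase_fourierFreq_mul_conj (N k k' : ℕ) :
    phase (fourierFreq N k) * (starRingEnd ℂ) (phase (fourierFreq N k')) =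
      phase (2 * Real.pi * ((k - k' : ℤ) : ℝ) / N) := by
  rw [conj_phase, ← phase_add]
  congr 1
  unfold fourierFreq
  push_cast
  ring

/-- Distinct blocks have disjoint supports; within one block a full geometric sum of the root of
unity of index `k + k'` appears, and `0 < k + k' < N`. The case of equal indices is included: it
makes real and imaginary part uncorrelated with equal variance. The strict bound `k < N / 2`
excludes the real frequency `π`. -/
lemma sum_fourierVec_mul_fourierVec {N M j j' k k' : ℕ} (hN : 0 < N) (hj : j ∈ Finset.Icc 1 M)
    (hk : k ∈ Finset.Ico 1 (N / 2)) (hk' : k' ∈ Finset.Ico 1 (N / 2)) :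
    ∑ m ∈ Finset.Ico 1 (((N * M : ℕ) : ℤ) + 1), fourierVec N j k m * fourierVec N j' k' m = 0 := by
  rcases eq_or_ne j j' with rfl | hjj
  · rw [sum_fourierVec_mul hj]
    have e : ∀ i ∈ Finset.range N, phase (fourierFreq N k) ^ i *
        fourierVec N j k' (blockStart N j + i) =
        ((Real.sqrt N : ℝ) : ℂ)⁻¹ * phase (2 * Real.pi * ((k + k' : ℤ) : ℝ) / N) ^ i := fun i hi => by
      rw [fourierVec_blockStart_add _ (Finset.mem_range.1 hi), ← phase_fourierFreq_mul, mul_pow]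
      ring
    rw [Finset.sum_congr rfl e, ← Finset.mul_sum, sum_phase_pow_eq_zero hN, mul_zero, mul_zero]
    intro hd
    simp only [Finset.mem_Ico] at hk hk'
    have := Int.eq_zero_of_abs_lt_dvd hd (by rw [abs_of_nonneg (by omega)]; omega)
    omega
  · refine Finset.sum_eq_zero fun m _ => ?_
    rcases fourierVec_mul_of_ne (N := N) hjj k k' m with h | h <;> simp [h]

lemma sum_fourierVec_mul_conj {N M j j' k k' : ℕ} (hN : 0 < N) (hj : j ∈ Finset.Icc 1 M)
    (hk : k ∈ Finset.Ico 1 (N / 2)) (hk' : k' ∈ Finset.Ico 1 (N / 2)) (hne : (k, j) ≠ (k', j')) :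
    ∑ m ∈ Finset.Ico 1 (((N * M : ℕ) : ℤ) + 1),
      fourierVec N j k m * (starRingEnd ℂ) (fourierVec N j' k' m) = 0 := by
  rcases eq_or_ne j j' with rfl | hjj
  · rw [sum_fourierVec_mul hj _ (fun m => (starRingEnd ℂ) (fourierVec N j k' m))]
    have e : ∀ i ∈ Finset.range N, phase (fourierFreq N k) ^ i *
        (starRingEnd ℂ) (fourierVec N j k' (blockStart N j + i)) =
        ((Real.sqrt N : ℝ) : ℂ)⁻¹ * phase (2 * Real.pi * ((k - k' : ℤ) : ℝ) / N) ^ i := fun i hi => by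
      rw [fourierVec_blockStart_add _ (Finset.mem_range.1 hi), ← phase_fourierFreq_mul_conj,
        mul_pow, map_mul, map_pow, map_inv₀, Complex.conj_ofReal]
      ring
    rw [Finset.sum_congr rfl e, ← Finset.mul_sum, sum_phase_pow_eq_zero hN, mul_zero, mul_zero]
    intro hd
    simp only [Finset.mem_Ico] at hk hk'
    have := Int.eq_zero_of_abs_lt_dvd hd (by rw [abs_lt]; omega)
    exact hne (by rw [show k = k' by omega])
  · refine Finset.sum_eq_zero fun m _ => ?_
    rcases fourierVec_mul_of_ne (N := N) hjj k k' m with h | h <;> simp [h]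

lemma sum_norm_fourierVec_sq {N M j : ℕ} (hN : 0 < N) (hj : j ∈ Finset.Icc 1 M) (k : ℕ) :
    ∑ m ∈ Finset.Ico 1 (((N * M : ℕ) : ℤ) + 1), ‖fourierVec N j k m‖ ^ 2 = 1 := by
  have hN' : (0 : ℝ) < N := by exact_mod_cast hN
  have h : ((∑ m ∈ Finset.Ico 1 (((N * M : ℕ) : ℤ) + 1), ‖fourierVec N j k m‖ ^ 2 : ℝ) : ℂ) = 1 := by
    rw [Complex.ofReal_sum]
    simp_rw [Complex.ofReal_pow, ← Complex.mul_conj']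
    rw [sum_fourierVec_mul hj _ (fun m => (starRingEnd ℂ) (fourierVec N j k m))]
    have e : ∀ i ∈ Finset.range N, phase (fourierFreq N k) ^ i *
        (starRingEnd ℂ) (fourierVec N j k (blockStart N j + i)) = ((Real.sqrt N : ℝ) : ℂ)⁻¹ :=
      fun i hi => by
        rw [fourierVec_blockStart_add _ (Finset.mem_range.1 hi), map_mul, map_pow, map_inv₀,
          Complex.conj_ofReal, mul_left_comm, ← mul_pow, Complex.mul_conj', norm_phase]
        simp
    rw [Finset.sum_congr rfl e, Finset.sum_const, Finset.card_range, nsmul_eq_mul, mul_left_comm,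
      ← mul_inv, ← Complex.ofReal_mul, Real.mul_self_sqrt hN'.le]
    push_cast
    exact mul_inv_cancel₀ (by exact_mod_cast hN.ne')
  exact_mod_cast h

end LongMemory

/-! ### The periodogram of the innovations and the remainder. -/

namespace LongMemory

variable {Ω : Type*}

/-- The fourth power of the normalised periodogram of the innovations in the `j`-th block. -/
noncomputable def noisePow (Z : ℤ → Ω → ℝ) (N M j k : ℕ) (ω : Ω) : ℝ :=
  ‖linForm Z (Finset.Ico 1 (((N * M : ℕ) : ℤ) + 1)) (fourierVec N j k) ω‖ ^ (2 * 4)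

/-- For even `N` the number `u_j T = N(j-1) + N/2` is an integer, so the floor is exact and the
window is precisely the `j`-th block; no observation is replaced by zero. -/
lemma localPeriodogram_pow_eq (X : ℤ → ℕ → Ω → ℝ) {N M j : ℕ} (hN : 0 < N) (hNe : Even N)
    (hj : j ∈ Finset.Icc 1 M) (lam : ℝ) (ω : Ω) :
    localPeriodogram X (N * M) N (blockMid (N * M) N j) lam ω ^ 4 =
      (1 / (2 * Real.pi * N)) ^ 4 *
        ‖dft (fun s => X (blockStart N j + s) (N * M)) N lam ω‖ ^ 8 := by
  have h1 := one_le_blockStart (N := N) (Finset.mem_Icc.1 hj).1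
  have h2 := blockStart_add_le (N := N) (Finset.mem_Icc.1 hj).2
  have hM : 0 < M := by have := Finset.mem_Icc.1 hj; omega
  have hT : ((N * M : ℕ) : ℝ) ≠ 0 := by exact_mod_cast (Nat.mul_pos hN hM).ne'
  have hfloor : ⌊blockMid (N * M) N j * ((N * M : ℕ) : ℝ)⌋ - ((N / 2 : ℕ) : ℤ) + 1 =
      blockStart N j := by
    obtain ⟨r, hr⟩ := hNe
    have hr' : N / 2 = r := by omega
    have e : blockMid (N * M) N j * ((N * M : ℕ) : ℝ) =
        (((N : ℤ) * ((j : ℤ) - 1) + r : ℤ) : ℝ) := by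
      rw [blockMid, div_mul_cancel₀ _ hT]
      have : (N : ℝ) / 2 = r := by rw [hr]; push_cast; ring
      rw [this]
      push_cast
      ring
    rw [e, Int.floor_intCast, hr', blockStart]
    ring
  have hsum : ∑ s ∈ Finset.range N, (obs X (N * M)
      (⌊blockMid (N * M) N j * ((N * M : ℕ) : ℝ)⌋ - ((N / 2 : ℕ) : ℤ) + 1 + (s : ℤ)) ω : ℂ) *
        Complex.exp (-(Complex.I * (lam : ℂ) * (s : ℂ))) =
      dft (fun s => X (blockStart N j + s) (N * M)) N lam ω := by
    rw [dft, hfloor]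
    refine Finset.sum_congr rfl fun s hs => ?_
    have := Finset.mem_range.1 hs
    rw [exp_eq_phase_pow, obs, if_pos (by omega)]
  rw [localPeriodogram, hsum, mul_pow, ← pow_mul]

/-- The factor `2π` goes into the spectral density, the factor `N` into the normalisation of the
Fourier vector. -/
lemma signal_eq (Z : ℤ → Ω → ℝ) (ψ : ℕ → ℝ → ℝ) {N M j : ℕ} (hN : 0 < N)
    (hj : j ∈ Finset.Icc 1 M) (k : ℕ) (u : ℝ) (ω : Ω) :
    (1 / (2 * Real.pi * N)) ^ 4 * ‖transfer ψ u (fourierFreq N k) *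
        dft (fun s => Z (blockStart N j + s)) N (fourierFreq N k) ω‖ ^ 8 =
      spectralDensity ψ u (fourierFreq N k) ^ 4 * noisePow Z N M j k ω := by
  have hN' : (0 : ℝ) < N := by exact_mod_cast hN
  have hpi := Real.pi_pos
  rw [noisePow, linForm_fourierVec Z hj, spectralDensity, norm_mul, norm_mul, norm_inv,
    Complex.norm_real, Real.norm_eq_abs, abs_of_nonneg (Real.sqrt_nonneg _)]
  have h8 : ((Real.sqrt N)⁻¹) ^ (2 * 4) = (N : ℝ)⁻¹ ^ 4 := by
    rw [pow_mul, inv_pow, Real.sq_sqrt hN'.le]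
  rw [mul_pow ((Real.sqrt N)⁻¹), h8]
  field_simp

lemma noisePow_nonneg (Z : ℤ → Ω → ℝ) (N M j k : ℕ) (ω : Ω) : 0 ≤ noisePow Z N M j k ω := by
  unfold noisePow; positivity

section

variable [MeasurableSpace Ω] {P : Measure Ω} [IsProbabilityMeasure P] {Z : ℤ → Ω → ℝ}

lemma integrable_noisePow (hg : ∀ t, HasLaw (Z t) (gaussianReal 0 1) P) (N M j k : ℕ) :
    Integrable (noisePow Z N M j k) P := integrable_norm_linForm_pow hg _ _ _

/-- Crude, with `3360 = 2^5 * 7!!`, but valid also at the frequency `π`, to which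
`integral_noisePow_eq` does not apply. -/
lemma integral_noisePow_le (hi : iIndepFun Z P) (hg : ∀ t, HasLaw (Z t) (gaussianReal 0 1) P)
    {N M j : ℕ} (hN : 0 < N) (hj : j ∈ Finset.Icc 1 M) (k : ℕ) :
    ∫ ω, noisePow Z N M j k ω ∂P ≤ 3360 := by
  refine (integral_norm_linForm_pow_le hi hg _ _ 4).trans (le_of_eq ?_)
  rw [sum_norm_fourierVec_sq hN hj]
  norm_num [Nat.doubleFactorial]

lemma integral_noisePow_sq_le (hi : iIndepFun Z P)
    (hg : ∀ t, HasLaw (Z t) (gaussianReal 0 1) P)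
    {N M j : ℕ} (hN : 0 < N) (hj : j ∈ Finset.Icc 1 M) (k : ℕ) :
    ∫ ω, noisePow Z N M j k ω ^ 2 ∂P ≤ 2 ^ 9 * ((2 * 8 - 1).doubleFactorial : ℝ) := by
  have h := integral_norm_linForm_pow_le hi hg (Finset.Ico 1 (((N * M : ℕ) : ℤ) + 1))
    (fourierVec N j k) 8
  rw [sum_norm_fourierVec_sq hN hj, one_pow, mul_one] at h
  refine le_trans (le_of_eq ?_) h
  refine integral_congr_ae (Eventually.of_forall fun ω => ?_)
  simp only [noisePow, ← pow_mul]

lemma memLp_noisePow (hg : ∀ t, HasLaw (Z t) (gaussianReal 0 1) P) (N M j k : ℕ) :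
    MemLp (noisePow Z N M j k) 2 P := by
  refine (memLp_two_iff_integrable_sq (integrable_noisePow hg N M j k).1).2 ?_
  refine (integrable_norm_linForm_pow hg (Finset.Ico 1 (((N * M : ℕ) : ℤ) + 1))
    (fourierVec N j k) (2 * 4 * 2)).congr (Eventually.of_forall fun ω => ?_)
  simp only [noisePow, ← pow_mul]

/-- A vanishing sum of squares together with unit norm forces uncorrelated real and imaginary parts
of variance `1/2` each. -/
lemma integral_noisePow_eq (hi : iIndepFun Z P) (hg : ∀ t, HasLaw (Z t) (gaussianReal 0 1) P)
    {N M j k : ℕ} (hN : 0 < N) (hj : j ∈ Finset.Icc 1 M) (hk : k ∈ Finset.Ico 1 (N / 2)) :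
    ∫ ω, noisePow Z N M j k ω ∂P = 24 := by
  have h1 := sum_fourierVec_mul_fourierVec hN (j' := j) hj hk hk
  have h2 := sum_norm_fourierVec_sq hN hj k
  have a1 := congrArg Complex.re h1
  have a2 := congrArg Complex.im h1
  simp only [Complex.re_sum, Complex.im_sum, Complex.mul_re, Complex.mul_im, Complex.zero_re,
    Complex.zero_im, Finset.sum_sub_distrib, Finset.sum_add_distrib] at a1 a2
  simp_rw [← Complex.normSq_eq_norm_sq, Complex.normSq_apply, Finset.sum_add_distrib] at h2
  have a3 : ∑ m ∈ Finset.Ico 1 (((N * M : ℕ) : ℤ) + 1),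
      (fourierVec N j k m).im * (fourierVec N j k m).re =
      ∑ m ∈ Finset.Ico 1 (((N * M : ℕ) : ℤ) + 1),
      (fourierVec N j k m).re * (fourierVec N j k m).im :=
    Finset.sum_congr rfl fun m _ => mul_comm _ _
  refine integral_norm_linForm_pow_eight hi hg _ _ ?_ ?_ ?_
  · simp_rw [sq]; linarith
  · simp_rw [sq]; linarith
  · linarith

lemma indepFun_noisePow (hi : iIndepFun Z P) (hg : ∀ t, HasLaw (Z t) (gaussianReal 0 1) P)
    {N M j j' k k' : ℕ} (hN : 0 < N) (hj : j ∈ Finset.Icc 1 M)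
    (hk : k ∈ Finset.Ico 1 (N / 2)) (hk' : k' ∈ Finset.Ico 1 (N / 2)) (hne : (k, j) ≠ (k', j')) :
    IndepFun (noisePow Z N M j k) (noisePow Z N M j' k') P :=
  indepFun_norm_linForm_pow hi hg _ _ _ (sum_fourierVec_mul_fourierVec hN hj hk hk')
    (sum_fourierVec_mul_conj hN hj hk hk' hne) 4

/-! ### Approximation of the local periodogram -/

/-- The normalised eighth moment of the remainder in the approximation of the discrete Fourier
transform of a block by that of the innovations. -/
noncomputable def remainder (P : Measure Ω) (X : ℤ → ℕ → Ω → ℝ) (Z : ℤ → Ω → ℝ)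
    (ψ : ℕ → ℝ → ℝ) (N M j k : ℕ) : ℝ :=
  (1 / (2 * Real.pi * N)) ^ 4 *
    ∫ ω, ‖dft (fun s => X (blockStart N j + s) (N * M)) N (fourierFreq N k) ω -
      transfer ψ (midpt M j) (fourierFreq N k) *
        dft (fun s => Z (blockStart N j + s)) N (fourierFreq N k) ω‖ ^ 8 ∂P

lemma remainder_nonneg {P : Measure Ω} (X : ℤ → ℕ → Ω → ℝ) (ψ : ℕ → ℝ → ℝ) (N M j k : ℕ) :
    0 ≤ remainder P X Z ψ N M j k :=
  mul_nonneg (by positivity) (integral_nonneg fun ω => by positivity)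

variable {X : ℤ → ℕ → Ω → ℝ} {c : ℤ → ℕ → ℕ → ℝ} {ψ : ℕ → ℝ → ℝ} {a d : ℝ → ℝ} {b C : ℝ}

lemma remainder_le (hX : IsLocallyStationary P Z X c ψ a d) {N M j k : ℕ} (hN : 0 < N)
    (hj : j ∈ Finset.Icc 1 M) {V : ℝ}
    (hV : ∀ᶠ n : ℕ in atTop, ∑ m ∈ Finset.Ico (-(n : ℤ)) N,
      ‖blockCoef c (N * M) (blockStart N j) N n (fourierFreq N k)
        (transfer ψ (midpt M j) (fourierFreq N k)) m‖ ^ 2 ≤ V * N) :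
    remainder P X Z ψ N M j k ≤ 3360 * V ^ 4 := by
  have hN' : (0 : ℝ) < N := by exact_mod_cast hN
  have hpi := Real.two_le_pi
  have h := (hX.integral_norm_dft_sub_le (one_le_blockStart (Finset.mem_Icc.1 hj).1)
    (blockStart_add_le (Finset.mem_Icc.1 hj).2) _ _ hV).2
  calc remainder P X Z ψ N M j k
      ≤ (1 / (2 * Real.pi * N)) ^ 4 * (2 ^ 5 * 105 * (V * N) ^ 4) :=
        mul_le_mul_of_nonneg_left h (by positivity)
    _ = (1 / (2 * Real.pi)) ^ 4 * (3360 * V ^ 4) := by field_simp; ring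
    _ ≤ 1 * (3360 * V ^ 4) := by
        gcongr
        refine pow_le_one₀ (by positivity) ?_
        rw [div_le_one (by positivity)]
        linarith
    _ = _ := one_mul _

/-- The moment bound raises the square sum, of order `λ^(-2b)` after division by `N`, to the fourth
power. -/
lemma exists_remainder_le (hX : IsLocallyStationary P Z X c ψ a d) (H : CoefBound c ψ b C)
    (hb0 : 0 < b) (hb : b < 1 / 2) :
    ∃ K, 0 ≤ K ∧ ∀ N M : ℕ, 0 < N → ∀ k ∈ Finset.Icc 1 (N / 2), ∀ j ∈ Finset.Icc 1 M,
      remainder P X Z ψ N M j k ≤ K * fourierFreq N k ^ (-(8 * b)) := by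
  obtain ⟨K, hK0, hK⟩ := H.sum_norm_sq_blockCoef_le hb0 hb
  refine ⟨3360 * K ^ 4, by positivity, fun N M hN k hk j hj => ?_⟩
  obtain ⟨hk1, hk2⟩ := Finset.mem_Icc.1 hk
  obtain ⟨hj1, hj2⟩ := Finset.mem_Icc.1 hj
  have hl := fourierFreq_pos hN hk1
  refine (remainder_le hX hN hj (V := K * fourierFreq N k ^ (-(2 * b)))
    (Eventually.of_forall fun n => ?_)).trans (le_of_eq ?_)
  · refine (hK (N * M) N (blockStart N j) (midpt M j) _ (one_le_blockStart hj1) hN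
      (blockStart_add_le hj2) (midpt_mem hj1 hj2) hl (fourierFreq_le_pi hN hk2)
      (one_le_mul_fourierFreq hN hk1) n).trans (le_of_eq (by ring))
  · rw [mul_pow, ← Real.rpow_natCast (fourierFreq N k ^ (-(2 * b))) 4, ← Real.rpow_mul hl.le,
      mul_assoc]
    congr 3; push_cast; ring

/-- All time points of a block lie within `N / T = 1 / M` of its midpoint in rescaled time, so the
closeness required by `exists_sum_norm_sq_blockCoef_le` holds for large `n`, uniformly in the block.
-/
lemma eventually_remainder_le (hX : IsLocallyStationary P Z X c ψ a d) (H : CoefBound c ψ b C)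
    (hb0 : 0 < b) (hb : b < 1 / 2) {N M : ℕ → ℕ} (hN0 : ∀ n, 0 < N n)
    (hN : Tendsto N atTop atTop) (hM : Tendsto M atTop atTop) (hM0 : ∀ n, 0 < M n)
    {δ ε : ℝ} (hδ : 0 < δ) (hε : 0 < ε) :
    ∀ᶠ n in atTop, ∀ k ∈ Finset.Icc 1 (N n / 2), ∀ j ∈ Finset.Icc 1 (M n),
      δ ≤ fourierFreq (N n) k → remainder P X Z ψ (N n) (M n) j k ≤ ε := by
  obtain ⟨V, hV0, hV⟩ : ∃ V > 0, 3360 * V ^ 4 ≤ ε := by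
    have h : Tendsto (fun V : ℝ => 3360 * V ^ 4) (𝓝[>] 0) (𝓝 0) := by
      have : Continuous fun V : ℝ => 3360 * V ^ 4 := by fun_prop
      have := this.tendsto 0
      simp only [ne_eq, OfNat.ofNat_ne_zero, not_false_eq_true, zero_pow, mul_zero] at this
      exact this.mono_left nhdsWithin_le_nhds
    obtain ⟨V, hV⟩ := ((h.eventually (ge_mem_nhds hε)).and self_mem_nhdsWithin).exists
    exact ⟨V, hV.2, hV.1⟩
  obtain ⟨η, hη, N₀, hS⟩ := H.exists_sum_norm_sq_blockCoef_le hb0 hb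
    (fun l => (hX.contDiff_ψ l).continuousOn) hδ hV0
  have hMη : ∀ᶠ n in atTop, 1 / (M n : ℝ) ≤ η :=
    (tendsto_one_div_atTop_nhds_zero_nat.comp hM).eventually (ge_mem_nhds hη)
  filter_upwards [hMη, hN.eventually_ge_atTop N₀] with n hn1 hn2 k hk j hj hδl
  obtain ⟨hk1, hk2⟩ := Finset.mem_Icc.1 hk
  obtain ⟨hj1, hj2⟩ := Finset.mem_Icc.1 hj
  have hNr : (0 : ℝ) < N n := by exact_mod_cast hN0 n
  have hN1 : (1 : ℝ) ≤ N n := by exact_mod_cast hN0 n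
  have hMr : (0 : ℝ) < M n := by exact_mod_cast hM0 n
  have hTr : ((N n * M n : ℕ) : ℝ) = N n * M n := by push_cast; ring
  refine (remainder_le hX (hN0 n) hj (eventually_atTop.2 ⟨N n, fun m hm => ?_⟩)).trans hV
  refine hS (N n * M n) (N n) (blockStart (N n) j) (midpt (M n) j) _ (one_le_blockStart hj1) hn2
    (blockStart_add_le hj2) (midpt_mem hj1 hj2) hδl (fourierFreq_le_pi (hN0 n) hk2) ?_ ?_ m hm
  · rw [hTr, ← one_div]
    refine le_trans ?_ hn1
    gcongr
    nlinarith
  · intro s hs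
    refine le_trans ?_ hn1
    have hs1 : (s : ℝ) + 1 ≤ N n := by exact_mod_cast hs
    have hs0 : (0 : ℝ) ≤ s := by positivity
    have e : ((blockStart (N n) j + s : ℤ) : ℝ) / ((N n * M n : ℕ) : ℝ) - midpt (M n) j =
        ((s : ℝ) + 1 - N n / 2) / (N n * M n) := by
      rw [hTr, blockStart, midpt]
      push_cast
      field_simp
      ring
    rw [e, abs_div, abs_of_pos (mul_pos hNr hMr), div_le_div_iff₀ (mul_pos hNr hMr) hMr]
    have : |(s : ℝ) + 1 - N n / 2| ≤ N n := by
      rw [abs_le]; constructor <;> linarith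
    nlinarith

lemma memLp_dft (hX : IsLocallyStationary P Z X c ψ a d) (H : CoefBound c ψ b C)
    (hb0 : 0 < b) (hb : b < 1 / 2) {N M j k : ℕ} (hN : 0 < N) (hk : k ∈ Finset.Icc 1 (N / 2))
    (hj : j ∈ Finset.Icc 1 M) :
    MemLp (fun ω => dft (fun s => X (blockStart N j + s) (N * M)) N (fourierFreq N k) ω -
      transfer ψ (midpt M j) (fourierFreq N k) *
        dft (fun s => Z (blockStart N j + s)) N (fourierFreq N k) ω) 8 P ∧
    MemLp (dft (fun s => X (blockStart N j + s) (N * M)) N (fourierFreq N k)) 8 P := by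
  obtain ⟨K, hK0, hK⟩ := H.sum_norm_sq_blockCoef_le hb0 hb
  obtain ⟨hk1, hk2⟩ := Finset.mem_Icc.1 hk
  obtain ⟨hj1, hj2⟩ := Finset.mem_Icc.1 hj
  have h1 := (hX.integral_norm_dft_sub_le (one_le_blockStart hj1) (blockStart_add_le hj2) _ _
    (Eventually.of_forall fun n => hK (N * M) N (blockStart N j) (midpt M j) _
      (one_le_blockStart hj1) hN (blockStart_add_le hj2) (midpt_mem hj1 hj2)
      (fourierFreq_pos hN hk1) (fourierFreq_le_pi hN hk2) (one_le_mul_fourierFreq hN hk1) n)).1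
  have h2 : MemLp (dft (fun s => Z (blockStart N j + s)) N (fourierFreq N k)) 8 P := by
    refine memLp_finsetSum _ fun s _ => ?_
    have := (((hX.gaussian (blockStart N j + s)).hasGaussianLaw.memLp
      (p := 8) (by simp)).ofReal (K := ℂ)).const_mul (phase (fourierFreq N k) ^ s)
    refine this.ae_eq (Eventually.of_forall fun ω => ?_)
    simp [mul_comm]
  refine ⟨h1, ?_⟩
  have h3 := h1.add (h2.const_mul (transfer ψ (midpt M j) (fourierFreq N k)))
  refine h3.ae_eq (Eventually.of_forall fun ω => ?_)
  simp

end

end LongMemory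

/-! ### `L¹` approximation of the estimator. -/

namespace LongMemory

section

variable {Ω : Type*} [MeasurableSpace Ω] {P : Measure Ω} [IsProbabilityMeasure P]
  {Z : ℤ → Ω → ℝ} {X : ℤ → ℕ → Ω → ℝ} {c : ℤ → ℕ → ℕ → ℝ} {ψ : ℕ → ℝ → ℝ} {a d : ℝ → ℝ} {b C : ℝ}

lemma integrable_localPeriodogram_pow (hX : IsLocallyStationary P Z X c ψ a d)
    (H : CoefBound c ψ b C) (hb0 : 0 < b) (hb : b < 1 / 2) {N M j k : ℕ} (hN : 0 < N)
    (hNe : Even N) (hk : k ∈ Finset.Icc 1 (N / 2)) (hj : j ∈ Finset.Icc 1 M) :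
    Integrable (fun ω => localPeriodogram X (N * M) N (blockMid (N * M) N j)
      (fourierFreq N k) ω ^ 4) P := by
  simp_rw [localPeriodogram_pow_eq X hN hNe hj]
  exact (((memLp_dft hX H hb0 hb hN hk hj).2.integrable_norm_pow (p := 8) (by norm_num))).const_mul _

/-- `L¹` distance between the fourth power of the local periodogram and that of its
approximation by the periodogram of the innovations. -/
lemma integral_abs_localPeriodogram_sub_le (hX : IsLocallyStationary P Z X c ψ a d)
    (H : CoefBound c ψ b C) (hb0 : 0 < b) (hb : b < 1 / 2) {η K : ℝ} (hη : 0 < η)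
    (hK : ∀ x y r : ℝ, 0 ≤ x → 0 ≤ y → |x - y| ≤ r → |x ^ 8 - y ^ 8| ≤ η * y ^ 8 + K * r ^ 8)
    {N M j k : ℕ} (hN : 0 < N) (hNe : Even N) (hk : k ∈ Finset.Icc 1 (N / 2))
    (hj : j ∈ Finset.Icc 1 M) :
    ∫ ω, |localPeriodogram X (N * M) N (blockMid (N * M) N j) (fourierFreq N k) ω ^ 4 -
        spectralDensity ψ (midpt M j) (fourierFreq N k) ^ 4 * noisePow Z N M j k ω| ∂P ≤
      η * (3360 * spectralDensity ψ (midpt M j) (fourierFreq N k) ^ 4) +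
        K * remainder P X Z ψ N M j k := by
  set f := spectralDensity ψ (midpt M j) (fourierFreq N k) with hf
  have hf0 : 0 ≤ f ^ 4 := by positivity
  have hY := integrable_noisePow (P := P) hX.gaussian N M j k
  have hI := integrable_localPeriodogram_pow hX H hb0 hb hN hNe hk hj
  have hR := ((memLp_dft hX H hb0 hb hN hk hj).1.integrable_norm_pow (p := 8) (by norm_num))
  calc _ ≤ ∫ ω, (η * (f ^ 4 * noisePow Z N M j k ω) + K * ((1 / (2 * Real.pi * N)) ^ 4 *
        ‖dft (fun s => X (blockStart N j + s) (N * M)) N (fourierFreq N k) ω -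
          transfer ψ (midpt M j) (fourierFreq N k) *
          dft (fun s => Z (blockStart N j + s)) N (fourierFreq N k) ω‖ ^ 8)) ∂P := by
        refine integral_mono (hI.sub (hY.const_mul _)).abs
          (((hY.const_mul _).const_mul _).add ((hR.const_mul _).const_mul _)) fun ω => ?_
        have hc : 0 ≤ (1 / (2 * Real.pi * N : ℝ)) ^ 4 := by positivity
        have h := mul_le_mul_of_nonneg_left (hK _ _ _ (norm_nonneg _) (norm_nonneg _)
          (abs_norm_sub_norm_le
            (dft (fun s => X (blockStart N j + s) (N * M)) N (fourierFreq N k) ω)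
            (transfer ψ (midpt M j) (fourierFreq N k) *
              dft (fun s => Z (blockStart N j + s)) N (fourierFreq N k) ω))) hc
        rw [← abs_of_nonneg hc, ← abs_mul, abs_of_nonneg hc, mul_sub,
          ← localPeriodogram_pow_eq X hN hNe hj, mul_add, mul_left_comm,
          signal_eq Z ψ hN hj k (midpt M j) ω, mul_left_comm _ K] at h
        exact h
    _ = η * (f ^ 4 * ∫ ω, noisePow Z N M j k ω ∂P) + K * remainder P X Z ψ N M j k := by
        rw [integral_add ((hY.const_mul _).const_mul _) ((hR.const_mul _).const_mul _),
          integral_const_mul, integral_const_mul, integral_const_mul, integral_const_mul, remainder]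
    _ ≤ _ := by
        have := integral_noisePow_le hX.indep hX.gaussian hN hj k
        have := mul_le_mul_of_nonneg_left (mul_le_mul_of_nonneg_left this hf0) hη.le
        linarith

/-- The noise part of the estimator at the inner Fourier frequencies. -/
lemma integral_abs_noise_sum_le (hX : IsLocallyStationary P Z X c ψ a d)
    (H : CoefBound c ψ b C) (hb0 : 0 < b) (hb : b < 1 / 8) {N M : ℕ} (hN : 2 ≤ N) (hM : 0 < M) :
    ∫ ω, |∑ k ∈ Finset.Ico 1 (N / 2), ∑ j ∈ Finset.Icc 1 M,
        spectralDensity ψ (midpt M j) (fourierFreq N k) ^ 4 * (noisePow Z N M j k ω - 24)| ∂P ≤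
      ((N * M : ℕ) : ℝ) * Real.sqrt ((2 ^ 9 * ((2 * 8 - 1).doubleFactorial : ℝ) *
        (C ^ 8 * (C ^ 8 * (1 - 8 * b)⁻¹))) / M) := by
  have hN0 : 0 < N := by omega
  have hMr : (0 : ℝ) < M := by exact_mod_cast hM
  have hNr : (1 : ℝ) ≤ N := by exact_mod_cast hN0
  have hC := H.nonneg
  set K : ℝ := 2 ^ 9 * ((2 * 8 - 1).doubleFactorial : ℝ) with hKdef
  have hK0 : 0 ≤ K := by positivity
  set w : ℕ × ℕ → ℝ := fun i => spectralDensity ψ (midpt M i.2) (fourierFreq N i.1) ^ 4 with hw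
  have hS := sum_sum_le (M := M) hN (by positivity) (by linarith : 8 * b < 1)
    (g := fun j k => w (k, j)) (B := C ^ 8) (fun k hk j hj => by
      obtain ⟨hk1, hk2⟩ := Finset.mem_Icc.1 hk
      obtain ⟨hj1, hj2⟩ := Finset.mem_Icc.1 hj
      exact H.spectralDensity_pow_le (by linarith) (midpt_mem hj1 hj2) (fourierFreq_pos hN0 hk1)
        (fourierFreq_le_pi hN0 hk2)) (by positivity)
  have hw0 : ∀ i, 0 ≤ w i := fun i => by simp only [hw]; positivity
  -- The squared weights have a pole of order `16b`, possibly not integrable. One factor is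
  -- therefore bounded by its maximum, `C⁸ λ^(-8b) ≤ C⁸ N`, and only the other is averaged. The
  -- total `O(N T)` is `O(T² / M)`.
  have hwsq : ∑ i ∈ Finset.Ico 1 (N / 2) ×ˢ Finset.Icc 1 M, w i ^ 2 ≤
      C ^ 8 * N * (C ^ 8 * (1 - 8 * b)⁻¹ * ((N * M : ℕ) : ℝ)) := by
    calc ∑ i ∈ Finset.Ico 1 (N / 2) ×ˢ Finset.Icc 1 M, w i ^ 2
        ≤ ∑ i ∈ Finset.Ico 1 (N / 2) ×ˢ Finset.Icc 1 M, C ^ 8 * N * w i := by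
          refine Finset.sum_le_sum fun i hi => ?_
          obtain ⟨hk, hj⟩ := Finset.mem_product.1 hi
          obtain ⟨hk1, hk2⟩ := Finset.mem_Ico.1 hk
          obtain ⟨hj1, hj2⟩ := Finset.mem_Icc.1 hj
          have hl := fourierFreq_pos hN0 hk1
          rw [sq]
          refine mul_le_mul_of_nonneg_right ?_ (hw0 i)
          refine (H.spectralDensity_pow_le (by linarith) (midpt_mem hj1 hj2) hl
            (fourierFreq_le_pi hN0 hk2.le)).trans ?_
          gcongr
          rw [Real.rpow_neg hl.le, ← Real.inv_rpow hl.le]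
          have h1 : (fourierFreq N i.1)⁻¹ ≤ N :=
            inv_le_of_inv_le₀ (by positivity) (by
              rw [inv_le_iff_one_le_mul₀ (by positivity)]
              linarith [one_le_mul_fourierFreq hN0 hk1])
          calc _ ≤ (N : ℝ) ^ (8 * b) := Real.rpow_le_rpow (by positivity) h1 (by positivity)
            _ ≤ (N : ℝ) ^ (1 : ℝ) := Real.rpow_le_rpow_of_exponent_le hNr (by linarith)
            _ = N := Real.rpow_one _
      _ = C ^ 8 * N * ∑ k ∈ Finset.Ico 1 (N / 2), ∑ j ∈ Finset.Icc 1 M, w (k, j) := by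
          rw [← Finset.mul_sum, Finset.sum_product]
      _ ≤ C ^ 8 * N * ∑ k ∈ Finset.Icc 1 (N / 2), ∑ j ∈ Finset.Icc 1 M, w (k, j) := by
          refine mul_le_mul_of_nonneg_left ?_ (by positivity)
          exact Finset.sum_le_sum_of_subset_of_nonneg Finset.Ico_subset_Icc_self
            fun k _ _ => Finset.sum_nonneg fun j _ => hw0 _
      _ ≤ _ := mul_le_mul_of_nonneg_left hS (by positivity)
  have h := integral_abs_weighted_sum_le (P := P) (Y := fun i : ℕ × ℕ => noisePow Z N M i.2 i.1)
    (I := Finset.Ico 1 (N / 2) ×ˢ Finset.Icc 1 M) (μ := 24) (K := K) w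
    (fun i _ => memLp_noisePow hX.gaussian N M i.2 i.1)
    (fun i hi i' hi' hne => indepFun_noisePow hX.indep hX.gaussian hN0
      (Finset.mem_product.1 (Finset.mem_coe.1 hi)).2 (Finset.mem_product.1 (Finset.mem_coe.1 hi)).1
      (Finset.mem_product.1 (Finset.mem_coe.1 hi')).1 hne)
    (fun i hi => integral_noisePow_eq hX.indep hX.gaussian hN0 (Finset.mem_product.1 hi).2
      (Finset.mem_product.1 hi).1)
    (fun i hi => integral_noisePow_sq_le hX.indep hX.gaussian hN0 (Finset.mem_product.1 hi).2 i.1)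
  simp_rw [Finset.sum_product] at h
  refine h.trans ?_
  have hT0 : (0 : ℝ) ≤ ((N * M : ℕ) : ℝ) := by positivity
  rw [Finset.sum_product] at hwsq
  conv_rhs => rw [← Real.sqrt_sq hT0]
  rw [← Real.sqrt_mul (sq_nonneg _)]
  refine Real.sqrt_le_sqrt ((mul_le_mul_of_nonneg_left hwsq hK0).trans (le_of_eq ?_))
  push_cast
  field_simp

/-- The noise part of the estimator at the frequency `π`. -/
lemma integral_abs_noise_edge_le (hX : IsLocallyStationary P Z X c ψ a d)
    (H : CoefBound c ψ b C) (hb0 : 0 < b) (hb : b < 1 / 8) {N M : ℕ} (hN : 2 ≤ N)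
    (hNe : Even N) :
    ∫ ω, |∑ j ∈ Finset.Icc 1 M, spectralDensity ψ (midpt M j) (fourierFreq N (N / 2)) ^ 4 *
        (noisePow Z N M j (N / 2) ω - 24)| ∂P ≤ M * (C ^ 8 * 3384) := by
  have hN0 : 0 < N := by omega
  have hC := H.nonneg
  have hY := fun j => integrable_noisePow (P := P) hX.gaussian N M j (N / 2)
  have hpi : fourierFreq N (N / 2) = Real.pi := by
    obtain ⟨r, rfl⟩ := hNe
    have hr : (r + r) / 2 = r := by omega
    have hr0 : (r : ℝ) ≠ 0 := by
      have : r ≠ 0 := by omega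
      exact_mod_cast this
    rw [fourierFreq, hr]
    push_cast
    field_simp
    norm_num
  rw [hpi]
  set w : ℕ → ℝ := fun j => spectralDensity ψ (midpt M j) Real.pi ^ 4 with hw
  have hw0 : ∀ j, 0 ≤ w j := fun j => by simp only [hw]; positivity
  have hw1 : ∀ j ∈ Finset.Icc 1 M, w j ≤ C ^ 8 := fun j hj => by
    obtain ⟨hj1, hj2⟩ := Finset.mem_Icc.1 hj
    refine (H.spectralDensity_pow_le (by linarith) (midpt_mem hj1 hj2) Real.pi_pos le_rfl).trans ?_
    refine mul_le_of_le_one_right (by positivity) ?_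
    exact Real.rpow_le_one_of_one_le_of_nonpos (by linarith [Real.two_le_pi]) (by linarith)
  have hterm : ∀ j, Integrable (fun ω => w j * (noisePow Z N M j (N / 2) ω + 24)) P := fun j =>
    ((hY j).add (integrable_const _)).const_mul _
  -- No cancellation is needed for these `M` terms: `|Y - 24| ≤ Y + 24`, and `3384 = 3360 + 24`.
  calc _ ≤ ∫ ω, ∑ j ∈ Finset.Icc 1 M, w j * (noisePow Z N M j (N / 2) ω + 24) ∂P := by
        refine integral_mono (integrable_finsetSum _ fun j _ =>
          ((hY j).sub (integrable_const _)).const_mul _).abs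
          (integrable_finsetSum _ fun j _ => hterm j) fun ω => ?_
        refine (Finset.abs_sum_le_sum_abs _ _).trans (Finset.sum_le_sum fun j _ => ?_)
        rw [abs_mul, abs_of_nonneg (hw0 j)]
        refine mul_le_mul_of_nonneg_left ?_ (hw0 j)
        have := noisePow_nonneg Z N M j (N / 2) ω
        rw [abs_le]
        constructor <;> linarith
    _ = ∑ j ∈ Finset.Icc 1 M, w j * (∫ ω, noisePow Z N M j (N / 2) ω ∂P + 24) := by
        rw [integral_finsetSum _ fun j _ => hterm j]
        refine Finset.sum_congr rfl fun j _ => ?_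
        rw [integral_const_mul, integral_add (hY j) (integrable_const _)]
        simp
    _ ≤ ∑ j ∈ Finset.Icc 1 M, C ^ 8 * 3384 := by
        refine Finset.sum_le_sum fun j hj => ?_
        have h1 := integral_noisePow_le hX.indep hX.gaussian hN0 hj (N / 2)
        have h2 : 0 ≤ ∫ ω, noisePow Z N M j (N / 2) ω ∂P :=
          integral_nonneg fun ω => noisePow_nonneg Z N M j (N / 2) ω
        exact mul_le_mul (hw1 j hj) (by linarith) (by linarith) (by positivity)
    _ = _ := by simp

lemma integrable_tauHatSq (hX : IsLocallyStationary P Z X c ψ a d)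
    (H : CoefBound c ψ b C) (hb0 : 0 < b) (hb : b < 1 / 2) {N M : ℕ} (hN : 0 < N)
    (hNe : Even N) : Integrable (tauHatSq X N M) P :=
  (integrable_finsetSum _ fun _ hk => integrable_finsetSum _ fun _ hj =>
    integrable_localPeriodogram_pow hX H hb0 hb hN hNe hk hj).const_mul _

/-- `L¹` distance between the estimator and the Riemann sum of its limit. -/
lemma integral_abs_tauHatSq_sub_le (hX : IsLocallyStationary P Z X c ψ a d)
    (H : CoefBound c ψ b C) (hb0 : 0 < b) (hb : b < 1 / 8) {η K : ℝ} (hη : 0 < η)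
    (hK : ∀ x y r : ℝ, 0 ≤ x → 0 ≤ y → |x - y| ≤ r → |x ^ 8 - y ^ 8| ≤ η * y ^ 8 + K * r ^ 8)
    {N M : ℕ} (hN : 2 ≤ N) (hNe : Even N) (hM : 0 < M) :
    ∫ ω, |tauHatSq X N M ω - 4 * (1 / ((N * M : ℕ) : ℝ) * ∑ k ∈ Finset.Icc 1 (N / 2),
        ∑ j ∈ Finset.Icc 1 M, spectralDensity ψ (midpt M j) (fourierFreq N k) ^ 4)| ∂P ≤
      1 / 6 * (η * (3360 * (C ^ 8 * (1 - 8 * b)⁻¹)) +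
        K * (1 / ((N * M : ℕ) : ℝ) * ∑ k ∈ Finset.Icc 1 (N / 2), ∑ j ∈ Finset.Icc 1 M,
          remainder P X Z ψ N M j k) +
        Real.sqrt ((2 ^ 9 * ((2 * 8 - 1).doubleFactorial : ℝ) *
          (C ^ 8 * (C ^ 8 * (1 - 8 * b)⁻¹))) / M) + C ^ 8 * 3384 / N) := by
  have hN0 : 0 < N := by omega
  have hNr : (0 : ℝ) < N := by exact_mod_cast hN0
  have hMr : (0 : ℝ) < M := by exact_mod_cast hM
  have hT : (0 : ℝ) < ((N * M : ℕ) : ℝ) := by push_cast; positivity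
  have hb2 : b < 1 / 2 := by linarith
  set T : ℝ := ((N * M : ℕ) : ℝ) with hTdef
  set w : ℕ → ℕ → ℝ := fun k j => spectralDensity ψ (midpt M j) (fourierFreq N k) ^ 4 with hw
  set I : ℕ → ℕ → Ω → ℝ := fun k j ω =>
    localPeriodogram X (N * M) N (blockMid (N * M) N j) (fourierFreq N k) ω ^ 4 with hI
  set Y : ℕ → ℕ → Ω → ℝ := fun k j => noisePow Z N M j k with hY
  set A : Ω → ℝ := fun ω => ∑ k ∈ Finset.Icc 1 (N / 2), ∑ j ∈ Finset.Icc 1 M,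
    |I k j ω - w k j * Y k j ω| with hA
  set B : Ω → ℝ := fun ω => ∑ k ∈ Finset.Ico 1 (N / 2), ∑ j ∈ Finset.Icc 1 M,
    w k j * (Y k j ω - 24) with hB
  set D : Ω → ℝ := fun ω => ∑ j ∈ Finset.Icc 1 M,
    w (N / 2) j * (Y (N / 2) j ω - 24) with hD
  have hYi : ∀ k j, Integrable (Y k j) P := fun k j => integrable_noisePow hX.gaussian N M j k
  have hIi : ∀ k ∈ Finset.Icc 1 (N / 2), ∀ j ∈ Finset.Icc 1 M,
      Integrable (fun ω => |I k j ω - w k j * Y k j ω|) P := fun k hk j hj =>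
    ((integrable_localPeriodogram_pow hX H hb0 hb2 hN0 hNe hk hj).sub
      ((hYi k j).const_mul _)).abs
  have hAi : Integrable A P :=
    integrable_finsetSum _ fun k hk => integrable_finsetSum _ fun j hj => hIi k hk j hj
  have hBi : Integrable B P := integrable_finsetSum _ fun k _ => integrable_finsetSum _ fun j _ =>
    ((hYi k j).sub (integrable_const _)).const_mul _
  have hDi : Integrable D P := integrable_finsetSum _ fun j _ =>
    ((hYi (N / 2) j).sub (integrable_const _)).const_mul _
  -- The centring constant is `4 = 24 / 6`. `A` collects the approximation errors, `B` the noise at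
  -- the inner frequencies, `D` the noise at frequency `π`.
  have hpt : ∀ ω, |tauHatSq X N M ω - 4 * (1 / T * ∑ k ∈ Finset.Icc 1 (N / 2),
      ∑ j ∈ Finset.Icc 1 M, w k j)| ≤ 1 / (6 * T) * (A ω + |B ω| + |D ω|) := by
    intro ω
    have hsplit : ∑ k ∈ Finset.Icc 1 (N / 2), ∑ j ∈ Finset.Icc 1 M, w k j * (Y k j ω - 24) =
        B ω + D ω := by
      rw [← Finset.Ico_insert_right (by omega : 1 ≤ N / 2), Finset.sum_insert (by simp), add_comm]
    have e : tauHatSq X N M ω - 4 * (1 / T * ∑ k ∈ Finset.Icc 1 (N / 2),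
        ∑ j ∈ Finset.Icc 1 M, w k j) = 1 / (6 * T) *
        (∑ k ∈ Finset.Icc 1 (N / 2), ∑ j ∈ Finset.Icc 1 M, (I k j ω - w k j * Y k j ω) +
          (B ω + D ω)) := by
      rw [← hsplit, tauHatSq]
      simp only [mul_sub, Finset.sum_sub_distrib, ← Finset.sum_mul, hI]
      field_simp
      ring
    rw [e, abs_mul, abs_of_nonneg (by positivity : 0 ≤ 1 / (6 * T))]
    refine mul_le_mul_of_nonneg_left ?_ (by positivity)
    refine (abs_add_le _ _).trans ?_
    rw [add_assoc]
    refine add_le_add ?_ (abs_add_le _ _)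
    refine (Finset.abs_sum_le_sum_abs _ _).trans (Finset.sum_le_sum fun k _ => ?_)
    exact Finset.abs_sum_le_sum_abs _ _
  have hAint : ∫ ω, A ω ∂P ≤ η * (3360 * (C ^ 8 * (1 - 8 * b)⁻¹)) * T +
      K * ∑ k ∈ Finset.Icc 1 (N / 2), ∑ j ∈ Finset.Icc 1 M, remainder P X Z ψ N M j k := by
    have hS := sum_sum_le (M := M) hN (by positivity) (by linarith : 8 * b < 1)
      (g := fun j k => w k j) (B := C ^ 8) (fun k hk j hj => by
        obtain ⟨hk1, hk2⟩ := Finset.mem_Icc.1 hk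
        obtain ⟨hj1, hj2⟩ := Finset.mem_Icc.1 hj
        exact H.spectralDensity_pow_le (by linarith) (midpt_mem hj1 hj2) (fourierFreq_pos hN0 hk1)
          (fourierFreq_le_pi hN0 hk2)) (by positivity)
    calc ∫ ω, A ω ∂P = ∑ k ∈ Finset.Icc 1 (N / 2), ∑ j ∈ Finset.Icc 1 M,
          ∫ ω, |I k j ω - w k j * Y k j ω| ∂P := by
          rw [integral_finsetSum _ fun k hk => integrable_finsetSum _ fun j hj => hIi k hk j hj]
          exact Finset.sum_congr rfl fun k hk => integral_finsetSum _ fun j hj => hIi k hk j hj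
      _ ≤ ∑ k ∈ Finset.Icc 1 (N / 2), ∑ j ∈ Finset.Icc 1 M,
          (η * (3360 * w k j) + K * remainder P X Z ψ N M j k) :=
          Finset.sum_le_sum fun k hk => Finset.sum_le_sum fun j hj =>
            integral_abs_localPeriodogram_sub_le hX H hb0 hb2 hη hK hN0 hNe hk hj
      _ = η * (3360 * ∑ k ∈ Finset.Icc 1 (N / 2), ∑ j ∈ Finset.Icc 1 M, w k j) +
          K * ∑ k ∈ Finset.Icc 1 (N / 2), ∑ j ∈ Finset.Icc 1 M, remainder P X Z ψ N M j k := by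
          simp only [Finset.sum_add_distrib, ← Finset.mul_sum]
      _ ≤ η * (3360 * (C ^ 8 * (1 - 8 * b)⁻¹ * T)) +
          K * ∑ k ∈ Finset.Icc 1 (N / 2), ∑ j ∈ Finset.Icc 1 M, remainder P X Z ψ N M j k := by
          gcongr
      _ = _ := by ring
  have hBint := integral_abs_noise_sum_le hX H hb0 hb hN hM
  have hDint := integral_abs_noise_edge_le hX H hb0 hb (M := M) hN hNe
  calc _ ≤ ∫ ω, 1 / (6 * T) * (A ω + |B ω| + |D ω|) ∂P :=
        integral_mono (((integrable_tauHatSq hX H hb0 hb2 hN0 hNe).sub (integrable_const _)).abs)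
          (((hAi.add hBi.abs).add hDi.abs).const_mul _) hpt
    _ = 1 / (6 * T) * (∫ ω, A ω ∂P + ∫ ω, |B ω| ∂P + ∫ ω, |D ω| ∂P) := by
        rw [integral_const_mul, integral_add (f := fun ω => A ω + |B ω|) (hAi.add hBi.abs) hDi.abs,
          integral_add hAi hBi.abs]
    _ ≤ _ := by
        refine (mul_le_mul_of_nonneg_left (add_le_add (add_le_add hAint hBint) hDint)
          (by positivity)).trans (le_of_eq ?_)
        have hTN : T = N * M := by rw [hTdef]; push_cast; ring
        rw [hTN]
        push_cast
        field_simp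

/-- The order of choices matters: `η` is fixed first so that its term stays below `ε / 2`, which
fixes `K`; then the averaged remainder, the noise terms of order `M^(-1/2)` and `1/N`, and the
Riemann error tend to zero. -/
lemma tendsto_integral_abs_tauHatSq_sub (hX : IsLocallyStationary P Z X c ψ a d)
    (H : CoefBound c ψ b C) (hb0 : 0 < b) (hb : b < 1 / 8) {N M : ℕ → ℕ} (hN0 : ∀ n, 0 < N n)
    (hNe : ∀ n, Even (N n)) (hN : Tendsto N atTop atTop) (hM0 : ∀ n, 0 < M n)
    (hM : Tendsto M atTop atTop) {ℓ : ℝ}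
    (hℓ : Tendsto (fun n => 1 / ((N n * M n : ℕ) : ℝ) * ∑ k ∈ Finset.Icc 1 (N n / 2),
      ∑ j ∈ Finset.Icc 1 (M n), spectralDensity ψ (midpt (M n) j) (fourierFreq (N n) k) ^ 4)
      atTop (𝓝 ℓ)) :
    Tendsto (fun n => ∫ ω, |tauHatSq X (N n) (M n) ω - 4 * ℓ| ∂P) atTop (𝓝 0) := by
  have hC := H.nonneg
  have h8 : 0 < 1 - 8 * b := by linarith
  have hb2 : b < 1 / 2 := by linarith
  have hN2 : ∀ n, 2 ≤ N n := fun n => two_le_of_pos_of_even (hN0 n) (hNe n)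
  set Q : ℝ := 3360 * (C ^ 8 * (1 - 8 * b)⁻¹) with hQ
  have hQ0 : 0 ≤ Q := by positivity
  set V : ℝ := 2 ^ 9 * ((2 * 8 - 1).doubleFactorial : ℝ) * (C ^ 8 * (C ^ 8 * (1 - 8 * b)⁻¹))
  set R : ℕ → ℝ := fun n => 1 / ((N n * M n : ℕ) : ℝ) * ∑ k ∈ Finset.Icc 1 (N n / 2),
      ∑ j ∈ Finset.Icc 1 (M n), spectralDensity ψ (midpt (M n) j) (fourierFreq (N n) k) ^ 4 with hR
  obtain ⟨L, hL0, hL⟩ := exists_remainder_le hX H hb0 hb2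
  have hrem := tendsto_average_zero hN2 hM0 (by linarith : 0 < 8 * b) (by linarith : 8 * b < 1) hL0
    (g := fun n j k => remainder P X Z ψ (N n) (M n) j k)
    (fun n k _ j _ => remainder_nonneg X ψ (N n) (M n) j k)
    (fun n k hk j hj => hL (N n) (M n) (hN0 n) k hk j hj)
    (fun δ hδ ε hε => eventually_remainder_le hX H hb0 hb2 hN0 hN hM hM0 hδ hε)
  have hsqrt : Tendsto (fun n => Real.sqrt (V / M n)) atTop (𝓝 0) := by
    have h := (Real.continuous_sqrt.tendsto 0).comp
      ((tendsto_const_div_atTop_nhds_zero_nat V).comp hM)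
    rwa [Real.sqrt_zero] at h
  have hedge : Tendsto (fun n => C ^ 8 * 3384 / (N n : ℝ)) atTop (𝓝 0) :=
    (tendsto_const_div_atTop_nhds_zero_nat _).comp hN
  have hriem : Tendsto (fun n => 4 * |R n - ℓ|) atTop (𝓝 0) := by
    have h := ((hℓ.sub_const ℓ).abs).const_mul 4
    simpa using h
  refine tendsto_order.2 ⟨fun x hx => Eventually.of_forall fun n =>
    hx.trans_le (integral_nonneg fun ω => abs_nonneg _), fun ε hε => ?_⟩
  obtain ⟨η, hη, hηε⟩ : ∃ η > 0, 1 / 6 * (η * Q) < ε / 2 := by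
    refine ⟨ε / (Q + 1), by positivity, ?_⟩
    have : ε / (Q + 1) * Q ≤ ε := by
      rw [div_mul_eq_mul_div, div_le_iff₀ (by positivity)]
      nlinarith
    linarith
  obtain ⟨K, hK0, hK⟩ := exists_pow_eight_sub_le hη
  have hsum : Tendsto (fun n => 1 / 6 * (K * (1 / ((N n * M n : ℕ) : ℝ) *
      ∑ k ∈ Finset.Icc 1 (N n / 2), ∑ j ∈ Finset.Icc 1 (M n),
        remainder P X Z ψ (N n) (M n) j k) + Real.sqrt (V / M n) + C ^ 8 * 3384 / N n) +
      4 * |R n - ℓ|) atTop (𝓝 0) := by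
    have h := ((((hrem.const_mul K).add hsqrt).add hedge).const_mul (1 / 6)).add hriem
    simpa using h
  filter_upwards [hsum.eventually_lt_const (half_pos hε)] with n hn
  have hmain : ∫ ω, |tauHatSq X (N n) (M n) ω - 4 * R n| ∂P ≤ 1 / 6 * (η * Q +
      K * (1 / ((N n * M n : ℕ) : ℝ) * ∑ k ∈ Finset.Icc 1 (N n / 2),
        ∑ j ∈ Finset.Icc 1 (M n), remainder P X Z ψ (N n) (M n) j k) +
      Real.sqrt (V / M n) + C ^ 8 * 3384 / N n) :=
    integral_abs_tauHatSq_sub_le hX H hb0 hb hη hK (hN2 n) (hNe n) (hM0 n)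
  have hτ := integrable_tauHatSq hX H hb0 hb2 (M := M n) (hN0 n) (hNe n)
  calc ∫ ω, |tauHatSq X (N n) (M n) ω - 4 * ℓ| ∂P
      ≤ ∫ ω, (|tauHatSq X (N n) (M n) ω - 4 * R n| + 4 * |R n - ℓ|) ∂P := by
        refine integral_mono (hτ.sub (integrable_const _)).abs
          ((hτ.sub (integrable_const _)).abs.add (integrable_const _)) fun ω => ?_
        have h := abs_sub_le (tauHatSq X (N n) (M n) ω) (4 * R n) (4 * ℓ)
        rwa [← mul_sub 4 (R n), abs_mul 4, abs_of_pos (by norm_num : (0 : ℝ) < 4)] at h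
    _ = ∫ ω, |tauHatSq X (N n) (M n) ω - 4 * R n| ∂P + 4 * |R n - ℓ| := by
        rw [integral_add (f := fun ω => |tauHatSq X (N n) (M n) ω - 4 * R n|)
          (hτ.sub (integrable_const _)).abs (integrable_const _)]
        simp
    _ < ε := by linarith

end

end LongMemory

/-! ### Convergence in probability of the estimator. -/

theorem theorem3p4 {Ω : Type*} [MeasurableSpace Ω] (P : Measure Ω) [IsProbabilityMeasure P]
    (Z : ℤ → Ω → ℝ) (X : ℤ → ℕ → Ω → ℝ) (c : ℤ → ℕ → ℕ → ℝ)
    (ψ : ℕ → ℝ → ℝ) (a d : ℝ → ℝ)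
    (hX : LongMemory.IsLocallyStationary P Z X c ψ a d)
    (hd : LongMemory.dInf d < 1 / 8)
    (N M : ℕ → ℕ)
    (hNpos : ∀ n, 0 < N n) (hMpos : ∀ n, 0 < M n) (hNeven : ∀ n, Even (N n))
    (hN : Tendsto N atTop atTop)
    (hNT : Tendsto (fun n => (N n : ℝ) / ((N n * M n : ℕ) : ℝ)) atTop (𝓝 0))
    (hTN : Tendsto (fun n => Real.sqrt ((N n * M n : ℕ) : ℝ) /
      (N n : ℝ) ^ (1 - 4 * LongMemory.dInf d)) atTop (𝓝 0)) :
    IntegrableOn (fun p : ℝ × ℝ => LongMemory.spectralDensity ψ p.1 p.2 ^ 4)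
        (Set.Icc 0 1 ×ˢ Set.Icc (-Real.pi) Real.pi) volume ∧
      TendstoInMeasure P (fun n ω => LongMemory.tauHatSq X (N n) (M n) ω) atTop
        (fun _ => 1 / Real.pi * ∫ lam in (-Real.pi)..Real.pi, ∫ u in (0 : ℝ)..1,
          LongMemory.spectralDensity ψ u lam ^ 4) := by
  have hd0 := hX.dInf_nonneg
  -- Above `d_∞` to absorb logarithms, below `1/8` so that `λ^(-8b)` is integrable at zero.
  obtain ⟨b, hb1, hb2⟩ := exists_between hd
  have hb0 : 0 < b := hd0.trans_lt hb1
  obtain ⟨C, H⟩ := hX.exists_coefBound hb1 (by linarith)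
  have hC := H.nonneg
  have hF : ContinuousOn (fun p : ℝ × ℝ => LongMemory.spectralDensity ψ p.1 p.2 ^ 4)
      (Set.Icc 0 1 ×ˢ Set.Ioc 0 Real.pi) := hX.contDiff_f.continuousOn.pow 4
  have hFB : ∀ u ∈ Set.Icc (0 : ℝ) 1, ∀ lam ∈ Set.Ioc 0 Real.pi,
      |LongMemory.spectralDensity ψ u lam ^ 4| ≤ C ^ 8 * lam ^ (-(8 * b)) := fun u hu lam hl => by
    rw [abs_of_nonneg (by positivity)]
    exact H.spectralDensity_pow_le (by linarith) hu hl.1 hl.2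
  have heven : ∀ u ∈ Set.Icc (0 : ℝ) 1, ∀ lam ∈ Set.Ioc 0 Real.pi,
      LongMemory.spectralDensity ψ u (-lam) ^ 4 = LongMemory.spectralDensity ψ u lam ^ 4 :=
    fun u hu lam hl => by rw [H.spectralDensity_neg (by linarith) hu hl.1 hl.2]
  refine ⟨LongMemory.integrableOn_rectangle (F := fun u lam =>
    LongMemory.spectralDensity ψ u lam ^ 4) hF (by linarith) hFB heven, ?_⟩
  -- `N / T` is `1 / M`, so its convergence to zero says that the number of blocks grows.
  have hM : Tendsto M atTop atTop := by
    rw [← tendsto_natCast_atTop_iff (R := ℝ)]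
    have h : Tendsto (fun n => ((M n : ℝ))⁻¹) atTop (𝓝[>] 0) := by
      refine tendsto_nhdsWithin_iff.2 ⟨hNT.congr fun n => ?_, Eventually.of_forall fun n =>
        Set.mem_Ioi.2 (inv_pos.2 (Nat.cast_pos.2 (hMpos n)))⟩
      have h1 : (N n : ℝ) ≠ 0 := by exact_mod_cast (hNpos n).ne'
      push_cast
      rw [div_mul_cancel_left₀ h1]
    exact h.inv_tendsto_nhdsGT_zero.congr fun n => by simp
  have hriem := LongMemory.tendsto_riemann_sum (F := fun u lam =>
    LongMemory.spectralDensity ψ u lam ^ 4) hN hNpos hNeven hM hMpos hF (by positivity)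
    (by linarith) (by positivity) hFB
  have hL1 := LongMemory.tendsto_integral_abs_tauHatSq_sub hX H hb0 hb2 hNpos hNeven hN hMpos hM
    hriem
  have hlim : 4 * (1 / (2 * Real.pi) * ∫ lam in (0 : ℝ)..Real.pi, ∫ u in (0 : ℝ)..1,
      LongMemory.spectralDensity ψ u lam ^ 4) =
      1 / Real.pi * ∫ lam in (-Real.pi)..Real.pi, ∫ u in (0 : ℝ)..1,
        LongMemory.spectralDensity ψ u lam ^ 4 := by
    rw [LongMemory.integral_symm_eq (F := fun u lam =>
      LongMemory.spectralDensity ψ u lam ^ 4) hF (by linarith) hFB heven]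
    have := Real.pi_ne_zero
    field_simp
    ring
  rw [hlim] at hL1
  have hτ : ∀ n, Integrable (LongMemory.tauHatSq X (N n) (M n)) P := fun n =>
    LongMemory.integrable_tauHatSq hX H hb0 (by linarith) (hNpos n) (hNeven n)
  -- `L¹` convergence is stronger than convergence in probability.
  refine tendstoInMeasure_of_tendsto_eLpNorm (p := 1) one_ne_zero (fun n => (hτ n).1)
    aestronglyMeasurable_const ?_
  have h := ENNReal.tendsto_ofReal hL1
  rw [ENNReal.ofReal_zero] at h
  refine h.congr fun n => ?_
  rw [eLpNorm_one_eq_lintegral_enorm, ← ofReal_integral_norm_eq_lintegral_enorm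
    ((hτ n).sub (integrable_const _))]
  simp only [Pi.sub_apply, Real.norm_eq_abs]
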